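/- **Setting.** Let $F$ be an absolutely continuous probability distribution on $\Theta=[0,1]$ with mean $m^\varnothing=\int\theta\,dF(\theta)$, and let $0<k<m^\varnothing$. An agent searches without recall. In each period in which he still searches he pays the search cost $k$ and samples a good of unknown quality $\theta\sim F$, i.i.d. across periods. A single broker makes an offer $(p,G)$, where $p\ge 0$ is a price and $G$ is a mean-preserving contraction of $F$ (a distribution of posterior means). The agent either buys, paying $p$ and drawing a posterior mean $m\sim G$, or takes the null offer, which is free and has $m=m^\varnothing$. The realization $m$ is public. The agent then either consumes the sampled good, which has expected quality $m$, and stops, or continues to the next period. There is no discounting: the broker's payoff is the expected sum of the payments she receives until the agent stops, and the agent's payoff is the expected quality of the consumed good minus the expected sum of the prices and search costs he pays until he stops. Behavioral strategies may depend on the whole public history of offers, purchase decisions and realized posterior means. An equilibrium is a sequentially rational strategy profile: after every history (on or off path) no change of strategy increases the broker's payoff or the agent's payoff, and the agent's strategy is also optimal after every offer and after every realized posterior mean. Let $\mathcal E(1,k)\subseteq\mathbb R^2$ be the set of equilibrium payoff pairs $(y_1,y_2)=(\text{broker},\text{agent})$, let $\underline u_k=m^\varnothing-k$, let $\bar u_k$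 be the unique solution $u$ of $k=\int_u^1(\theta-u)\,dF(\theta)$, and let $$\mathcal F(1,k)=\{(y_1,y_2)\in\mathbb R_+^2:\ y_2\ge\underline u_k,\ y_1+y_2\le\bar u_k\}.$$ **Proposition.** For every $k\in(0,m^\varnothing)$ the payoff $\bar u_k$ is well defined, and there is a unique $k^*\in(0,m^\varnothing)$ such that for all $k\in(0,m^\varnothing)$ $$\mathcal E(1,k)=\begin{cases}\mathcal F(1,k) & \text{if } k\le k^*,\\ \{(\bar u_k-\underline u_k,\ \underline u_k)\} & \text{if } k>k^*.\end{cases}$$ -/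

import Mathlib

open MeasureTheory ProbabilityTheory
open scoped ENNReal NNReal

noncomputable section

namespace PersuadedSearch

/-- The set `Θ = [0, 1]` of match values (and of posterior means). -/
abbrev Quality : Type := Set.Icc (0 : ℝ) 1

/-- The prior mean `m^∅ = ∫ θ dF(θ)`, as a real number. -/
def priorMean (F : ProbabilityMeasure Quality) : ℝ := ∫ θ, (θ : ℝ) ∂(F : Measure Quality)

theorem priorMean_mem (F : ProbabilityMeasure Quality) : priorMean F ∈ Set.Icc (0 : ℝ) 1 := by
  have hint : Integrable (fun θ : Quality => (θ : ℝ)) (F : Measure Quality) :=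
    Integrable.of_bound measurable_subtype_coe.aestronglyMeasurable 1
      (Filter.Eventually.of_forall fun θ => by
        rw [Real.norm_eq_abs, abs_of_nonneg θ.2.1]; exact θ.2.2)
  refine ⟨integral_nonneg fun θ => θ.2.1, ?_⟩
  have h := integral_mono hint (integrable_const (1 : ℝ)) fun θ => θ.2.2
  simpa [priorMean] using h

/-- The prior mean as a point of `Θ`. -/
def priorMeanPt (F : ProbabilityMeasure Quality) : Quality := ⟨priorMean F, priorMean_mem F⟩

/-- `G` is a mean-preserving contraction of `F`: it is dominated by `F` in the convex order.
(Convex functions on the line are continuous, so all these integrals over `[0, 1]` converge; the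
linear functions `x ↦ x` and `x ↦ -x` force the means to be equal.) -/
def IsMeanPreservingContraction (G F : ProbabilityMeasure Quality) : Prop :=
  ∀ φ : ℝ → ℝ, ConvexOn ℝ Set.univ φ →
    ∫ m, φ (m : ℝ) ∂(G : Measure Quality) ≤ ∫ θ, φ (θ : ℝ) ∂(F : Measure Quality)

/-- The set `𝒢(F)` of feasible posterior-mean distributions (signals). -/
abbrev Signal (F : ProbabilityMeasure Quality) : Type :=
  {G : ProbabilityMeasure Quality // IsMeanPreservingContraction G F}

/-- The set `𝒪 = ℝ₊ × 𝒢(F)` of take-it-or-leave-it offers: a price and a signal. -/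
abbrev Offer (F : ProbabilityMeasure Quality) : Type := ℝ≥0 × Signal F

/-- What becomes public in one period: the offer, the purchase decision (`true`: buy from the
broker, `false`: take the null offer), and the realized posterior mean. -/
abbrev Outcome (F : ProbabilityMeasure Quality) : Type := Offer F × Bool × Quality

/-- One full period of play: the offer, the purchase decision, the realized posterior mean, and the
stopping decision (`true`: consume the good and stop, `false`: continue to search). -/
abbrev Stage (F : ProbabilityMeasure Quality) : Type := Offer F × Bool × Quality × Bool

/-- Histories at the beginning of a period before which `t` periods have been played (`t = 0` is the
first period). -/
abbrev History (F : ProbabilityMeasure Quality) (t : ℕ) : Type := Fin t → Outcome F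

variable {F : ProbabilityMeasure Quality}

/-- The part of a period of play that enters the history. -/
def Stage.outcome (s : Stage F) : Outcome F := (s.1, s.2.1, s.2.2.1)

/-- The realized posterior mean. -/
def Stage.signal (s : Stage F) : Quality := s.2.2.1

/-- Whether the agent stops. -/
def Stage.stops (s : Stage F) : Bool := s.2.2.2

/-- The payment from the agent to the broker: the price if the agent buys, else `0`. -/
def Stage.payment (s : Stage F) : ℝ≥0∞ := if s.2.1 = true then ((s.1.1 : ℝ≥0) : ℝ≥0∞) else 0

/-! ### Strategies -/

/-- A behavioral strategy of the broker: a (measurable) map from histories to distributions over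
offers. -/
structure BrokerStrategy (F : ProbabilityMeasure Quality) where
  offer : ∀ t, Kernel (History F t) (Offer F)
  markov : ∀ t, IsMarkovKernel (offer t)

/-- A behavioral strategy of the agent: a purchase decision after each history and offer, and a
stopping decision after each history, offer, purchase decision and realized posterior mean. A
distribution over the two decisions `true` (stop) and `false` (continue) is the same as a probability
of continuing. -/
structure AgentStrategy (F : ProbabilityMeasure Quality) where
  buy : ∀ t, Kernel (History F t × Offer F) Bool
  halt : ∀ t, Kernel (((History F t × Offer F) × Bool) × Quality) Bool
  buy_markov : ∀ t, IsMarkovKernel (buy t)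
  halt_markov : ∀ t, IsMarkovKernel (halt t)

instance (σ : BrokerStrategy F) (t : ℕ) : IsMarkovKernel (σ.offer t) := σ.markov t
instance (a : AgentStrategy F) (t : ℕ) : IsMarkovKernel (a.buy t) := a.buy_markov t
instance (a : AgentStrategy F) (t : ℕ) : IsMarkovKernel (a.halt t) := a.halt_markov t

/-! ### The law of play -/

/-- The distribution of the posterior mean: the signal on offer if the agent buys it, and the
distribution degenerate on the prior mean if he takes the null offer. -/
def signalLaw (o : Offer F) (w : Bool) : Measure Quality :=
  if w = true then ((o.2.1 : ProbabilityMeasure Quality) : Measure Quality)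
  else Measure.dirac (priorMeanPt F)

theorem measurable_signalLaw :
    Measurable fun x : Offer F × Bool => signalLaw x.1 x.2 := by
  refine Measurable.ite (measurable_snd (measurableSet_singleton true)) ?_ measurable_const
  exact measurable_subtype_coe.comp
    (measurable_subtype_coe.comp (measurable_snd.comp measurable_fst))

/-- The realization of the posterior mean given a history, an offer and a purchase decision. -/
def signalKernel (F : ProbabilityMeasure Quality) (t : ℕ) :
    Kernel ((History F t × Offer F) × Bool) Quality where
  toFun x := signalLaw x.1.2 x.2
  measurable' := measurable_signalLaw.comp
    ((measurable_snd.comp measurable_fst).prodMk measurable_snd)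

instance (t : ℕ) : IsMarkovKernel (signalKernel F t) where
  isProbabilityMeasure x := by
    change IsProbabilityMeasure (signalLaw x.1.2 x.2)
    unfold signalLaw
    split_ifs <;> infer_instance

/-- The law of the agent's purchase, the posterior mean and the stopping decision, given a history
and an offer. -/
def responseKernel (a : AgentStrategy F) (t : ℕ) :
    Kernel (History F t × Offer F) (Bool × Quality × Bool) :=
  a.buy t ⊗ₖ (signalKernel F t ⊗ₖ a.halt t)

instance (a : AgentStrategy F) (t : ℕ) : IsMarkovKernel (responseKernel a t) := by
  unfold responseKernel; infer_instance

/-- The law of one period of play given the history. -/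
def stageKernel (b : BrokerStrategy F) (a : AgentStrategy F) (t : ℕ) :
    Kernel (History F t) (Stage F) :=
  b.offer t ⊗ₖ responseKernel a t

instance (b : BrokerStrategy F) (a : AgentStrategy F) (t : ℕ) :
    IsMarkovKernel (stageKernel b a t) := by
  unfold stageKernel; infer_instance

/-- The history recorded by periods `0, …, n` of play. -/
def record (n : ℕ) (x : ∀ _ : Finset.Iic n, Stage F) : History F (n + 1) :=
  fun j => (x ⟨j, Finset.mem_Iic.2 (Nat.lt_succ_iff.1 j.2)⟩).outcome

theorem measurable_record (n : ℕ) : Measurable (record (F := F) n) := by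
  refine measurable_pi_lambda _ fun j => ?_
  have h : Measurable (Stage.outcome (F := F)) := by
    unfold Stage.outcome; fun_prop
  exact h.comp (measurable_pi_apply _)

/-- The law of period `n + 1` given periods `0, …, n`. -/
def nextKernel (b : BrokerStrategy F) (a : AgentStrategy F) (n : ℕ) :
    Kernel (∀ _ : Finset.Iic n, Stage F) (Stage F) :=
  (stageKernel b a (n + 1)).comap (record n) (measurable_record n)

instance (b : BrokerStrategy F) (a : AgentStrategy F) (n : ℕ) :
    IsMarkovKernel (nextKernel b a n) := by
  unfold nextKernel; infer_instance

/-- Play in periods `0, …, t`: the history `h`, along which the agent always continued, followed by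
the period `s`. -/
def extend {t : ℕ} (h : History F t) (s : Stage F) : ∀ _ : Finset.Iic t, Stage F :=
  fun i => if hi : (i : ℕ) < t then
    ((h ⟨i, hi⟩).1, (h ⟨i, hi⟩).2.1, (h ⟨i, hi⟩).2.2, false) else s

theorem measurable_extend {t : ℕ} (h : History F t) : Measurable (extend h) := by
  refine measurable_pi_lambda _ fun i => ?_
  unfold extend
  split_ifs
  · exact measurable_const
  · exact measurable_id

/-- The law (by the Ionescu-Tulcea theorem) of the path of play that is induced by the strategies
`b` and `a` from the history `h` on, where `μ` is the law of the period that follows `h`. Coordinate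
`τ` is the period of play number `τ`; coordinates below `t` are those of `h`. Coordinates after the
agent has stopped are fictitious and enter no payoff. -/
def pathLaw (b : BrokerStrategy F) (a : AgentStrategy F) {t : ℕ} (h : History F t)
    (μ : Measure (Stage F)) : Measure (ℕ → Stage F) :=
  (μ.map (extend h)).bind (Kernel.traj (X := fun _ => Stage F) (nextKernel b a) t)

/-! ### Payoffs -/

/-- Period `τ` is played: `t ≤ τ ≤ T`, where `T` is the first period from `t` on in which the agent
stops. -/
def Reached (t τ : ℕ) (ω : ℕ → Stage F) : Prop :=
  t ≤ τ ∧ ∀ s, t ≤ s → s < τ → (ω s).stops = false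

open scoped Classical in
/-- All payments to the broker from period `t` until the agent stops. -/
def totalPayment (t : ℕ) (ω : ℕ → Stage F) : ℝ≥0∞ :=
  ∑' τ, if Reached t τ ω then (ω τ).payment else 0

open scoped Classical in
/-- All prices and search costs paid by the agent from period `t` until he stops. It is infinite if
he never stops (and `k > 0`). -/
def totalCost (k : ℝ) (t : ℕ) (ω : ℕ → Stage F) : ℝ≥0∞ :=
  ∑' τ, if Reached t τ ω then (ω τ).payment + ENNReal.ofReal k else 0

open scoped Classical in
/-- The (expected) quality of the good with which the agent stops, and `0` if he never stops. The sum
has at most one nonzero term. -/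
def matchValue (t : ℕ) (ω : ℕ → Stage F) : ℝ≥0∞ :=
  ∑' τ, if Reached t τ ω ∧ (ω τ).stops = true then ENNReal.ofReal ((ω τ).signal : ℝ) else 0

/-- The broker's expected payoff under a law of the path of play from period `t` on. -/
def brokerValue (t : ℕ) (P : Measure (ℕ → Stage F)) : EReal :=
  ((∫⁻ ω, totalPayment t ω ∂P : ℝ≥0∞) : EReal)

/-- The agent's expected payoff, in `[-∞, 1]`, under a law of the path of play from period `t` on: the
expected match value (at most `1`) minus the expected total cost (possibly infinite). -/
def agentValue (k : ℝ) (t : ℕ) (P : Measure (ℕ → Stage F)) : EReal :=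
  ((∫⁻ ω, matchValue t ω ∂P : ℝ≥0∞) : EReal) - ((∫⁻ ω, totalCost k t ω ∂P : ℝ≥0∞) : EReal)

/-- Path law from the beginning of a period, given the history `h`. -/
def lawAt (b : BrokerStrategy F) (a : AgentStrategy F) {t : ℕ} (h : History F t) :
    Measure (ℕ → Stage F) :=
  pathLaw b a h (stageKernel b a t h)

/-- Path law given the history `h` and the current offer `o`. -/
def lawAtOffer (b : BrokerStrategy F) (a : AgentStrategy F) {t : ℕ} (h : History F t)
    (o : Offer F) : Measure (ℕ → Stage F) :=
  pathLaw b a h ((responseKernel a t (h, o)).map fun r => (o, r))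

/-- Path law given the history `h`, the current offer `o`, the purchase decision `w` and the realized
posterior mean `m`. -/
def lawAtSignal (b : BrokerStrategy F) (a : AgentStrategy F) {t : ℕ} (h : History F t)
    (o : Offer F) (w : Bool) (m : Quality) : Measure (ℕ → Stage F) :=
  pathLaw b a h ((a.halt t (((h, o), w), m)).map fun d => (o, w, m, d))

/-! ### Equilibrium -/

/-- Sequential rationality of the strategy profile `(b, a)` of the monopolist and the agent, at every
point, on or off path, at which a player moves. At `(h, o, w, m)` the current price and search cost
are sunk; they are counted on both sides. -/
structure IsEquilibrium (k : ℝ) (b : BrokerStrategy F) (a : AgentStrategy F) : Prop where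
  broker : ∀ (t : ℕ) (h : History F t) (b' : BrokerStrategy F),
    brokerValue t (lawAt b' a h) ≤ brokerValue t (lawAt b a h)
  agent : ∀ (t : ℕ) (h : History F t) (a' : AgentStrategy F),
    agentValue k t (lawAt b a' h) ≤ agentValue k t (lawAt b a h)
  agent_purchase : ∀ (t : ℕ) (h : History F t) (o : Offer F) (a' : AgentStrategy F),
    agentValue k t (lawAtOffer b a' h o) ≤ agentValue k t (lawAtOffer b a h o)
  agent_stopping : ∀ (t : ℕ) (h : History F t) (o : Offer F) (w : Bool) (m : Quality)
    (a' : AgentStrategy F),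
    agentValue k t (lawAtSignal b a' h o w m) ≤ agentValue k t (lawAtSignal b a h o w m)

/-- The empty history, at the beginning of the first period. -/
def emptyHistory (F : ProbabilityMeasure Quality) : History F 0 := Fin.elim0

/-- The set `ℰ(1, k)` of equilibrium payoff profiles (broker's payoff, agent's payoff) under
monopoly. -/
def equilibriumPayoffs (F : ProbabilityMeasure Quality) (k : ℝ) : Set (ℝ × ℝ) :=
  {y | ∃ (b : BrokerStrategy F) (a : AgentStrategy F), IsEquilibrium k b a ∧
    brokerValue 0 (lawAt b a (emptyHistory F)) = ((y.1 : ℝ) : EReal) ∧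
    agentValue k 0 (lawAt b a (emptyHistory F)) = ((y.2 : ℝ) : EReal)}

/-- The equation `k = ∫_u^1 (θ - u) dF(θ)` for the McCall payoff `u = ū_k`. -/
def IsMcCallPayoff (F : ProbabilityMeasure Quality) (k u : ℝ) : Prop :=
  k = ∫ θ in {θ : Quality | u ≤ (θ : ℝ)}, ((θ : ℝ) - u) ∂(F : Measure Quality)

/-- The autarky payoff `m^∅ - k`. -/
def autarkyPayoff (F : ProbabilityMeasure Quality) (k : ℝ) : ℝ := priorMean F - k

/-- The feasible payoff set `ℱ(1, k)`, where `ubar` is the McCall payoff. -/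
def feasiblePayoffs (F : ProbabilityMeasure Quality) (k ubar : ℝ) : Set (ℝ × ℝ) :=
  {y | 0 ≤ y.1 ∧ 0 ≤ y.2 ∧ autarkyPayoff F k ≤ y.2 ∧ y.1 + y.2 ≤ ubar}

end PersuadedSearch

end

noncomputable section

namespace PersuadedSearch

variable {F : ProbabilityMeasure Quality}

/-! Write `L` for the autarky payoff `m^∅ - k` and `u` for the McCall payoff, so that `E max(θ, u) =
u + k`. Prices are transfers, so at every history the two equilibrium payoffs sum to at most `u`
(`McCall.value_add_value_le`); and the agent secures `L` by declining the offer and consuming at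
once (`IsEquilibrium.autarky_add_cost_le`). Hence every equilibrium payoff is feasible. The regime
depends on whether one free, fully revealing sample followed by autarky, worth `E max(θ, L)`, beats
`u`.

Suppose `E max(θ, L) ≤ u`. A two-state automaton then supports every feasible payoff
(`Plan.oneShotOptimal`). In the absorbing inactive state the agent has `L`, and the broker gets all
of `u - L` by pooling the match values below `u`. In the active state, from the second period on,
full information is free and the agent has `u`. An offer that departs from the plan is rejected:
rejection keeps the active state and `u`, while purchase leads to the inactive state and is worth at
most `E max(θ, L) ≤ u` even at price zero. Deviations therefore earn the broker nothing. In the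
first period a signal that is informative with probability `α`, sold at price `y₁`, spreads the
surplus as desired. Since `F` has no atoms, the realized mean itself shows whether the signal was
informative, and the automaton conditions on that.

Suppose `u < E max(θ, L)`. Let `v` be the infimum of the broker's payoffs over all histories; the
agent then never has more than `u - v`. An offer that beats `max(m^∅, u - v)` even when followed by
autarky is surely bought (`IsEquilibrium.buy_eq_zero`), and a mean below `L` surely leads to more
search (`IsEquilibrium.halt_eq_zero`). Full revelation then forces `u - v ≤ m^∅`, and the pooling
signal forces `v ≥ u - L` (`IsEquilibrium.gains_le_payment`). With the surplus bound this fixes both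
payoffs.

The condition `E max(θ, L) ≤ u` is equivalent to an inequality between `k` and a function of `k` in
which `u` no longer occurs. The difference is continuous and antitone in `k` and changes sign, which
gives the threshold (`exists_threshold`).

Strategies are compared through recursively defined total rewards. `lintegral_pathLaw` identifies
them with integrals over the path space, and super- and subharmonic bounds reduce sequential
rationality to the absence of profitable one-shot deviations (`OneShotOptimal.isEquilibrium`).
Inequalities between net payoffs are kept in additive form, because values lie in `ℝ≥0∞`. -/

/-- The history `h` followed by the outcome `x` of one more period. -/
def snoc {t : ℕ} (h : History F t) (x : Outcome F) : History F (t + 1) :=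
  fun j => if hj : (j : ℕ) < t then h ⟨j, hj⟩ else x

theorem measurable_snoc {t : ℕ} :
    Measurable fun z : History F t × Outcome F => snoc z.1 z.2 := by
  refine measurable_pi_lambda _ fun j => ?_
  unfold snoc
  split_ifs
  · exact (measurable_pi_apply _).comp measurable_fst
  · exact measurable_snd

theorem measurable_outcome : Measurable (Stage.outcome (F := F)) := by
  unfold Stage.outcome; fun_prop

theorem measurable_stops : Measurable (Stage.stops (F := F)) := by
  unfold Stage.stops; fun_prop

theorem measurable_ite_stops {α : Type*} [MeasurableSpace α] {g : α → Stage F} {φ : α → ℝ≥0∞}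
    (hg : Measurable g) (hφ : Measurable φ) :
    Measurable fun x => if (g x).stops = true then 0 else φ x :=
  Measurable.ite (measurable_stops.comp hg (measurableSet_singleton true)) measurable_const hφ

/-! ### Recursive total rewards and verification inequalities -/

/-- The expected reward `f` collected in period `t + d`, if it is reached, from the history `h`. -/
def reward (b : BrokerStrategy F) (a : AgentStrategy F) (f : Stage F → ℝ≥0∞) :
    ℕ → ∀ t : ℕ, History F t → ℝ≥0∞
  | 0, t, h => ∫⁻ s, f s ∂stageKernel b a t h
  | d + 1, t, h => ∫⁻ s, (if s.stops = true then 0 else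
      reward b a f d (t + 1) (snoc h s.outcome)) ∂stageKernel b a t h

/-- The expected total reward from the history `h` on. -/
def value (b : BrokerStrategy F) (a : AgentStrategy F) (f : Stage F → ℝ≥0∞) (t : ℕ)
    (h : History F t) : ℝ≥0∞ := ∑' d, reward b a f d t h

/-- The expected reward of the first `n` periods from the history `h` on. -/
def partialValue (b : BrokerStrategy F) (a : AgentStrategy F) (f : Stage F → ℝ≥0∞) (n t : ℕ)
    (h : History F t) : ℝ≥0∞ := ∑ d ∈ Finset.range n, reward b a f d t h

section

variable {b : BrokerStrategy F} {a : AgentStrategy F} {f g : Stage F → ℝ≥0∞}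

theorem measurable_ite_reward {t : ℕ} {φ : History F (t + 1) → ℝ≥0∞} (hφ : Measurable φ) :
    Measurable fun z : History F t × Stage F =>
      if z.2.stops = true then 0 else φ (snoc z.1 z.2.outcome) :=
  measurable_ite_stops measurable_snd
    (hφ.comp (measurable_snoc.comp (measurable_fst.prodMk (measurable_outcome.comp measurable_snd))))

theorem measurable_continuation {t : ℕ} {φ : History F (t + 1) → ℝ≥0∞} (hφ : Measurable φ)
    (h : History F t) :
    Measurable fun s : Stage F => if s.stops = true then 0 else φ (snoc h s.outcome) :=
  (measurable_ite_reward hφ).comp measurable_prodMk_left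

theorem measurable_reward (hf : Measurable f) (d t : ℕ) : Measurable (reward b a f d t) := by
  induction d generalizing t with
  | zero => exact hf.lintegral_kernel
  | succ d ih => exact (measurable_ite_reward (ih (t + 1))).lintegral_kernel_prod_right'

theorem measurable_value (hf : Measurable f) (t : ℕ) : Measurable (value b a f t) :=
  Measurable.tsum fun d => measurable_reward hf d t

theorem measurable_partialValue (hf : Measurable f) (n t : ℕ) :
    Measurable (partialValue b a f n t) :=
  Finset.measurable_fun_sum _ fun d _ => measurable_reward hf d t

theorem value_eq_iSup (t : ℕ) (h : History F t) :
    value b a f t h = ⨆ n, partialValue b a f n t h := ENNReal.tsum_eq_iSup_nat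

theorem partialValue_le_value (n t : ℕ) (h : History F t) :
    partialValue b a f n t h ≤ value b a f t h := ENNReal.sum_le_tsum _

theorem partialValue_succ (hf : Measurable f) (n t : ℕ) (h : History F t) :
    partialValue b a f (n + 1) t h =
      ∫⁻ s, (f s + if s.stops = true then 0 else
        partialValue b a f n (t + 1) (snoc h s.outcome)) ∂stageKernel b a t h := by
  rw [lintegral_add_left hf]
  unfold partialValue
  rw [Finset.sum_range_succ', add_comm]
  congr 1
  simp only [reward]
  rw [← lintegral_finsetSum _ fun d _ => measurable_continuation (measurable_reward hf d _) h]
  refine lintegral_congr fun s => ?_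
  split_ifs <;> simp

theorem value_eq (hf : Measurable f) (t : ℕ) (h : History F t) :
    value b a f t h =
      ∫⁻ s, (f s + if s.stops = true then 0 else
        value b a f (t + 1) (snoc h s.outcome)) ∂stageKernel b a t h := by
  rw [lintegral_add_left hf]
  unfold value
  rw [tsum_eq_zero_add' ENNReal.summable]
  congr 1
  simp only [reward]
  rw [← lintegral_tsum fun d => (measurable_continuation (measurable_reward hf d _) h).aemeasurable]
  refine lintegral_congr fun s => ?_
  split_ifs <;> simp

theorem reward_congr {b' : BrokerStrategy F} {a' : AgentStrategy F} {t₀ : ℕ}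
    (hk : ∀ t, t₀ ≤ t → stageKernel b a t = stageKernel b' a' t) (d t : ℕ) (ht : t₀ ≤ t) :
    reward b a f d t = reward b' a' f d t := by
  induction d generalizing t with
  | zero => ext h; simp only [reward, hk t ht]
  | succ d ih => ext h; simp only [reward, hk t ht, ih (t + 1) (by omega)]

/-- A value only sees the kernels from the current period on, so a deviation confined to an earlier
period leaves it unchanged. -/
theorem value_congr {b' : BrokerStrategy F} {a' : AgentStrategy F} {t₀ : ℕ}
    (hk : ∀ t, t₀ ≤ t → stageKernel b a t = stageKernel b' a' t) (t : ℕ) (ht : t₀ ≤ t) :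
    value b a f t = value b' a' f t := by
  ext h; simp only [value, reward_congr hk _ t ht]

theorem value_add (hf : Measurable f) (t : ℕ) (h : History F t) :
    value b a (fun s => f s + g s) t h = value b a f t h + value b a g t h := by
  unfold value
  rw [← ENNReal.tsum_add]
  congr 1
  ext d
  induction d generalizing t with
  | zero => exact lintegral_add_left hf _
  | succ d ih =>
    simp only [reward]
    rw [← lintegral_add_left (measurable_continuation (measurable_reward hf d _) h)]
    refine lintegral_congr fun s => ?_
    split_ifs <;> simp [ih]

theorem value_const_mul (c : ℝ≥0∞) (hf : Measurable f) (t : ℕ) (h : History F t) :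
    value b a (fun s => c * f s) t h = c * value b a f t h := by
  unfold value
  rw [← ENNReal.tsum_mul_left]
  congr 1
  ext d
  induction d generalizing t with
  | zero => exact lintegral_const_mul _ hf
  | succ d ih =>
    simp only [reward]
    rw [← lintegral_const_mul _ (measurable_continuation (measurable_reward hf d _) h)]
    refine lintegral_congr fun s => ?_
    split_ifs <;> simp [ih]

/-- Verification of an upper bound for the difference of two total rewards. -/
theorem value_le_of_superharmonic (hf : Measurable f) (hg : Measurable g)
    {W : ∀ t, History F t → ℝ≥0∞}
    (hW : ∀ t h, ∫⁻ s, (f s + if s.stops = true then 0 else W (t + 1) (snoc h s.outcome))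
      ∂stageKernel b a t h ≤ W t h + ∫⁻ s, g s ∂stageKernel b a t h) (t : ℕ) (h : History F t) :
    value b a f t h ≤ W t h + value b a g t h := by
  rw [value_eq_iSup]
  -- Rewards are nonnegative, so finite horizons suffice. The continuation bound beyond the horizon
  -- is also nonnegative and can be dropped, so no condition at infinity is needed.
  refine iSup_le fun n => le_trans ?_ (add_le_add_right (partialValue_le_value n t h) _)
  induction n generalizing t with
  | zero => simp [partialValue]
  | succ n ih =>
    rw [partialValue_succ hf, partialValue_succ hg, lintegral_add_left hg, ← add_assoc]
    refine le_trans ?_ (add_le_add_left (hW t h) _)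
    rw [← lintegral_add_right _ (measurable_continuation (measurable_partialValue hg n _) h)]
    refine lintegral_mono fun s => ?_
    dsimp only
    split_ifs
    · simp
    · rw [add_assoc]
      exact add_le_add_right (ih _ _) _

theorem reward_one_le_one (d t : ℕ) (h : History F t) : reward b a (fun _ => 1) d t h ≤ 1 := by
  induction d generalizing t with
  | zero => simp [reward]
  | succ d ih =>
    refine (lintegral_mono (g := fun _ => 1) fun s => ?_).trans (by simp)
    dsimp only
    split_ifs
    · exact zero_le_one
    · exact ih _ _

/-- Iterating the one-period inequality leaves a remainder, the bound `W` on the event that search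
outlasts the horizon. It is at most `c` times the probability of reaching period `t + n`; this is
cruder than period `t + n + 1`, but it is a term of the series for the expected duration. -/
theorem add_partialValue_le (hf : Measurable f) (hg : Measurable g)
    {W : ∀ t, History F t → ℝ≥0∞} {c : ℝ≥0∞} (hWc : ∀ t h, W t h ≤ c)
    (hW : ∀ t h, W t h + ∫⁻ s, g s ∂stageKernel b a t h ≤
      ∫⁻ s, (f s + if s.stops = true then 0 else W (t + 1) (snoc h s.outcome)) ∂stageKernel b a t h)
    (n t : ℕ) (h : History F t) :
    W t h + partialValue b a g (n + 1) t h ≤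
      partialValue b a f (n + 1) t h + c * reward b a (fun _ => 1) n t h := by
  induction n generalizing t with
  | zero =>
    simp only [partialValue, zero_add, Finset.sum_range_one]
    refine (hW t h).trans ?_
    rw [lintegral_add_left hf]
    refine add_le_add_right ?_ _
    simp only [reward, lintegral_const, measure_univ, mul_one]
    refine (lintegral_mono (g := fun _ => c) fun s => ?_).trans (by simp)
    dsimp only
    split_ifs
    · exact zero_le
    · exact hWc _ _
  | succ n ih =>
    rw [partialValue_succ hf, partialValue_succ hg, lintegral_add_left hg, ← add_assoc]
    refine (add_le_add_left (hW t h) _).trans ?_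
    rw [reward, ← lintegral_const_mul _ (measurable_continuation
      (measurable_reward measurable_const n _) h), ← lintegral_add_right _ (measurable_continuation
        (measurable_partialValue hg (n + 1) _) h), ← lintegral_add_right _
      ((measurable_continuation (measurable_reward measurable_const n _) h).const_mul c)]
    refine lintegral_mono fun s => ?_
    dsimp only
    split_ifs
    · simp
    · rw [add_assoc, add_assoc]
      exact add_le_add_right (ih _ _) _

/-- Verification of a lower bound for the difference of two total rewards, if play ends in
finite expected time. -/
theorem add_value_le_of_subharmonic (hf : Measurable f) (hg : Measurable g)
    {W : ∀ t, History F t → ℝ≥0∞} {c : ℝ≥0∞} (hc : c ≠ ∞) (hWc : ∀ t h, W t h ≤ c)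
    (hW : ∀ t h, W t h + ∫⁻ s, g s ∂stageKernel b a t h ≤
      ∫⁻ s, (f s + if s.stops = true then 0 else W (t + 1) (snoc h s.outcome)) ∂stageKernel b a t h)
    (t : ℕ) (h : History F t) (hfin : value b a (fun _ => 1) t h ≠ ∞) :
    W t h + value b a g t h ≤ value b a f t h := by
  have h0 := ENNReal.tendsto_atTop_zero_of_tsum_ne_top hfin
  have hS : ∀ φ : Stage F → ℝ≥0∞, Filter.Tendsto (fun n => partialValue b a φ (n + 1) t h)
      Filter.atTop (nhds (value b a φ t h)) := fun φ =>
    (Filter.tendsto_add_atTop_iff_nat 1).2 ENNReal.summable.hasSum.tendsto_sum_nat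
  have hr := ENNReal.Tendsto.const_mul h0 (Or.inr hc)
  have := le_of_tendsto_of_tendsto' ((hS g).const_add (W t h)) ((hS f).add hr)
    fun n => add_partialValue_le hf hg hWc hW n t h
  simpa using this

/-- Play ends in finite expected time if a continuation payoff that is net of a positive flow cost
is bounded. -/
theorem value_one_ne_top (hf : Measurable f) (hg : Measurable g)
    {W : ∀ t, History F t → ℝ≥0∞} {c : ℝ≥0∞} (hc : c ≠ ∞) (hWc : ∀ t h, W t h ≤ c)
    (hW : ∀ t h, W t h + ∫⁻ s, g s ∂stageKernel b a t h ≤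
      ∫⁻ s, (f s + if s.stops = true then 0 else W (t + 1) (snoc h s.outcome)) ∂stageKernel b a t h)
    {κ : ℝ≥0∞} (hκ : κ ≠ 0) (hgκ : ∀ s, κ ≤ g s) (t : ℕ) (h : History F t)
    (hfv : value b a f t h ≠ ∞) : value b a (fun _ => 1) t h ≠ ∞ := by
  -- The crude remainder bound `c` already makes the total of `g` finite. Since every period played
  -- costs at least `κ`, the expected number of periods is finite too.
  have hgfin : value b a g t h ≤ value b a f t h + c := by
    rw [value_eq_iSup]
    refine iSup_le fun n => ?_
    calc partialValue b a g n t h ≤ partialValue b a g (n + 1) t h :=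
          Finset.sum_le_sum_of_subset (Finset.range_subset_range.2 n.le_succ)
      _ ≤ W t h + partialValue b a g (n + 1) t h := le_add_self
      _ ≤ _ := add_partialValue_le hf hg hWc hW n t h
      _ ≤ _ := add_le_add (partialValue_le_value _ _ _)
          (mul_le_of_le_one_right' (reward_one_le_one _ _ _))
  have hmono : κ * value b a (fun _ => 1) t h ≤ value b a g t h := by
    rw [← value_const_mul κ measurable_const]
    have := value_le_of_superharmonic (b := b) (a := a) (f := fun _ => κ * 1) (g := g)
      measurable_const hg (W := fun _ _ => 0) (fun t h => by
        simp only [ite_self, add_zero, zero_add]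
        exact lintegral_mono fun s => by simpa using hgκ s) t h
    simpa using this
  intro htop
  rw [htop, ENNReal.mul_top hκ] at hmono
  exact ENNReal.add_ne_top.2 ⟨hfv, hc⟩ (top_le_iff.1 (hmono.trans hgfin))

end

/-! ### Expected rewards along the path of play -/

section

variable (b : BrokerStrategy F) (a : AgentStrategy F) {f : Stage F → ℝ≥0∞}

/-- Play in periods `0, …, n` followed by period `n + 1`. -/
def append {n : ℕ} (x : ∀ _ : Finset.Iic n, Stage F) (s : Stage F) :
    ∀ _ : Finset.Iic (n + 1), Stage F :=
  fun i => if hi : (i : ℕ) ≤ n then x ⟨i, Finset.mem_Iic.2 hi⟩ else s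

theorem record_append {n : ℕ} (x : ∀ _ : Finset.Iic n, Stage F) (s : Stage F) :
    record (n + 1) (append x s) = snoc (record n x) s.outcome := by
  ext1 j
  by_cases hj : (j : ℕ) < n + 1
  · simp [record, append, snoc, hj, Nat.lt_succ_iff.1 hj]
  · simp [record, append, snoc, hj, show ¬ (j : ℕ) ≤ n by omega]

theorem record_extend {t : ℕ} (h : History F t) (s : Stage F) :
    record t (extend h s) = snoc h s.outcome := by
  ext1 j
  by_cases hj : (j : ℕ) < t
  · simp [record, extend, snoc, hj, Stage.outcome]
  · simp [record, extend, snoc, hj]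

/-- The Markov property in one step: draw period `n + 1`, then restart the trajectory from the
lengthened past. -/
theorem lintegral_traj_succ {Φ : (ℕ → Stage F) → ℝ≥0∞} (hΦ : Measurable Φ) (n : ℕ)
    (x : ∀ _ : Finset.Iic n, Stage F) :
    ∫⁻ ω, Φ ω ∂Kernel.traj (X := fun _ => Stage F) (nextKernel b a) n x =
      ∫⁻ s, ∫⁻ ω, Φ ω ∂Kernel.traj (X := fun _ => Stage F) (nextKernel b a) (n + 1) (append x s)
        ∂nextKernel b a n x := by
  rw [← Kernel.traj_comp_partialTraj (X := fun _ => Stage F) (κ := nextKernel b a) (Nat.le_succ n),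
    Kernel.lintegral_comp _ _ _ hΦ]
  have hm : Measurable fun y => ∫⁻ ω, Φ ω
      ∂Kernel.traj (X := fun _ => Stage F) (nextKernel b a) (n + 1) y := hΦ.lintegral_kernel
  have hI : Measurable (IicProdIoc (X := fun _ => Stage F) n (n + 1)) := measurable_IicProdIoc
  have hmI : Measurable fun y => ∫⁻ ω, Φ ω ∂Kernel.traj (X := fun _ => Stage F) (nextKernel b a)
      (n + 1) (IicProdIoc (X := fun _ => Stage F) n (n + 1) y) := hm.comp hI
  have hmx : Measurable fun y => ∫⁻ ω, Φ ω ∂Kernel.traj (X := fun _ => Stage F) (nextKernel b a)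
      (n + 1) (IicProdIoc (X := fun _ => Stage F) n (n + 1) (x, y)) :=
    hmI.comp measurable_prodMk_left
  rw [Nat.succ_eq_add_one, Kernel.partialTraj_succ_self, Kernel.lintegral_map _ hI _ hm,
    Kernel.lintegral_id_prod hmI, Kernel.lintegral_map _ (MeasurableEquiv.measurable _) _ hmx]
  refine lintegral_congr fun s => ?_
  congr 2
  ext1 i
  simp only [IicProdIoc, append]
  split_ifs with hi
  · rfl
  · obtain ⟨i, h1⟩ := i
    have : i = n + 1 := by simp at hi h1; omega
    subst this
    rfl

open scoped Classical in
theorem measurable_reached (hf : Measurable f) (t τ : ℕ) :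
    Measurable fun ω : ℕ → Stage F => if Reached t τ ω then f (ω τ) else 0 := by
  refine Measurable.ite ?_ (hf.comp (measurable_pi_apply τ)) measurable_const
  have : {ω : ℕ → Stage F | Reached t τ ω} =
      {_ω | t ≤ τ} ∩ ⋂ s, ⋂ (_ : t ≤ s), ⋂ (_ : s < τ), {ω | (ω s).stops = false} := by
    ext ω; simp [Reached]
  rw [this]
  refine (MeasurableSet.const _).inter (MeasurableSet.iInter fun s => MeasurableSet.iInter fun _ =>
    MeasurableSet.iInter fun _ => ?_)
  exact measurable_stops.comp (measurable_pi_apply s) (measurableSet_singleton false)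

open scoped Classical in
theorem lintegral_reached_of_lt (hf : Measurable f) (n τ : ℕ) (hτ : n < τ)
    (x : ∀ _ : Finset.Iic n, Stage F) :
    ∫⁻ ω, (if Reached n τ ω then f (ω τ) else 0)
      ∂Kernel.traj (X := fun _ => Stage F) (nextKernel b a) n x =
    if (x ⟨n, by simp⟩).stops = true then 0 else
      ∫⁻ ω, (if Reached (n + 1) τ ω then f (ω τ) else 0)
        ∂Kernel.traj (X := fun _ => Stage F) (nextKernel b a) n x := by
  -- Under the trajectory law the coordinates up to `n` agree with `x` almost surely. Substituting
  -- them makes the stopping decision of period `n` a constant.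
  rw [Kernel.lintegral_traj x (measurable_reached hf n τ),
    Kernel.lintegral_traj x (measurable_reached hf (n + 1) τ)]
  have hpast : ∀ ω : ℕ → Stage F, Function.updateFinset ω (Finset.Iic n) x n = x ⟨n, by simp⟩ :=
    fun ω => by simp [Function.updateFinset]
  have key : ∀ ω : ℕ → Stage F, Reached n τ (Function.updateFinset ω (Finset.Iic n) x) ↔
      (x ⟨n, by simp⟩).stops = false ∧
        Reached (n + 1) τ (Function.updateFinset ω (Finset.Iic n) x) := fun ω => by
    constructor
    · rintro ⟨h1, h2⟩
      exact ⟨by simpa [hpast] using h2 n le_rfl hτ, hτ, fun s hs => h2 s (by omega)⟩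
    · rintro ⟨h0, h1, h2⟩
      refine ⟨hτ.le, fun s hs hs' => ?_⟩
      rcases hs.eq_or_lt with rfl | hs
      · rw [hpast]; exact h0
      · exact h2 s hs hs'
  simp only [key]
  split_ifs with hx
  · simp [hx]
  · simp [Bool.not_eq_true _ ▸ hx]

open scoped Classical in
theorem lintegral_reached_eq_reward (hf : Measurable f) (d n : ℕ)
    (x : ∀ _ : Finset.Iic n, Stage F) :
    ∫⁻ ω, (if Reached (n + 1) (n + 1 + d) ω then f (ω (n + 1 + d)) else 0)
      ∂Kernel.traj (X := fun _ => Stage F) (nextKernel b a) n x =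
    reward b a f d (n + 1) (record n x) := by
  induction d generalizing n with
  | zero =>
    have h1 : ∀ ω : ℕ → Stage F, Reached (n + 1) (n + 1 + 0) ω :=
      fun ω => ⟨le_rfl, fun s h1 h2 => by omega⟩
    simp only [h1, if_true, add_zero, reward]
    have := Kernel.map_traj_succ_self (X := fun _ => Stage F) (κ := nextKernel b a) (a := n)
    rw [← Kernel.lintegral_map (Kernel.traj (X := fun _ => Stage F) (nextKernel b a) n)
      (measurable_pi_apply (n + 1)) x hf, this]
    rfl
  | succ d ih =>
    rw [lintegral_traj_succ b a (measurable_reached hf _ _)]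
    simp only [reward]
    refine lintegral_congr fun s => ?_
    rw [lintegral_reached_of_lt b a hf (n + 1) _ (by omega)]
    have e : n + 1 + (d + 1) = n + 1 + 1 + d := by omega
    have hs : append x s ⟨n + 1, by simp⟩ = s := by simp [append]
    rw [e, ih, hs, record_append]

open scoped Classical in
theorem lintegral_traj_total (hf : Measurable f) (n : ℕ) (x : ∀ _ : Finset.Iic n, Stage F) :
    ∫⁻ ω, (∑' τ, if Reached n τ ω then f (ω τ) else 0)
      ∂Kernel.traj (X := fun _ => Stage F) (nextKernel b a) n x =
    f (x ⟨n, by simp⟩) + if (x ⟨n, by simp⟩).stops = true then 0 else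
      value b a f (n + 1) (record n x) := by
  have hsum := lintegral_tsum
    (μ := Kernel.traj (X := fun _ => Stage F) (nextKernel b a) n x)
    (f := fun τ (ω : ℕ → Stage F) => if Reached n τ ω then f (ω τ) else 0)
    fun τ => (measurable_reached hf n τ).aemeasurable
  refine hsum.trans ?_
  rw [← Summable.sum_add_tsum_nat_add' (k := n + 1) ENNReal.summable]
  rw [Finset.sum_range_succ, Finset.sum_eq_zero, zero_add]
  · congr 1
    · have h1 : ∀ ω : ℕ → Stage F, Reached n n ω := fun ω => ⟨le_rfl, fun s h1 h2 => by omega⟩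
      simp only [h1, if_true]
      have hpast : ∀ ω : ℕ → Stage F,
          f (Function.updateFinset ω (Finset.Iic n) x n) = f (x ⟨n, by simp⟩) :=
        fun ω => by simp [Function.updateFinset]
      have hfn : Measurable fun ω : ℕ → Stage F => f (ω n) := hf.comp (measurable_pi_apply n)
      rw [Kernel.lintegral_traj x hfn]
      simp only [hpast]
      simp
    · have key : ∀ d, ∫⁻ ω, (if Reached n (d + (n + 1)) ω then f (ω (d + (n + 1))) else 0)
          ∂Kernel.traj (X := fun _ => Stage F) (nextKernel b a) n x =
          if (x ⟨n, by simp⟩).stops = true then 0 else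
            reward b a f d (n + 1) (record n x) := fun d => by
        rw [lintegral_reached_of_lt b a hf n _ (by omega), add_comm d,
          lintegral_reached_eq_reward b a hf]
      simp only [key]
      split_ifs
      · simp
      · rfl
  · intro τ hτ
    have h1 : ∀ ω : ℕ → Stage F, ¬ Reached n τ ω := fun ω hω => by
      have := hω.1
      simp at hτ
      omega
    simp [h1]

open scoped Classical in
/-- The expected total reward on the path of play from period `t` on. -/
theorem lintegral_pathLaw (hf : Measurable f) {t : ℕ} (h : History F t) (μ : Measure (Stage F)) :
    ∫⁻ ω, (∑' τ, if Reached t τ ω then f (ω τ) else 0) ∂pathLaw b a h μ =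
      ∫⁻ s, (f s + if s.stops = true then 0 else value b a f (t + 1) (snoc h s.outcome)) ∂μ := by
  have hm : Measurable fun ω : ℕ → Stage F => ∑' τ, if Reached t τ ω then f (ω τ) else 0 :=
    Measurable.tsum fun τ => measurable_reached hf t τ
  have hm' : Measurable fun x => ∫⁻ ω, (∑' τ, if Reached t τ ω then f (ω τ) else 0)
      ∂Kernel.traj (X := fun _ => Stage F) (nextKernel b a) t x := hm.lintegral_kernel
  rw [pathLaw, Measure.lintegral_bind (Kernel.aemeasurable _) hm.aemeasurable,
    lintegral_map hm' (measurable_extend h)]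
  refine lintegral_congr fun s => ?_
  have hs : extend h s ⟨t, by simp⟩ = s := by simp [extend]
  rw [lintegral_traj_total b a hf, hs, record_extend]

end

/-! ### The rewards of the two players -/

/-- The price and the search cost paid in one period. -/
def Stage.cost (k : ℝ) (s : Stage F) : ℝ≥0∞ := s.payment + ENNReal.ofReal k

/-- The quality of the good consumed at the end of one period. -/
def Stage.consumption (s : Stage F) : ℝ≥0∞ :=
  if s.stops = true then ENNReal.ofReal (s.signal : ℝ) else 0

/-- The payment for the offer `o` under the purchase decision `w`. -/
def payment (o : Offer F) (w : Bool) : ℝ≥0∞ := if w = true then ((o.1 : ℝ≥0) : ℝ≥0∞) else 0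

@[simp] theorem payment_mk (o : Offer F) (w : Bool) (m : Quality) (d : Bool) :
    Stage.payment (o, w, m, d) = payment o w := rfl

@[simp] theorem cost_mk (k : ℝ) (o : Offer F) (w : Bool) (m : Quality) (d : Bool) :
    Stage.cost k (o, w, m, d) = payment o w + ENNReal.ofReal k := rfl

@[simp] theorem consumption_mk (o : Offer F) (w : Bool) (m : Quality) (d : Bool) :
    Stage.consumption (o, w, m, d) = if d = true then ENNReal.ofReal (m : ℝ) else 0 := rfl

@[simp] theorem stops_mk (o : Offer F) (w : Bool) (m : Quality) (d : Bool) :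
    Stage.stops (o, w, m, d) = d := rfl

@[simp] theorem outcome_mk (o : Offer F) (w : Bool) (m : Quality) (d : Bool) :
    Stage.outcome (o, w, m, d) = (o, w, m) := rfl

theorem measurable_payment : Measurable (Stage.payment (F := F)) :=
  Measurable.ite ((by fun_prop : Measurable fun s : Stage F => s.2.1) (measurableSet_singleton true))
    (by fun_prop) measurable_const

theorem measurable_cost (k : ℝ) : Measurable (Stage.cost (F := F) k) :=
  measurable_payment.add_const _

theorem measurable_consumption : Measurable (Stage.consumption (F := F)) :=
  Measurable.ite (measurable_stops (measurableSet_singleton true))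
    (by unfold Stage.signal; fun_prop) measurable_const

/-- The reward `f` of the period `s` that follows `h`, and the total reward `φ` afterwards. -/
def total (f : Stage F → ℝ≥0∞) {t : ℕ} (φ : History F (t + 1) → ℝ≥0∞) (h : History F t)
    (s : Stage F) : ℝ≥0∞ := f s + if s.stops = true then 0 else φ (snoc h s.outcome)

theorem measurable_total {f : Stage F → ℝ≥0∞} (hf : Measurable f) {t : ℕ}
    {φ : History F (t + 1) → ℝ≥0∞} (hφ : Measurable φ) (h : History F t) :
    Measurable (total f φ h) := hf.add (measurable_continuation hφ h)

section

variable (b : BrokerStrategy F) (a : AgentStrategy F) {t : ℕ} (h : History F t)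

theorem brokerValue_pathLaw (μ : Measure (Stage F)) :
    brokerValue t (pathLaw b a h μ) =
      ((∫⁻ s, total Stage.payment (value b a Stage.payment (t + 1)) h s ∂μ : ℝ≥0∞) : EReal) := by
  rw [brokerValue]
  exact congrArg _ (lintegral_pathLaw b a measurable_payment h μ)

theorem agentValue_pathLaw (k : ℝ) (μ : Measure (Stage F)) :
    agentValue k t (pathLaw b a h μ) =
      ((∫⁻ s, total Stage.consumption (value b a Stage.consumption (t + 1)) h s ∂μ : ℝ≥0∞) : EReal) -
      ((∫⁻ s, total (Stage.cost k) (value b a (Stage.cost k) (t + 1)) h s ∂μ : ℝ≥0∞) : EReal) := by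
  have h1 : ∫⁻ ω, matchValue t ω ∂pathLaw b a h μ =
      ∫⁻ s, total Stage.consumption (value b a Stage.consumption (t + 1)) h s ∂μ := by
    refine (lintegral_congr fun ω => ?_).trans (lintegral_pathLaw b a measurable_consumption h μ)
    unfold matchValue Stage.consumption
    refine tsum_congr fun τ => ?_
    by_cases h1 : Reached t τ ω <;> simp [h1]
  have h2 : ∫⁻ ω, totalCost k t ω ∂pathLaw b a h μ =
      ∫⁻ s, total (Stage.cost k) (value b a (Stage.cost k) (t + 1)) h s ∂μ :=
    lintegral_pathLaw b a (measurable_cost k) h μ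
  rw [agentValue, h1, h2]

theorem value_eq_total {f : Stage F → ℝ≥0∞} (hf : Measurable f) :
    value b a f t h = ∫⁻ s, total f (value b a f (t + 1)) h s ∂stageKernel b a t h :=
  value_eq hf t h

theorem brokerValue_lawAt :
    brokerValue t (lawAt b a h) = ((value b a Stage.payment t h : ℝ≥0∞) : EReal) := by
  rw [lawAt, brokerValue_pathLaw, value_eq_total b a h measurable_payment]

theorem agentValue_lawAt (k : ℝ) :
    agentValue k t (lawAt b a h) = ((value b a Stage.consumption t h : ℝ≥0∞) : EReal) -
      ((value b a (Stage.cost k) t h : ℝ≥0∞) : EReal) := by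
  rw [lawAt, agentValue_pathLaw, value_eq_total b a h measurable_consumption,
    value_eq_total b a h (measurable_cost k)]

theorem lintegral_stageKernel {g : Stage F → ℝ≥0∞} (hg : Measurable g) :
    ∫⁻ s, g s ∂stageKernel b a t h =
      ∫⁻ o, ∫⁻ r, g (o, r) ∂responseKernel a t (h, o) ∂b.offer t h :=
  Kernel.lintegral_compProd _ _ _ hg

theorem lintegral_responseKernel (o : Offer F) {g : Bool × Quality × Bool → ℝ≥0∞}
    (hg : Measurable g) :
    ∫⁻ r, g r ∂responseKernel a t (h, o) =
      ∫⁻ w, ∫⁻ m, ∫⁻ d, g (w, m, d) ∂a.halt t (((h, o), w), m) ∂signalLaw o w ∂a.buy t (h, o) := by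
  rw [responseKernel, Kernel.lintegral_compProd _ _ _ hg]
  refine lintegral_congr fun w => ?_
  have hgw : Measurable fun c => g (w, c) := hg.comp measurable_prodMk_left
  rw [Kernel.lintegral_compProd _ _ _ hgw]
  rfl

theorem lintegral_total_response (o : Offer F) {f : Stage F → ℝ≥0∞} (hf : Measurable f)
    {φ : History F (t + 1) → ℝ≥0∞} (hφ : Measurable φ) :
    ∫⁻ r, total f φ h (o, r) ∂responseKernel a t (h, o) =
      ∫⁻ w, ∫⁻ m, ∫⁻ d, total f φ h (o, w, m, d) ∂a.halt t (((h, o), w), m) ∂signalLaw o w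
        ∂a.buy t (h, o) :=
  lintegral_responseKernel a h o ((measurable_total hf hφ h).comp measurable_prodMk_left)

instance (o : Offer F) (w : Bool) : IsProbabilityMeasure (signalLaw o w) := by
  unfold signalLaw
  split_ifs <;> infer_instance

end

/-- Comparison of net payoffs. -/
theorem coe_sub_coe_le {M M' C C' K X : ℝ≥0∞} (hM : M ≠ ∞) (hM' : M' ≠ ∞) (hK : K ≠ ∞)
    (hX : X ≠ ∞) (h1 : M' + K ≤ X + C') (h2 : X + C ≤ M + K) :
    (M' : EReal) - (C' : EReal) ≤ (M : EReal) - (C : EReal) := by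
  have hC : C ≠ ∞ := fun h => by
    rw [h, add_top, top_le_iff] at h2
    exact ENNReal.add_ne_top.2 ⟨hM, hK⟩ h2
  by_cases hC' : C' = ∞
  · subst hC'
    lift M' to ℝ≥0 using hM'
    simp
  lift M to ℝ≥0 using hM
  lift M' to ℝ≥0 using hM'
  lift C to ℝ≥0 using hC
  lift C' to ℝ≥0 using hC'
  lift K to ℝ≥0 using hK
  lift X to ℝ≥0 using hX
  norm_cast at h1 h2
  have h1' : (M' : ℝ) + K ≤ X + C' := by exact_mod_cast h1
  have h2' : (X : ℝ) + C ≤ M + K := by exact_mod_cast h2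
  simp only [EReal.coe_nnreal_eq_coe_real, ← EReal.coe_sub, EReal.coe_le_coe_iff]
  linarith

theorem coe_sub_coe_eq {M C X : ℝ≥0∞} (hM : M ≠ ∞) (h : M = X + C) :
    (M : EReal) - (C : EReal) = X := by
  have hX : X ≠ ∞ := fun h' => hM (by simp [h, h'])
  have hC : C ≠ ∞ := fun h' => hM (by simp [h, h'])
  subst h
  lift X to ℝ≥0 using hX
  lift C to ℝ≥0 using hC
  rw [← ENNReal.coe_add]
  simp only [EReal.coe_nnreal_eq_coe_real, ← EReal.coe_sub]
  norm_num

theorem ofReal_quality_le_one (m : Quality) : ENNReal.ofReal (m : ℝ) ≤ 1 :=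
  ENNReal.ofReal_le_one.2 m.2.2

theorem value_consumption_le_one (b : BrokerStrategy F) (a : AgentStrategy F) (t : ℕ)
    (h : History F t) : value b a Stage.consumption t h ≤ 1 := by
  have := value_le_of_superharmonic (b := b) (a := a) (f := Stage.consumption) (g := fun _ => 0)
    measurable_consumption measurable_const (W := fun _ _ => 1) (fun t h => by
      simp only [lintegral_zero, add_zero]
      refine (lintegral_mono (g := fun _ => 1) fun s => ?_).trans (by simp)
      rcases s with ⟨o, w, m, d⟩
      cases d
      · simp
      · simpa using m.2.2) t h
  have h0 : value b a (fun _ => 0) t h = 0 := by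
    have := value_const_mul (b := b) (a := a) 0 (f := fun _ => 0) measurable_const t h
    simpa using this
  simpa [h0] using this

theorem lintegral_consumption_ne_top (b : BrokerStrategy F) (a : AgentStrategy F) {t : ℕ}
    (h : History F t) (μ : Measure (Stage F)) [IsProbabilityMeasure μ] :
    ∫⁻ s, total Stage.consumption (value b a Stage.consumption (t + 1)) h s ∂μ ≠ ∞ := by
  refine ne_top_of_le_ne_top ENNReal.one_ne_top
    ((lintegral_mono (g := fun _ => 1) fun s => ?_).trans (by simp))
  rcases s with ⟨o, w, m, d⟩
  cases d
  · simpa [total] using value_consumption_le_one b a _ _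
  · simpa [total] using m.2.2

/-! ### Deterministic profiles and sufficient conditions for equilibrium -/

theorem measure_quality_ext {μ ν : Measure Quality} [IsProbabilityMeasure μ]
    [IsProbabilityMeasure ν] (h : ∀ q : ℚ, μ {θ | (θ : ℝ) ≤ q} = ν {θ | (θ : ℝ) ≤ q}) : μ = ν := by
  refine ext_of_generate_finite
    {s | ∃ t ∈ ⋃ a : ℚ, {Set.Iic (a : ℝ)}, (Subtype.val : Quality → ℝ) ⁻¹' t = s} ?_
    (Real.isPiSystem_Iic_rat.comap _) ?_ (by simp)
  · change MeasurableSpace.comap _ (inferInstance : MeasurableSpace ℝ) = _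
    rw [BorelSpace.measurable_eq (α := ℝ), Real.borel_eq_generateFrom_Iic_rat,
      MeasurableSpace.comap_generateFrom]
    rfl
  · rintro s ⟨t, ht, rfl⟩
    obtain ⟨q, rfl⟩ := Set.mem_iUnion.1 ht
    exact h q

/-- The automaton below must recognize one particular offer measurably. A law on `[0, 1]` is
determined by its distribution function at the rationals, so a singleton is a countable intersection
of measurable sets. -/
instance : MeasurableSingletonClass (Signal F) where
  measurableSet_singleton G := by
    have hset : ({G} : Set (Signal F)) = ⋂ q : ℚ,
        {G' : Signal F | ((G'.1 : ProbabilityMeasure Quality) : Measure Quality) {θ | (θ : ℝ) ≤ q} =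
          ((G.1 : ProbabilityMeasure Quality) : Measure Quality) {θ | (θ : ℝ) ≤ q}} := by
      ext G'
      simp only [Set.mem_singleton_iff, Set.mem_iInter, Set.mem_ofPred_eq]
      refine ⟨fun h q => by rw [h], fun h => ?_⟩
      have := G'.1.2
      have := G.1.2
      exact Subtype.ext (Subtype.ext (measure_quality_ext h))
    rw [hset]
    refine MeasurableSet.iInter fun q => ?_
    have hq : MeasurableSet {θ : Quality | (θ : ℝ) ≤ q} :=
      measurableSet_le measurable_subtype_coe measurable_const
    exact ((Measure.measurable_coe hq).comp
      (measurable_subtype_coe.comp measurable_subtype_coe)) (measurableSet_singleton _)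

/-- The broker makes the offer `off t h` after the history `h`. -/
def detBroker (off : ∀ t, History F t → Offer F) (hoff : ∀ t, Measurable (off t)) :
    BrokerStrategy F where
  offer t := Kernel.deterministic (off t) (hoff t)
  markov _ := inferInstance

/-- The agent stops if and only if the realized posterior mean is at least his continuation payoff
`W`. -/
def haltRule (W : ∀ t, History F t → ℝ≥0∞) (t : ℕ)
    (x : ((History F t × Offer F) × Bool) × Quality) : Bool :=
  if W (t + 1) (snoc x.1.1.1 (x.1.1.2, x.1.2, x.2)) ≤ ENNReal.ofReal (x.2 : ℝ) then true else false

theorem measurable_haltRule {W : ∀ t, History F t → ℝ≥0∞} (hW : ∀ t, Measurable (W t)) (t : ℕ) :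
    Measurable (haltRule W t) := by
  have h1 : Measurable fun x : ((History F t × Offer F) × Bool) × Quality =>
      (x.1.1.1, ((x.1.1.2, x.1.2, x.2) : Outcome F)) := by fun_prop
  exact Measurable.ite (measurableSet_le ((hW _).comp (measurable_snoc.comp h1)) (by fun_prop))
    measurable_const measurable_const

/-- The agent buys according to `buy`, and stops if and only if the realized posterior mean is at
least his continuation payoff `W`. -/
def detAgent (buy : ∀ t, History F t × Offer F → Bool) (hbuy : ∀ t, Measurable (buy t))
    (W : ∀ t, History F t → ℝ≥0∞) (hW : ∀ t, Measurable (W t)) : AgentStrategy F where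
  buy t := Kernel.deterministic (buy t) (hbuy t)
  halt t := Kernel.deterministic (haltRule W t) (measurable_haltRule hW t)
  buy_markov _ := inferInstance
  halt_markov _ := inferInstance

theorem lintegral_stageKernel_detBroker {off : ∀ t, History F t → Offer F}
    {hoff : ∀ t, Measurable (off t)} (a : AgentStrategy F) {t : ℕ} (h : History F t)
    {g : Stage F → ℝ≥0∞} (hg : Measurable g) :
    ∫⁻ s, g s ∂stageKernel (detBroker off hoff) a t h =
      ∫⁻ r, g (off t h, r) ∂responseKernel a t (h, off t h) := by
  rw [lintegral_stageKernel _ _ _ hg]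
  exact Kernel.lintegral_deterministic (hoff t)

theorem lintegral_responseKernel_detAgent {buy : ∀ t, History F t × Offer F → Bool}
    {hbuy : ∀ t, Measurable (buy t)} {W : ∀ t, History F t → ℝ≥0∞} {hW : ∀ t, Measurable (W t)}
    {t : ℕ} (h : History F t) (o : Offer F) {g : Stage F → ℝ≥0∞} (hg : Measurable g) :
    ∫⁻ r, g (o, r) ∂responseKernel (detAgent buy hbuy W hW) t (h, o) =
      ∫⁻ m, g (o, buy t (h, o), m, haltRule W t (((h, o), buy t (h, o)), m))
        ∂signalLaw o (buy t (h, o)) := by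
  have hgo : Measurable fun r => g (o, r) := hg.comp measurable_prodMk_left
  rw [lintegral_responseKernel _ _ _ hgo]
  have h1 : ∀ w, ∫⁻ m, ∫⁻ d, g (o, w, m, d) ∂(detAgent buy hbuy W hW).halt t (((h, o), w), m)
      ∂signalLaw o w = ∫⁻ m, g (o, w, m, haltRule W t (((h, o), w), m)) ∂signalLaw o w :=
    fun w => lintegral_congr fun m => Kernel.lintegral_deterministic (measurable_haltRule hW t)
  simp only [h1]
  exact Kernel.lintegral_deterministic (hbuy t)

theorem total_consumption_le {t : ℕ} (W : ∀ t, History F t → ℝ≥0∞) (h : History F t) (o : Offer F)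
    (w : Bool) (m : Quality) (d : Bool) :
    total Stage.consumption (W (t + 1)) h (o, w, m, d) ≤
      max (ENNReal.ofReal (m : ℝ)) (W (t + 1) (snoc h (o, w, m))) := by
  cases d <;> simp [total]

theorem total_consumption_haltRule {t : ℕ} (W : ∀ t, History F t → ℝ≥0∞) (h : History F t)
    (o : Offer F) (w : Bool) (m : Quality) :
    total Stage.consumption (W (t + 1)) h (o, w, m, haltRule W t (((h, o), w), m)) =
      max (ENNReal.ofReal (m : ℝ)) (W (t + 1) (snoc h (o, w, m))) := by
  unfold haltRule
  split_ifs with hc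
  · simpa [total] using hc
  · simpa [total] using (not_le.1 hc).le

theorem lintegral_response_payment (a : AgentStrategy F) {t : ℕ} (h : History F t) (o : Offer F) :
    ∫⁻ r, Stage.payment (o, r) ∂responseKernel a t (h, o) =
      ∫⁻ w, payment o w ∂a.buy t (h, o) := by
  have hpay : Measurable fun r : Bool × Quality × Bool => Stage.payment (o, r) :=
    measurable_payment.comp measurable_prodMk_left
  rw [lintegral_responseKernel _ _ _ hpay]
  simp only [payment_mk, lintegral_const, measure_univ, mul_one]

section

variable {b : BrokerStrategy F} {a : AgentStrategy F} {k : ℝ} {W : ∀ t, History F t → ℝ≥0∞}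

/-- Passes from the candidate payoff `W` to true continuation values, for an arbitrary law `μ` of
the current period. `X` is the payoff before sunk amounts and `K` collects those other than the
search cost, so the same statement serves the purchase and the stopping decision. -/
theorem lintegral_total_consumption_le (hW : ∀ t, Measurable (W t))
    (hle : ∀ t h, value b a Stage.consumption t h ≤ W t h + value b a (Stage.cost k) t h)
    {t : ℕ} {h : History F t} {μ : Measure (Stage F)} [IsProbabilityMeasure μ] {X K : ℝ≥0∞}
    (hμ : ∫⁻ s, total Stage.consumption (W (t + 1)) h s ∂μ + K ≤
      X + ∫⁻ s, Stage.payment s ∂μ) :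
    ∫⁻ s, total Stage.consumption (value b a Stage.consumption (t + 1)) h s ∂μ +
        (K + ENNReal.ofReal k) ≤
      X + ∫⁻ s, total (Stage.cost k) (value b a (Stage.cost k) (t + 1)) h s ∂μ := by
  have h1 : ∫⁻ s, total Stage.consumption (value b a Stage.consumption (t + 1)) h s ∂μ ≤
      ∫⁻ s, total Stage.consumption (W (t + 1)) h s ∂μ + ∫⁻ s, (if s.stops = true then 0 else
        value b a (Stage.cost k) (t + 1) (snoc h s.outcome)) ∂μ := by
    rw [← lintegral_add_left (measurable_total measurable_consumption (hW _) h)]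
    refine lintegral_mono fun s => ?_
    unfold total
    split_ifs
    · simp
    · rw [add_assoc]
      exact add_le_add_right (hle _ _) _
  have h2 : ∫⁻ s, total (Stage.cost k) (value b a (Stage.cost k) (t + 1)) h s ∂μ =
      (∫⁻ s, Stage.payment s ∂μ + ENNReal.ofReal k) + ∫⁻ s, (if s.stops = true then 0 else
        value b a (Stage.cost k) (t + 1) (snoc h s.outcome)) ∂μ := by
    unfold total
    rw [lintegral_add_left (measurable_cost k)]
    congr 1
    unfold Stage.cost
    rw [lintegral_add_right _ measurable_const]
    simp
  rw [h2]
  calc _ ≤ _ := add_le_add_left h1 _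
    _ = (∫⁻ s, total Stage.consumption (W (t + 1)) h s ∂μ + K) + ENNReal.ofReal k +
        ∫⁻ s, (if s.stops = true then 0 else
        value b a (Stage.cost k) (t + 1) (snoc h s.outcome)) ∂μ := by ring
    _ ≤ (X + ∫⁻ s, Stage.payment s ∂μ) + ENNReal.ofReal k +
        ∫⁻ s, (if s.stops = true then 0 else
        value b a (Stage.cost k) (t + 1) (snoc h s.outcome)) ∂μ :=
      add_le_add_left (add_le_add_left hμ _) _
    _ = _ := by ring

theorem le_lintegral_total_consumption (hW : ∀ t, Measurable (W t))
    (hle : ∀ t h, W t h + value b a (Stage.cost k) t h ≤ value b a Stage.consumption t h)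
    {t : ℕ} {h : History F t} {μ : Measure (Stage F)} [IsProbabilityMeasure μ] {X K : ℝ≥0∞}
    (hμ : X + ∫⁻ s, Stage.payment s ∂μ ≤
      ∫⁻ s, total Stage.consumption (W (t + 1)) h s ∂μ + K) :
    X + ∫⁻ s, total (Stage.cost k) (value b a (Stage.cost k) (t + 1)) h s ∂μ ≤
      ∫⁻ s, total Stage.consumption (value b a Stage.consumption (t + 1)) h s ∂μ +
        (K + ENNReal.ofReal k) := by
  have h1 : ∫⁻ s, total Stage.consumption (W (t + 1)) h s ∂μ + ∫⁻ s, (if s.stops = true then 0 else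
        value b a (Stage.cost k) (t + 1) (snoc h s.outcome)) ∂μ ≤
      ∫⁻ s, total Stage.consumption (value b a Stage.consumption (t + 1)) h s ∂μ := by
    rw [← lintegral_add_left (measurable_total measurable_consumption (hW _) h)]
    refine lintegral_mono fun s => ?_
    unfold total
    split_ifs
    · simp
    · rw [add_assoc]
      exact add_le_add_right (hle _ _) _
  have h2 : ∫⁻ s, total (Stage.cost k) (value b a (Stage.cost k) (t + 1)) h s ∂μ =
      (∫⁻ s, Stage.payment s ∂μ + ENNReal.ofReal k) + ∫⁻ s, (if s.stops = true then 0 else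
        value b a (Stage.cost k) (t + 1) (snoc h s.outcome)) ∂μ := by
    unfold total
    rw [lintegral_add_left (measurable_cost k)]
    congr 1
    unfold Stage.cost
    rw [lintegral_add_right _ measurable_const]
    simp
  rw [h2]
  calc _ = (X + ∫⁻ s, Stage.payment s ∂μ) + ENNReal.ofReal k +
        ∫⁻ s, (if s.stops = true then 0 else
        value b a (Stage.cost k) (t + 1) (snoc h s.outcome)) ∂μ := by ring
    _ ≤ (∫⁻ s, total Stage.consumption (W (t + 1)) h s ∂μ + K) + ENNReal.ofReal k +
        ∫⁻ s, (if s.stops = true then 0 else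
        value b a (Stage.cost k) (t + 1) (snoc h s.outcome)) ∂μ :=
      add_le_add_left (add_le_add_left hμ _) _
    _ = (∫⁻ s, total Stage.consumption (W (t + 1)) h s ∂μ +
        ∫⁻ s, (if s.stops = true then 0 else
        value b a (Stage.cost k) (t + 1) (snoc h s.outcome)) ∂μ) + (K + ENNReal.ofReal k) := by ring
    _ ≤ _ := add_le_add_left h1 _

end

/-- A deterministic profile, with the payoffs `W` of the agent and `V` of the broker after each
history and the agent's gross payoffs `P` after each offer, from which no one-shot deviation is
profitable. -/
structure OneShotOptimal (k : ℝ) (off : ∀ t, History F t → Offer F)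
    (buy : ∀ t, History F t × Offer F → Bool) (W V : ∀ t, History F t → ℝ≥0∞)
    (P : ∀ t, History F t → Offer F → ℝ≥0∞) : Prop where
  hoff : ∀ t, Measurable (off t)
  hbuy : ∀ t, Measurable (buy t)
  hW : ∀ t, Measurable (W t)
  hV : ∀ t, Measurable (V t)
  W_le : ∀ t h, W t h ≤ 1
  V_le : ∀ t h, V t h ≤ 1
  interim_le : ∀ t h o w, ∫⁻ m, max (ENNReal.ofReal ((m : Quality) : ℝ)) (W (t + 1) (snoc h (o, w, m)))
    ∂signalLaw o w ≤ P t h o + payment o w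
  le_interim : ∀ t h o, P t h o + payment o (buy t (h, o)) ≤
    ∫⁻ m, max (ENNReal.ofReal ((m : Quality) : ℝ)) (W (t + 1) (snoc h (o, buy t (h, o), m)))
      ∂signalLaw o (buy t (h, o))
  promise : ∀ t h, W t h + ENNReal.ofReal k = P t h (off t h)
  broker_le : ∀ t h o, payment o (buy t (h, o)) +
    ∫⁻ m, (if W (t + 1) (snoc h (o, buy t (h, o), m)) ≤ ENNReal.ofReal ((m : Quality) : ℝ) then 0
      else V (t + 1) (snoc h (o, buy t (h, o), m))) ∂signalLaw o (buy t (h, o)) ≤ V t h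
  le_broker : ∀ t h, V t h ≤ payment (off t h) (buy t (h, off t h)) +
    ∫⁻ m, (if W (t + 1) (snoc h (off t h, buy t (h, off t h), m)) ≤ ENNReal.ofReal ((m : Quality) : ℝ)
      then 0 else V (t + 1) (snoc h (off t h, buy t (h, off t h), m)))
      ∂signalLaw (off t h) (buy t (h, off t h))

namespace OneShotOptimal

variable {k : ℝ} {off : ∀ t, History F t → Offer F} {buy : ∀ t, History F t × Offer F → Bool}
  {W V : ∀ t, History F t → ℝ≥0∞} {P : ∀ t, History F t → Offer F → ℝ≥0∞}


/-- The broker's strategy. -/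
abbrev broker (H : OneShotOptimal k off buy W V P) : BrokerStrategy F := detBroker off H.hoff

/-- The agent's strategy. -/
abbrev agent (H : OneShotOptimal k off buy W V P) : AgentStrategy F := detAgent buy H.hbuy W H.hW

/-- The two decisions are optimized separately: the maximum bounds any randomization over stopping,
and `P` bounds either purchase decision once its price is added back. -/
theorem response_le (H : OneShotOptimal k off buy W V P) (a' : AgentStrategy F) {t : ℕ}
    (h : History F t) (o : Offer F) :
    ∫⁻ r, total Stage.consumption (W (t + 1)) h (o, r) ∂responseKernel a' t (h, o) ≤
      P t h o + ∫⁻ r, Stage.payment (o, r) ∂responseKernel a' t (h, o) := by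
  rw [lintegral_total_response _ _ _ measurable_consumption (H.hW _), lintegral_response_payment]
  have : P t h o + ∫⁻ w, payment o w ∂a'.buy t (h, o) =
      ∫⁻ w, (P t h o + payment o w) ∂a'.buy t (h, o) := by
    rw [lintegral_add_left measurable_const, lintegral_const, measure_univ, mul_one]
  rw [this]
  refine lintegral_mono fun w => le_trans (lintegral_mono fun m => ?_) (H.interim_le t h o w)
  refine (lintegral_mono fun d => total_consumption_le W h o w m d).trans ?_
  rw [lintegral_const, measure_univ, mul_one]

theorem le_response (H : OneShotOptimal k off buy W V P) {t : ℕ} (h : History F t) (o : Offer F) :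
    P t h o + ∫⁻ r, Stage.payment (o, r) ∂responseKernel H.agent t (h, o) ≤
      ∫⁻ r, total Stage.consumption (W (t + 1)) h (o, r) ∂responseKernel H.agent t (h, o) := by
  rw [lintegral_responseKernel_detAgent _ _ measurable_payment,
    lintegral_responseKernel_detAgent _ _ (measurable_total measurable_consumption (H.hW _) h)]
  simp only [total_consumption_haltRule, payment_mk, lintegral_const, measure_univ, mul_one]
  exact H.le_interim t h o

theorem lintegral_cost {k : ℝ} (μ : Measure (Stage F)) [IsProbabilityMeasure μ] :
    ∫⁻ s, Stage.cost k s ∂μ = ∫⁻ s, Stage.payment s ∂μ + ENNReal.ofReal k := by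
  unfold Stage.cost
  rw [lintegral_add_right _ measurable_const]
  simp

theorem stage_le (H : OneShotOptimal k off buy W V P) (a' : AgentStrategy F) (t : ℕ)
    (h : History F t) :
    ∫⁻ s, total Stage.consumption (W (t + 1)) h s ∂stageKernel H.broker a' t h ≤
      W t h + ∫⁻ s, Stage.cost k s ∂stageKernel H.broker a' t h := by
  rw [lintegral_cost, add_comm _ (ENNReal.ofReal k), ← add_assoc, H.promise,
    lintegral_stageKernel_detBroker _ _ (measurable_total measurable_consumption (H.hW _) h),
    lintegral_stageKernel_detBroker _ _ measurable_payment]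
  exact H.response_le a' h _

theorem le_stage (H : OneShotOptimal k off buy W V P) (t : ℕ) (h : History F t) :
    W t h + ∫⁻ s, Stage.cost k s ∂stageKernel H.broker H.agent t h ≤
      ∫⁻ s, total Stage.consumption (W (t + 1)) h s ∂stageKernel H.broker H.agent t h := by
  rw [lintegral_cost, add_comm _ (ENNReal.ofReal k), ← add_assoc, H.promise,
    lintegral_stageKernel_detBroker _ _ (measurable_total measurable_consumption (H.hW _) h),
    lintegral_stageKernel_detBroker _ _ measurable_payment]
  exact H.le_response h _

theorem value_consumption_le (H : OneShotOptimal k off buy W V P) (a' : AgentStrategy F) (t : ℕ)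
    (h : History F t) : value H.broker a' Stage.consumption t h ≤
      W t h + value H.broker a' (Stage.cost k) t h :=
  value_le_of_superharmonic measurable_consumption (measurable_cost k) (H.stage_le a') t h

theorem value_consumption_ne_top (b : BrokerStrategy F) (a : AgentStrategy F) (t : ℕ)
    (h : History F t) : value b a Stage.consumption t h ≠ ∞ :=
  ne_top_of_le_ne_top ENNReal.one_ne_top (value_consumption_le_one b a t h)

/-- Payoffs are bounded and each period costs at least `k > 0`, so search has finite expected
length. This is also what validates the lower bound for the broker, who bears no flow cost herself.
-/
theorem value_one_ne_top (H : OneShotOptimal k off buy W V P) (hk : 0 < k) (t : ℕ)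
    (h : History F t) : value H.broker H.agent (fun _ => 1) t h ≠ ∞ :=
  PersuadedSearch.value_one_ne_top measurable_consumption (measurable_cost k) ENNReal.one_ne_top
    H.W_le H.le_stage (κ := ENNReal.ofReal k) (by simpa using hk) (fun _ => le_add_self) t h
    (value_consumption_ne_top _ _ _ _)

theorem le_value_consumption (H : OneShotOptimal k off buy W V P) (hk : 0 < k) (t : ℕ)
    (h : History F t) : W t h + value H.broker H.agent (Stage.cost k) t h ≤
      value H.broker H.agent Stage.consumption t h :=
  add_value_le_of_subharmonic measurable_consumption (measurable_cost k) ENNReal.one_ne_top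
    H.W_le H.le_stage t h (H.value_one_ne_top hk t h)

theorem agentValue_eq (H : OneShotOptimal k off buy W V P) (hk : 0 < k) {t : ℕ}
    (h : History F t) : agentValue k t (lawAt H.broker H.agent h) = (W t h : EReal) := by
  rw [agentValue_lawAt]
  exact coe_sub_coe_eq (value_consumption_ne_top _ _ _ _)
    (le_antisymm (H.value_consumption_le _ t h) (H.le_value_consumption hk t h))

theorem total_payment_haltRule {t : ℕ} (h : History F t)
    (o : Offer F) (w : Bool) (m : Quality) :
    total Stage.payment (V (t + 1)) h (o, w, m, haltRule W t (((h, o), w), m)) =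
      payment o w + if W (t + 1) (snoc h (o, w, m)) ≤ ENNReal.ofReal (m : ℝ) then 0 else
        V (t + 1) (snoc h (o, w, m)) := by
  unfold haltRule
  split_ifs with hc <;> simp [total]

theorem lintegral_response_total_payment (H : OneShotOptimal k off buy W V P) {t : ℕ}
    (h : History F t) (o : Offer F) :
    ∫⁻ r, total Stage.payment (V (t + 1)) h (o, r) ∂responseKernel H.agent t (h, o) =
      payment o (buy t (h, o)) + ∫⁻ m, (if W (t + 1) (snoc h (o, buy t (h, o), m)) ≤
        ENNReal.ofReal ((m : Quality) : ℝ) then 0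
        else V (t + 1) (snoc h (o, buy t (h, o), m))) ∂signalLaw o (buy t (h, o)) := by
  rw [lintegral_responseKernel_detAgent _ _ (measurable_total measurable_payment (H.hV _) h)]
  simp only [total_payment_haltRule]
  rw [lintegral_add_left measurable_const]
  simp

theorem value_zero (b : BrokerStrategy F) (a : AgentStrategy F) (t : ℕ) (h : History F t) :
    value b a (fun _ => 0) t h = 0 := by
  simpa using value_const_mul (b := b) (a := a) 0 (f := fun _ => 0) measurable_const t h

theorem value_payment_le (H : OneShotOptimal k off buy W V P) (b' : BrokerStrategy F) (t : ℕ)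
    (h : History F t) : value b' H.agent Stage.payment t h ≤ V t h := by
  have := value_le_of_superharmonic (b := b') (a := H.agent) (g := fun _ => 0) (W := V)
    measurable_payment measurable_const (fun t h => by
      change ∫⁻ s, total Stage.payment (V (t + 1)) h s ∂_ ≤ _
      rw [lintegral_stageKernel _ _ _ (measurable_total measurable_payment (H.hV _) h)]
      simp only [H.lintegral_response_total_payment, lintegral_zero, add_zero]
      exact (lintegral_mono fun o => H.broker_le t h o).trans (by simp)) t h
  simpa [value_zero] using this

theorem le_value_payment (H : OneShotOptimal k off buy W V P) (hk : 0 < k) (t : ℕ)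
    (h : History F t) : V t h ≤ value H.broker H.agent Stage.payment t h := by
  have := add_value_le_of_subharmonic (b := H.broker) (a := H.agent) (g := fun _ => 0) (W := V)
    measurable_payment measurable_const ENNReal.one_ne_top H.V_le (fun t h => by
      change _ ≤ ∫⁻ s, total Stage.payment (V (t + 1)) h s ∂_
      rw [lintegral_stageKernel_detBroker _ _ (measurable_total measurable_payment (H.hV _) h)]
      simp only [H.lintegral_response_total_payment, lintegral_zero, add_zero]
      exact H.le_broker t h) t h (H.value_one_ne_top hk t h)
  simpa [value_zero] using this

theorem brokerValue_eq (H : OneShotOptimal k off buy W V P) (hk : 0 < k) {t : ℕ}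
    (h : History F t) : brokerValue t (lawAt H.broker H.agent h) = (V t h : EReal) := by
  rw [brokerValue_lawAt]
  exact congrArg _ (le_antisymm (H.value_payment_le _ t h) (H.le_value_payment hk t h))

theorem isEquilibrium (H : OneShotOptimal k off buy W V P) (hk : 0 < k) :
    IsEquilibrium k H.broker H.agent where
  broker t h b' := by
    rw [H.brokerValue_eq hk, brokerValue_lawAt]
    exact EReal.coe_ennreal_le_coe_ennreal_iff.2 (H.value_payment_le b' t h)
  agent t h a' := by
    rw [agentValue_lawAt, agentValue_lawAt]
    refine coe_sub_coe_le (K := 0) (X := W t h) (value_consumption_ne_top _ _ _ _)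
      (value_consumption_ne_top _ _ _ _) ENNReal.zero_ne_top
      (ne_top_of_le_ne_top ENNReal.one_ne_top (H.W_le t h)) ?_ ?_
    · simpa using H.value_consumption_le a' t h
    · simpa using H.le_value_consumption hk t h
  agent_purchase t h o a' := by
    have hprob : ∀ a : AgentStrategy F,
        IsProbabilityMeasure ((responseKernel a t (h, o)).map fun r => (o, r)) := fun a =>
      Measure.isProbabilityMeasure_map measurable_prodMk_left.aemeasurable
    have hmap : ∀ (a : AgentStrategy F) {g : Stage F → ℝ≥0∞}, Measurable g →
        ∫⁻ s, g s ∂((responseKernel a t (h, o)).map fun r => (o, r)) =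
          ∫⁻ r, g (o, r) ∂responseKernel a t (h, o) := fun a g hg =>
      lintegral_map hg measurable_prodMk_left
    have hP : P t h o ≠ ∞ := by
      refine ne_top_of_le_ne_top ENNReal.one_ne_top (le_self_add.trans ((H.le_interim t h o).trans ?_))
      refine (lintegral_mono (g := fun _ => 1) fun m => ?_).trans (by simp)
      exact max_le (ofReal_quality_le_one m) (H.W_le _ _)
    rw [lawAtOffer, lawAtOffer, agentValue_pathLaw, agentValue_pathLaw]
    refine coe_sub_coe_le (lintegral_consumption_ne_top _ _ _ _)
      (lintegral_consumption_ne_top _ _ _ _) (K := 0 + ENNReal.ofReal k) (by simp) hP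
      (lintegral_total_consumption_le H.hW (H.value_consumption_le a') ?_)
      (le_lintegral_total_consumption H.hW (H.le_value_consumption hk) ?_)
    · rw [hmap _ (measurable_total measurable_consumption (H.hW _) h), hmap _ measurable_payment,
        add_zero]
      exact H.response_le a' h o
    · rw [hmap _ (measurable_total measurable_consumption (H.hW _) h), hmap _ measurable_payment,
        add_zero]
      exact H.le_response h o
  agent_stopping t h o w m a' := by
    have hd : Measurable fun d : Bool => ((o, w, m, d) : Stage F) := measurable_of_finite _
    have hprob : ∀ a : AgentStrategy F,
        IsProbabilityMeasure ((a.halt t (((h, o), w), m)).map fun d => (o, w, m, d)) := fun a =>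
      Measure.isProbabilityMeasure_map hd.aemeasurable
    have hmap : ∀ (a : AgentStrategy F) {g : Stage F → ℝ≥0∞}, Measurable g →
        ∫⁻ s, g s ∂((a.halt t (((h, o), w), m)).map fun d => (o, w, m, d)) =
          ∫⁻ d, g (o, w, m, d) ∂a.halt t (((h, o), w), m) := fun a g hg => lintegral_map hg hd
    have hpay : payment o w ≠ ∞ := by unfold payment; split_ifs <;> simp
    rw [lawAtSignal, lawAtSignal, agentValue_pathLaw, agentValue_pathLaw]
    -- The price and the search cost of the current period are sunk, so they enter `K`; `X` is the
    -- payoff from optimal stopping.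
    refine coe_sub_coe_le (lintegral_consumption_ne_top _ _ _ _)
      (lintegral_consumption_ne_top _ _ _ _) (K := payment o w + ENNReal.ofReal k)
      (X := max (ENNReal.ofReal (m : ℝ)) (W (t + 1) (snoc h (o, w, m)))) (by simp [hpay])
      (ne_top_of_le_ne_top ENNReal.one_ne_top (max_le (ofReal_quality_le_one m) (H.W_le _ _)))
      (lintegral_total_consumption_le H.hW (H.value_consumption_le a') ?_)
      (le_lintegral_total_consumption H.hW (H.le_value_consumption hk) ?_)
    · rw [hmap _ (measurable_total measurable_consumption (H.hW _) h), hmap _ measurable_payment]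
      simp only [payment_mk, lintegral_const, measure_univ, mul_one]
      refine add_le_add_left ((lintegral_mono fun d => total_consumption_le W h o w m d).trans ?_) _
      rw [lintegral_const, measure_univ, mul_one]
    · rw [hmap _ (measurable_total measurable_consumption (H.hW _) h), hmap _ measurable_payment]
      simp only [payment_mk, lintegral_const, measure_univ, mul_one]
      refine add_le_add_left ?_ _
      rw [← total_consumption_haltRule W h o w m]
      exact (Kernel.lintegral_deterministic (measurable_haltRule H.hW t)).ge

end OneShotOptimal

/-! ### The McCall payoff and the threshold search cost -/

theorem integrable_of_continuous (μ : Measure Quality) [IsProbabilityMeasure μ] {φ : ℝ → ℝ}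
    (hφ : Continuous φ) : Integrable (fun θ : Quality => φ θ) μ := by
  have hc : Continuous fun θ : Quality => φ θ := hφ.comp continuous_subtype_val
  obtain ⟨C, hC⟩ := isCompact_univ.exists_bound_of_continuousOn hc.continuousOn
  exact Integrable.of_bound hc.measurable.aestronglyMeasurable C
    (Filter.Eventually.of_forall fun θ => hC θ (Set.mem_univ θ))

theorem integrable_coe (μ : Measure Quality) [IsProbabilityMeasure μ] :
    Integrable (fun θ : Quality => (θ : ℝ)) μ := integrable_of_continuous μ continuous_id

theorem integrable_max (μ : Measure Quality) [IsProbabilityMeasure μ] (x : ℝ) :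
    Integrable (fun θ : Quality => max (θ : ℝ) x) μ :=
  integrable_of_continuous μ (continuous_id.max continuous_const)

/-- The expected maximum of the posterior mean and `x`. -/
def expMax (G : ProbabilityMeasure Quality) (x : ℝ) : ℝ :=
  ∫ m, max (m : ℝ) x ∂(G : Measure Quality)

/-- The expected excess of the match value over `x`. -/
def excess (F : ProbabilityMeasure Quality) (x : ℝ) : ℝ := expMax F x - x

theorem expMax_mono (G : ProbabilityMeasure Quality) {x y : ℝ} (h : x ≤ y) :
    expMax G x ≤ expMax G y :=
  integral_mono (integrable_max _ x) (integrable_max _ y) fun _ => max_le_max le_rfl h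

theorem expMax_sub_le (G : ProbabilityMeasure Quality) {x y : ℝ} (h : x ≤ y) :
    expMax G y - expMax G x ≤ y - x := by
  have h1 : expMax G y ≤ ∫ m, (max (m : ℝ) x + (y - x)) ∂(G : Measure Quality) := by
    refine integral_mono (integrable_max _ y) ((integrable_max _ x).add (integrable_const _))
      fun m => ?_
    refine max_le ?_ ?_
    · have := le_max_left (m : ℝ) x; dsimp only; linarith
    · have := le_max_right (m : ℝ) x; dsimp only; linarith
  rw [integral_add (integrable_max _ x) (integrable_const _)] at h1
  simp only [integral_const, probReal_univ, one_smul] at h1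
  unfold expMax at *
  linarith

theorem continuous_expMax (G : ProbabilityMeasure Quality) : Continuous (expMax G) := by
  refine LipschitzWith.continuous (K := 1) (LipschitzWith.of_dist_le_mul fun x y => ?_)
  rw [Real.dist_eq, Real.dist_eq, NNReal.coe_one, one_mul]
  rcases le_total x y with h | h
  · rw [abs_sub_comm, abs_sub_comm x, abs_of_nonneg (sub_nonneg.2 h),
      abs_of_nonneg (sub_nonneg.2 (expMax_mono G h))]
    exact expMax_sub_le G h
  · rw [abs_of_nonneg (sub_nonneg.2 h), abs_of_nonneg (sub_nonneg.2 (expMax_mono G h))]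
    exact expMax_sub_le G h

theorem continuous_excess : Continuous (excess F) := (continuous_expMax F).sub continuous_id

theorem excess_antitone : Antitone (excess F) := fun x y h => by
  have := expMax_sub_le F h
  unfold excess
  linarith

theorem le_expMax (x : ℝ) : x ≤ expMax F x := by
  have := integral_mono (μ := (F : Measure Quality)) (integrable_const x) (integrable_max _ x)
    fun m => le_max_right _ _
  simpa [expMax] using this

theorem excess_nonneg (x : ℝ) : 0 ≤ excess F x := sub_nonneg.2 (le_expMax x)

theorem priorMean_le_expMax (x : ℝ) : priorMean F ≤ expMax F x :=
  integral_mono (integrable_coe _) (integrable_max _ x) fun _ => le_max_left _ _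

theorem expMax_of_nonpos {x : ℝ} (hx : x ≤ 0) : expMax F x = priorMean F :=
  integral_congr_ae (Filter.Eventually.of_forall fun θ => max_eq_left (hx.trans θ.2.1))

theorem excess_of_one_le {x : ℝ} (hx : 1 ≤ x) : excess F x = 0 := by
  have : expMax F x = x := by
    unfold expMax
    rw [integral_congr_ae (Filter.Eventually.of_forall
      fun θ : Quality => max_eq_right (θ.2.2.trans hx))]
    simp
  rw [excess, this, sub_self]

/-- Pointwise `max θ y ≤ max θ x + (y - x)`, strictly when `θ > x`. Equal excesses make both sides
equal in mean, hence almost surely. Thus the excess is strictly decreasing until it vanishes. -/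
theorem ae_le_of_excess_eq {x y : ℝ} (hxy : x < y) (h : excess F x = excess F y) :
    ∀ᵐ θ : Quality ∂(F : Measure Quality), (θ : ℝ) ≤ x := by
  have hint : Integrable (fun θ : Quality => max (θ : ℝ) x + (y - x) - max (θ : ℝ) y)
      (F : Measure Quality) :=
    ((integrable_max _ x).add (integrable_const _)).sub (integrable_max _ y)
  have hnn : (0 : Quality → ℝ) ≤ fun θ : Quality => max (θ : ℝ) x + (y - x) - max (θ : ℝ) y := by
    intro θ
    simp only [Pi.zero_apply, sub_nonneg]
    refine max_le ?_ ?_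
    · have := le_max_left (θ : ℝ) x; linarith
    · have := le_max_right (θ : ℝ) x; linarith
  have h0 : ∫ θ, (max (θ : ℝ) x + (y - x) - max (θ : ℝ) y) ∂(F : Measure Quality) = 0 := by
    have h1 : Integrable (fun θ : Quality => max (θ : ℝ) x + (y - x)) (F : Measure Quality) :=
      (integrable_max _ x).add (integrable_const _)
    rw [integral_sub h1 (integrable_max _ y), integral_add (integrable_max _ x) (integrable_const _)]
    simp only [integral_const, probReal_univ, one_smul]
    unfold excess expMax at h
    linarith
  filter_upwards [(integral_eq_zero_iff_of_nonneg hnn hint).1 h0] with θ hθ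
  by_contra hc
  push Not at hc
  simp only [Pi.zero_apply] at hθ
  rw [max_eq_left hc.le] at hθ
  rcases max_cases (θ : ℝ) y with ⟨h1, _⟩ | ⟨h1, _⟩ <;> linarith

theorem excess_eq_zero_of_ae_le {x : ℝ} (h : ∀ᵐ θ : Quality ∂(F : Measure Quality), (θ : ℝ) ≤ x) :
    excess F x = 0 := by
  have : expMax F x = x := by
    unfold expMax
    rw [integral_congr_ae (h.mono fun θ hθ => max_eq_right hθ)]
    simp
  rw [excess, this, sub_self]

theorem excess_lt {x y : ℝ} (hxy : x < y) (h : 0 < excess F x) : excess F y < excess F x := by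
  refine lt_of_le_of_ne (excess_antitone hxy.le) fun heq => h.ne' ?_
  exact excess_eq_zero_of_ae_le (ae_le_of_excess_eq hxy heq.symm)

theorem isMcCallPayoff_iff {k u : ℝ} : IsMcCallPayoff F k u ↔ excess F u = k := by
  have hs : MeasurableSet {θ : Quality | u ≤ (θ : ℝ)} :=
    measurableSet_le measurable_const measurable_subtype_coe
  have : ∫ θ in {θ : Quality | u ≤ (θ : ℝ)}, ((θ : ℝ) - u) ∂(F : Measure Quality) =
      excess F u := by
    rw [← integral_indicator hs, excess, expMax]
    have h1 : (∫ θ : Quality, max (θ : ℝ) u ∂(F : Measure Quality)) - u =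
        ∫ θ : Quality, (max (θ : ℝ) u - u) ∂(F : Measure Quality) := by
      rw [integral_sub (integrable_max _ u) (integrable_const _)]; simp
    rw [h1]
    refine integral_congr_ae (Filter.Eventually.of_forall fun θ => ?_)
    by_cases h : u ≤ (θ : ℝ)
    · simp [Set.indicator, h]
    · simp [Set.indicator, h, (not_le.1 h).le]
  rw [IsMcCallPayoff, this, eq_comm]

/-- The excess is continuous, falls from `m^∅` at `0` to `0` at `1`, and is strictly decreasing
wherever it is positive. -/
theorem existsUnique_isMcCallPayoff {k : ℝ} (hk : k ∈ Set.Ioo 0 (priorMean F)) :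
    ∃! u, IsMcCallPayoff F k u := by
  simp only [isMcCallPayoff_iff]
  have h0 : excess F 0 = priorMean F := by rw [excess, expMax_of_nonpos le_rfl, sub_zero]
  have h1 : excess F 1 = 0 := excess_of_one_le le_rfl
  obtain ⟨u, -, hu⟩ := intermediate_value_Icc' zero_le_one
    (continuous_excess (F := F)).continuousOn (by rw [h0, h1]; exact ⟨hk.1.le, hk.2.le⟩)
  refine ⟨u, hu, fun v hv => ?_⟩
  have key : ∀ x y : ℝ, excess F x = k → excess F y = k → ¬ x < y := fun x y hx hy hxy => by
    have := excess_lt hxy (hx ▸ hk.1)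
    rw [hx, hy] at this
    exact lt_irrefl _ this
  exact le_antisymm (not_lt.1 (key _ _ hu hv)) (not_lt.1 (key _ _ hv hu))

/-- The search cost, the prior mean and the McCall payoff. -/
structure McCall (F : ProbabilityMeasure Quality) (k u : ℝ) : Prop where
  pos : 0 < k
  lt : k < priorMean F
  eq : excess F u = k

namespace McCall

variable {k u : ℝ}

theorem le_of_le_excess (H : McCall F k u) {x : ℝ} (h : k ≤ excess F x) : x ≤ u := by
  by_contra hc
  have := excess_lt (not_le.1 hc) (H.eq ▸ H.pos)
  rw [H.eq] at this
  linarith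

theorem autarky_pos (H : McCall F k u) : 0 < autarkyPayoff F k := sub_pos.2 H.lt

theorem autarky_lt (H : McCall F k u) : autarkyPayoff F k < priorMean F := by
  have := H.pos; unfold autarkyPayoff; linarith

theorem autarky_le (H : McCall F k u) : autarkyPayoff F k ≤ u := by
  refine H.le_of_le_excess ?_
  have := priorMean_le_expMax (F := F) (autarkyPayoff F k)
  unfold excess
  unfold autarkyPayoff at *
  linarith

theorem lt_one (H : McCall F k u) : u < 1 := by
  by_contra hc
  have := H.eq
  rw [excess_of_one_le (not_lt.1 hc)] at this
  exact H.pos.ne this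

theorem expMax_eq (H : McCall F k u) : expMax F u = u + k := by
  have := H.eq; unfold excess at this; linarith

/-- This removes `u`, itself a function of `k`, from the regime condition; what remains depends on
`k` alone and can be studied by monotonicity. -/
theorem expMax_autarky_le_iff (H : McCall F k u) :
    expMax F (autarkyPayoff F k) ≤ u ↔ k ≤ excess F (expMax F (autarkyPayoff F k)) :=
  ⟨fun h => H.eq.symm.trans_le (excess_antitone h), H.le_of_le_excess⟩

end McCall

/-! ### Atomlessness and the existence of the threshold -/

theorem measure_singleton (hF : (F : Measure Quality) ≪ volume) (x : Quality) :
    (F : Measure Quality) {x} = 0 := by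
  refine hF ?_
  rw [Measure.Subtype.volume_def, Measure.comap_apply _ Subtype.val_injective
    (fun s hs => measurableSet_Icc.subtype_image hs) _ (measurableSet_singleton x)]
  simp

theorem ae_ne (hF : (F : Measure Quality) ≪ volume) (x : ℝ) :
    ∀ᵐ θ : Quality ∂(F : Measure Quality), (θ : ℝ) ≠ x := by
  by_cases hx : x ∈ Set.Icc (0 : ℝ) 1
  · have := measure_singleton hF ⟨x, hx⟩
    refine (measure_eq_zero_iff_ae_notMem.1 this).mono fun θ hθ h => hθ ?_
    exact Subtype.ext h
  · exact Filter.Eventually.of_forall fun θ h => hx (h ▸ θ.2)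

theorem priorMean_pos (hF : (F : Measure Quality) ≪ volume) : 0 < priorMean F := by
  refine lt_of_le_of_ne (priorMean_mem F).1 fun h => ?_
  have h1 := (integral_eq_zero_iff_of_nonneg (μ := (F : Measure Quality))
    (f := fun θ : Quality => (θ : ℝ)) (fun θ => θ.2.1) (integrable_coe _)).1 h.symm
  obtain ⟨θ, h2, h3⟩ := (h1.and (ae_ne hF 0)).exists
  exact h3 h2

/-- If the excess vanished at `x = E max(θ, m^∅)`, then `θ ≤ x` almost surely. So `max(θ, m^∅)` is
at most its own mean `x`, hence constant. As `θ ≠ x` almost surely, `m^∅ = x`; then `θ` is at most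
its own mean and also constant, which atomlessness excludes. -/
theorem excess_expMax_priorMean_pos (hF : (F : Measure Quality) ≪ volume) :
    0 < excess F (expMax F (priorMean F)) := by
  refine lt_of_le_of_ne (excess_nonneg _) fun h => ?_
  set x := expMax F (priorMean F) with hx
  have h1 : ∀ᵐ θ : Quality ∂(F : Measure Quality), (θ : ℝ) ≤ x :=
    ae_le_of_excess_eq (lt_add_one x) (le_antisymm (h ▸ excess_nonneg _) (excess_antitone (by simp)))
  have hmx : priorMean F ≤ x := le_expMax _
  have key : ∀ φ : Quality → ℝ, Integrable φ (F : Measure Quality) →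
      (∀ᵐ θ : Quality ∂(F : Measure Quality), φ θ ≤ x) → ∫ θ, φ θ ∂(F : Measure Quality) = x →
      ∀ᵐ θ : Quality ∂(F : Measure Quality), φ θ = x := fun φ hφ hle heq => by
    have hnn : 0 ≤ᵐ[(F : Measure Quality)] fun θ => x - φ θ := hle.mono fun θ h => sub_nonneg.2 h
    have h0 : ∫ θ, (x - φ θ) ∂(F : Measure Quality) = 0 := by
      rw [integral_sub (integrable_const _) hφ, heq]; simp
    refine ((integral_eq_zero_iff_of_nonneg_ae hnn ((integrable_const x).sub hφ)).1 h0).mono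
      fun θ hθ => ?_
    have : x - φ θ = 0 := hθ
    linarith
  have h2 := key _ (integrable_max _ (priorMean F)) (h1.mono fun θ hθ => max_le hθ hmx) hx.symm
  obtain ⟨θ, h3, h4⟩ := (h2.and (ae_ne hF x)).exists
  have h5 : priorMean F = x := by
    rcases max_choice (θ : ℝ) (priorMean F) with h | h <;> rw [h] at h3
    · exact absurd h3 h4
    · exact h3
  have h6 := key _ (integrable_coe _) h1 h5
  obtain ⟨θ, h7, h8⟩ := (h6.and (ae_ne hF x)).exists
  exact h8 h7

/-- The threshold search cost. -/
theorem exists_threshold (hF : (F : Measure Quality) ≪ volume) :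
    ∃ c ∈ Set.Ioo 0 (priorMean F), ∀ k ∈ Set.Ioo 0 (priorMean F),
      (k ≤ c ↔ k ≤ excess F (expMax F (autarkyPayoff F k))) := by
  set D : ℝ → ℝ := fun k => excess F (expMax F (autarkyPayoff F k)) - k with hD
  have hcont : Continuous D := by
    have : Continuous fun k => autarkyPayoff F k := continuous_const.sub continuous_id
    exact (continuous_excess.comp ((continuous_expMax F).comp this)).sub continuous_id
  -- When `k` rises, `L` falls by the same amount and `expMax F L` by no more. Since the excess has
  -- slope at least `-1`, its increase is offset by the subtracted `k`.
  have hanti : Antitone D := fun k k' hkk => by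
    have h0 : autarkyPayoff F k' ≤ autarkyPayoff F k := by unfold autarkyPayoff; linarith
    have h1 := expMax_sub_le F h0
    have h2 := expMax_mono F h0
    have h3 := expMax_mono F h2
    simp only [hD, excess]
    unfold autarkyPayoff at *
    linarith
  have hm := priorMean_pos hF
  have hD0 : 0 < D 0 := by
    simpa [hD, autarkyPayoff] using excess_expMax_priorMean_pos hF
  have hD1 : D (priorMean F) < 0 := by
    have h0 : excess F 0 = priorMean F := by rw [excess, expMax_of_nonpos le_rfl, sub_zero]
    have := excess_lt hm (h0 ▸ hm)
    simp only [hD, autarkyPayoff, sub_self, expMax_of_nonpos le_rfl]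
    linarith
  -- Monotonicity is only weak, so the zero need not be unique. The threshold is the largest point
  -- with `D ≥ 0`; the zero `k₁` shows that this point exists and is positive.
  obtain ⟨k₁, hk₁, hk₁'⟩ := intermediate_value_Icc' hm.le hcont.continuousOn ⟨hD1.le, hD0.le⟩
  have hk₁pos : 0 < k₁ := lt_of_le_of_ne hk₁.1 fun h => by rw [← h] at hk₁'; exact hD0.ne' hk₁'
  have hcomp : IsCompact (Set.Icc 0 (priorMean F) ∩ {k | 0 ≤ D k}) :=
    isCompact_Icc.inter_right (isClosed_le continuous_const hcont)
  obtain ⟨c, hc, hmax⟩ := hcomp.exists_isGreatest ⟨k₁, hk₁, hk₁'.ge⟩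
  have hDc : 0 ≤ D c := hc.2
  refine ⟨c, ⟨hk₁pos.trans_le (hmax ⟨hk₁, hk₁'.ge⟩), lt_of_le_of_ne hc.1.2 fun h => ?_⟩,
    fun k hk => ⟨fun h => ?_, fun h => hmax ⟨⟨hk.1.le, hk.2.le⟩, ?_⟩⟩⟩
  · rw [h] at hDc; linarith
  · have := hanti h
    simp only [hD] at this hDc
    linarith
  · simp only [hD, Set.mem_ofPred_eq]
    linarith

/-- Above the threshold search cost, there are search costs with positive gains from search. -/
theorem exists_gains_above {c : ℝ} (hc : c ∈ Set.Ioo 0 (priorMean F))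
    (hcc : c ≤ excess F (expMax F (autarkyPayoff F c))) {c' : ℝ} (hc' : c < c') :
    ∃ k ∈ Set.Ioo c c', k < excess F (autarkyPayoff F k) := by
  have h1 : autarkyPayoff F c < expMax F (autarkyPayoff F c) :=
    lt_of_lt_of_le (by unfold autarkyPayoff; linarith [hc.1]) (priorMean_le_expMax _)
  have h2 : 0 < excess F (autarkyPayoff F c) := hc.1.trans_le (hcc.trans (excess_antitone h1.le))
  have h3 : c < excess F (autarkyPayoff F c) := hcc.trans_lt (excess_lt h1 h2)
  have hcont : Continuous fun k => excess F (autarkyPayoff F k) :=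
    continuous_excess.comp (continuous_const.sub continuous_id)
  have hev : ∀ᶠ k in nhds c, k < excess F (autarkyPayoff F k) :=
    continuous_id.continuousAt.eventually_lt hcont.continuousAt h3
  obtain ⟨k, hk1, hk2⟩ := ((hev.filter_mono nhdsWithin_le_nhds).and
    (Ioo_mem_nhdsGT hc')).exists
  exact ⟨k, hk2, hk1⟩

/-! ### Signals -/

theorem continuous_of_convexOn_univ {φ : ℝ → ℝ} (hφ : ConvexOn ℝ Set.univ φ) : Continuous φ :=
  continuousOn_univ.1 (hφ.continuousOn isOpen_univ)

theorem ofReal_max (x y : ℝ) :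
    ENNReal.ofReal (max x y) = max (ENNReal.ofReal x) (ENNReal.ofReal y) :=
  ENNReal.ofReal_mono.map_max

theorem lintegral_max (G : ProbabilityMeasure Quality) (x : ℝ) :
    ∫⁻ m, max (ENNReal.ofReal ((m : Quality) : ℝ)) (ENNReal.ofReal x) ∂(G : Measure Quality) =
      ENNReal.ofReal (expMax G x) := by
  rw [expMax, ofReal_integral_eq_lintegral_ofReal (integrable_max _ x)
    (Filter.Eventually.of_forall fun m => m.2.1.trans (le_max_left _ _))]
  simp only [ofReal_max]

theorem expMax_signal_le (G : Signal F) (x : ℝ) : expMax G.1 x ≤ expMax F x :=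
  G.2 (fun y => max y x) ((convexOn_id convex_univ).sup (convexOn_const x convex_univ))

/-- The signal that reveals the match value. -/
def fullSignal (F : ProbabilityMeasure Quality) : Signal F := ⟨F, fun _ _ => le_rfl⟩

theorem map_priorMean_le {φ : ℝ → ℝ} (hφ : ConvexOn ℝ Set.univ φ) :
    φ (priorMean F) ≤ ∫ θ, φ ((θ : Quality) : ℝ) ∂(F : Measure Quality) :=
  hφ.map_integral_le (hφ.continuousOn isOpen_univ) isClosed_univ (by simp) (integrable_coe _)
    (integrable_of_continuous _ (continuous_of_convexOn_univ hφ))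

theorem isProbabilityMeasure_mix (F : ProbabilityMeasure Quality) {α : ℝ} (hα : α ∈ Set.Icc (0 : ℝ) 1) :
    IsProbabilityMeasure (ENNReal.ofReal (1 - α) • Measure.dirac (priorMeanPt F) +
      ENNReal.ofReal α • (F : Measure Quality)) := by
  constructor
  simp only [Measure.coe_add, Measure.coe_smul, Pi.add_apply, Pi.smul_apply, measure_univ,
    smul_eq_mul, mul_one]
  rw [← ENNReal.ofReal_add (by linarith [hα.2]) hα.1]
  simp

/-- The signal that reveals the match value with probability `α`. -/
def mixSignal (F : ProbabilityMeasure Quality) {α : ℝ} (hα : α ∈ Set.Icc (0 : ℝ) 1) : Signal F :=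
  ⟨⟨_, isProbabilityMeasure_mix F hα⟩, fun φ hφ => by
    have hint := fun μ : Measure Quality => fun _ : IsProbabilityMeasure μ =>
      integrable_of_continuous μ (continuous_of_convexOn_univ hφ)
    have h1 : Integrable (fun θ : Quality => φ θ)
        (ENNReal.ofReal (1 - α) • Measure.dirac (priorMeanPt F)) :=
      (hint _ inferInstance).smul_measure ENNReal.ofReal_ne_top
    have h2 : Integrable (fun θ : Quality => φ θ)
        (ENNReal.ofReal α • (F : Measure Quality)) :=
      (hint _ inferInstance).smul_measure ENNReal.ofReal_ne_top
    change ∫ m : Quality, φ m ∂(ENNReal.ofReal (1 - α) • Measure.dirac (priorMeanPt F) +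
      ENNReal.ofReal α • (F : Measure Quality)) ≤ _
    rw [integral_add_measure h1 h2, integral_smul_measure, integral_smul_measure, integral_dirac,
      ENNReal.toReal_ofReal (by linarith [hα.2]), ENNReal.toReal_ofReal hα.1]
    have := mul_le_mul_of_nonneg_left (map_priorMean_le (F := F) hφ)
      (by linarith [hα.2] : (0 : ℝ) ≤ 1 - α)
    simp only [smul_eq_mul]
    change (1 - α) * φ (priorMean F) + _ ≤ _
    linarith⟩

theorem lintegral_mixSignal {α : ℝ} (hα : α ∈ Set.Icc (0 : ℝ) 1) (g : Quality → ℝ≥0∞) :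
    ∫⁻ m, g m ∂((mixSignal F hα).1 : Measure Quality) =
      ENNReal.ofReal (1 - α) * g (priorMeanPt F) +
        ENNReal.ofReal α * ∫⁻ m, g m ∂(F : Measure Quality) := by
  change ∫⁻ m, g m ∂(ENNReal.ofReal (1 - α) • Measure.dirac (priorMeanPt F) +
      ENNReal.ofReal α • (F : Measure Quality)) = _
  rw [lintegral_add_measure, lintegral_smul_measure, lintegral_smul_measure, lintegral_dirac,
    smul_eq_mul, smul_eq_mul]

/-- If no mass lies below `u`, the average takes its default value `0`, which is still in `[0, 1]`;
no case distinction is needed. -/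
theorem lower_average_mem (F : ProbabilityMeasure Quality) (u : ℝ) :
    ⨍ θ in {θ : Quality | (θ : ℝ) < u}, (θ : ℝ) ∂(F : Measure Quality) ∈ Set.Icc (0 : ℝ) 1 := by
  rw [setAverage_eq, smul_eq_mul]
  refine ⟨mul_nonneg (inv_nonneg.2 measureReal_nonneg) (integral_nonneg fun θ => θ.2.1), ?_⟩
  have h : ∫ θ in {θ : Quality | (θ : ℝ) < u}, (θ : ℝ) ∂(F : Measure Quality) ≤
      (F : Measure Quality).real {θ : Quality | (θ : ℝ) < u} := by
    have := integral_mono (μ := (F : Measure Quality).restrict {θ : Quality | (θ : ℝ) < u})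
      (integrable_coe (F : Measure Quality)).integrableOn (integrable_const (1 : ℝ))
      fun θ => θ.2.2
    simpa using this
  rw [inv_mul_eq_div]
  exact div_le_one_of_le₀ h measureReal_nonneg

open scoped Classical in
/-- The match value if it is at least `u`, and else the expected match value below `u`. -/
def poolBelow (F : ProbabilityMeasure Quality) (u : ℝ) (θ : Quality) : Quality :=
  if (θ : ℝ) < u then ⟨_, lower_average_mem F u⟩ else θ

theorem measurableSet_lt_quality (u : ℝ) : MeasurableSet {θ : Quality | (θ : ℝ) < u} :=
  measurableSet_lt measurable_subtype_coe measurable_const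

theorem measurable_poolBelow (u : ℝ) : Measurable (poolBelow F u) :=
  Measurable.ite (measurableSet_lt_quality u) measurable_const measurable_id

/-- The signal that reveals the match value if it is at least `u`, and else only that it is not. -/
def poolSignal (F : ProbabilityMeasure Quality) (u : ℝ) : Signal F :=
  ⟨⟨(F : Measure Quality).map (poolBelow F u),
    Measure.isProbabilityMeasure_map (measurable_poolBelow u).aemeasurable⟩, fun φ hφ => by
    have hc := continuous_of_convexOn_univ hφ
    have hint := integrable_of_continuous (F : Measure Quality) hc
    set s := {θ : Quality | (θ : ℝ) < u} with hs
    have hsm : MeasurableSet s := measurableSet_lt_quality u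
    change ∫ m : Quality, φ m ∂((F : Measure Quality).map (poolBelow F u)) ≤ _
    have hmeas : Measurable fun m : Quality => φ m := hc.measurable.comp measurable_subtype_coe
    rw [integral_map (measurable_poolBelow u).aemeasurable hmeas.aestronglyMeasurable]
    have hprob : IsProbabilityMeasure ((F : Measure Quality).map (poolBelow F u)) :=
      Measure.isProbabilityMeasure_map (measurable_poolBelow u).aemeasurable
    have hint' : Integrable (fun θ : Quality => φ (poolBelow F u θ)) (F : Measure Quality) :=
      (integrable_of_continuous ((F : Measure Quality).map (poolBelow F u)) hc).comp_measurable
        (measurable_poolBelow u)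
    rw [← integral_add_compl hsm hint', ← integral_add_compl hsm hint]
    refine add_le_add ?_ (setIntegral_congr_fun hsm.compl fun θ hθ => ?_).le
    · rw [setIntegral_congr_fun (g := fun _ =>
        φ (⨍ θ in s, (θ : ℝ) ∂(F : Measure Quality))) hsm fun θ hθ => ?_]
      · rw [setIntegral_const, smul_eq_mul]
        -- Jensen's inequality on the pooled event needs positive mass; without mass both integrals
        -- vanish.
        rcases eq_or_ne ((F : Measure Quality) s) 0 with h0 | h0
        · rw [Measure.restrict_eq_zero.2 h0]; simp [measureReal_def, h0]
        · have h1 := hφ.map_set_average_le (μ := (F : Measure Quality)) (t := s)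
            (f := fun θ : Quality => (θ : ℝ)) (hφ.continuousOn isOpen_univ) isClosed_univ h0
            (measure_ne_top _ _) (by simp) (integrable_coe _).integrableOn hint.integrableOn
          rw [setAverage_eq (f := fun θ : Quality => φ θ), smul_eq_mul] at h1
          have h2 : 0 < (F : Measure Quality).real s :=
            ENNReal.toReal_pos h0 (measure_ne_top _ _)
          calc _ ≤ (F : Measure Quality).real s * (((F : Measure Quality).real s)⁻¹ *
                ∫ θ in s, φ θ ∂(F : Measure Quality)) := mul_le_mul_of_nonneg_left h1 h2.le
            _ = _ := mul_inv_cancel_left₀ h2.ne' _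
      · have : (θ : ℝ) < u := hθ
        simp [poolBelow, this, hs]
    · have : ¬ (θ : ℝ) < u := hθ
      simp [poolBelow, this]⟩

namespace McCall

variable {k u : ℝ}

/-- Splitting `E θ = m^∅` and `E max(θ, u) = u + k` at `u` and subtracting. In other words, `L` is
the mean of the variable that equals `θ` below `u` and `u` elsewhere. -/
theorem setIntegral_lt (H : McCall F k u) :
    ∫ θ in {θ : Quality | (θ : ℝ) < u}, (θ : ℝ) ∂(F : Measure Quality) =
      autarkyPayoff F k - (F : Measure Quality).real {θ : Quality | (θ : ℝ) < u}ᶜ * u := by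
  have hsm := measurableSet_lt_quality u
  have h1 := integral_add_compl hsm (integrable_coe (F : Measure Quality))
  have h2 := integral_add_compl hsm (integrable_max (F : Measure Quality) u)
  have h3 : ∫ θ in {θ : Quality | (θ : ℝ) < u}, max (θ : ℝ) u ∂(F : Measure Quality) =
      (F : Measure Quality).real {θ : Quality | (θ : ℝ) < u} * u := by
    rw [setIntegral_congr_fun (g := fun _ => u) hsm fun θ hθ => max_eq_right (le_of_lt hθ)]
    simp
  have h4 : ∫ θ in {θ : Quality | (θ : ℝ) < u}ᶜ, max (θ : ℝ) u ∂(F : Measure Quality) =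
      ∫ θ in {θ : Quality | (θ : ℝ) < u}ᶜ, (θ : ℝ) ∂(F : Measure Quality) :=
    setIntegral_congr_fun hsm.compl fun θ hθ => max_eq_left (not_lt.1 hθ)
  have h5 := H.expMax_eq
  have h6 : (F : Measure Quality).real {θ : Quality | (θ : ℝ) < u} = 1 -
      (F : Measure Quality).real {θ : Quality | (θ : ℝ) < u}ᶜ := by
    rw [probReal_compl_eq_one_sub hsm]; ring
  unfold expMax at h5
  rw [h3, h6] at h2
  unfold autarkyPayoff
  change _ = priorMean F at h1
  rw [h4] at h2
  linarith

/-- The probability of a match value that is at least the McCall payoff. -/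
def probGood (F : ProbabilityMeasure Quality) (u : ℝ) : ℝ :=
  (F : Measure Quality).real {θ : Quality | (θ : ℝ) < u}ᶜ

theorem probGood_pos (H : McCall F k u) : 0 < probGood F u := by
  refine lt_of_le_of_ne measureReal_nonneg fun h => ?_
  have h0 : (F : Measure Quality) {θ : Quality | (θ : ℝ) < u}ᶜ = 0 :=
    (measureReal_eq_zero_iff (measure_ne_top _ _)).1 h.symm
  have h1 : ∀ᵐ θ : Quality ∂(F : Measure Quality), (θ : ℝ) ≤ u :=
    (measure_eq_zero_iff_ae_notMem.1 h0).mono fun θ hθ => by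
      simp only [Set.mem_compl_iff, not_not] at hθ
      exact le_of_lt hθ
  have := excess_eq_zero_of_ae_le h1
  rw [H.eq] at this
  exact H.pos.ne' this

theorem probGood_le_one : probGood F u ≤ 1 := measureReal_le_one

/-- `L` is the average of `u` and the pooled mean, weighted by the masses above and below `u`; since
`L ≤ u`, the pooled mean is at most `L`, strictly if `L < u`. -/
theorem poolBelow_of_lt (H : McCall F k u) {θ : Quality} (hθ : (θ : ℝ) < u) :
    (poolBelow F u θ : ℝ) ≤ autarkyPayoff F k ∧
      (autarkyPayoff F k < u → (poolBelow F u θ : ℝ) < autarkyPayoff F k) := by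
  have e : (poolBelow F u θ : ℝ) =
      ((F : Measure Quality).real {θ : Quality | (θ : ℝ) < u})⁻¹ *
        (autarkyPayoff F k - probGood F u * u) := by
    simp only [poolBelow, hθ, if_true]
    rw [setAverage_eq, H.setIntegral_lt, smul_eq_mul]
    rfl
  rw [e]
  set f := (F : Measure Quality).real {θ : Quality | (θ : ℝ) < u} with hf
  have hq : probGood F u = 1 - f := probReal_compl_eq_one_sub (measurableSet_lt_quality u)
  have hqpos := H.probGood_pos
  have hf0 : 0 ≤ f := measureReal_nonneg
  -- If the pool has no mass, its mean is the default `0`, which lies below `L > 0`.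
  rcases hf0.eq_or_lt with h0 | h0
  · rw [← h0]
    simpa using ⟨H.autarky_pos.le, fun _ => H.autarky_pos⟩
  · have e2 : f⁻¹ * (autarkyPayoff F k - probGood F u * u) =
        autarkyPayoff F k - f⁻¹ * (probGood F u * (u - autarkyPayoff F k)) := by
      rw [hq]; field_simp; ring
    rw [e2]
    have h1 := H.autarky_le
    refine ⟨by
      have : 0 ≤ f⁻¹ * (probGood F u * (u - autarkyPayoff F k)) :=
        mul_nonneg (inv_nonneg.2 h0.le) (mul_nonneg hqpos.le (sub_nonneg.2 h1))
      linarith, fun h2 => ?_⟩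
    have : 0 < f⁻¹ * (probGood F u * (u - autarkyPayoff F k)) :=
      mul_pos (inv_pos.2 h0) (mul_pos hqpos (sub_pos.2 h2))
    linarith

/-- The agent replaces the pooled mean by `L` and keeps every value above `u`. The resulting gain `q
(u - L)` over `m^∅`, with `q` the mass above `u`, is the most he would pay, and hence the extraction
price. -/
theorem expMax_poolSignal (H : McCall F k u) :
    expMax (poolSignal F u).1 (autarkyPayoff F k) =
      priorMean F + probGood F u * (u - autarkyPayoff F k) := by
  have h0 : expMax (poolSignal F u).1 (autarkyPayoff F k) =
      ∫ θ, max (poolBelow F u θ : ℝ) (autarkyPayoff F k) ∂(F : Measure Quality) := by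
    refine integral_map (measurable_poolBelow u).aemeasurable ?_
    exact (measurable_subtype_coe.max measurable_const).aestronglyMeasurable
  have hsm := (measurableSet_lt_quality u).compl
  have h1 : ∀ θ : Quality, max (poolBelow F u θ : ℝ) (autarkyPayoff F k) =
      (max (θ : ℝ) u + (autarkyPayoff F k - u)) + {θ : Quality | (θ : ℝ) < u}ᶜ.indicator
        (fun _ => u - autarkyPayoff F k) θ := fun θ => by
    by_cases hθ : (θ : ℝ) < u
    · rw [max_eq_right (H.poolBelow_of_lt hθ).1, max_eq_right hθ.le,
        Set.indicator_of_notMem (by simpa using hθ)]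
      ring
    · rw [Set.indicator_of_mem (by simpa using hθ), max_eq_left (not_lt.1 hθ)]
      have : poolBelow F u θ = θ := by simp [poolBelow, hθ]
      rw [this, max_eq_left (H.autarky_le.trans (not_lt.1 hθ))]
      ring
  rw [h0]
  simp only [h1]
  have hi : Integrable (fun θ : Quality => max (θ : ℝ) u + (autarkyPayoff F k - u))
      (F : Measure Quality) := (integrable_max (F : Measure Quality) u).add (integrable_const _)
  rw [integral_add hi ((integrable_const _).indicator hsm),
    integral_add (integrable_max _ u) (integrable_const _), integral_indicator hsm,
    setIntegral_const]
  have := H.expMax_eq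
  unfold expMax at this
  rw [this]
  simp only [integral_const, probReal_univ, smul_eq_mul]
  unfold probGood autarkyPayoff
  ring

/-- The pool sits strictly below `L`, so with probability at least `1 - q` an agent who expects
autarky searches on and the broker can sell again. -/
theorem le_poolSignal_lt (H : McCall F k u) (h : autarkyPayoff F k < u) :
    ENNReal.ofReal (1 - probGood F u) ≤
      ((poolSignal F u).1 : Measure Quality) {m : Quality | (m : ℝ) < autarkyPayoff F k} := by
  change _ ≤ (F : Measure Quality).map (poolBelow F u) _
  rw [Measure.map_apply (measurable_poolBelow u) (measurableSet_lt_quality _)]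
  have : ENNReal.ofReal (1 - probGood F u) = (F : Measure Quality) {θ : Quality | (θ : ℝ) < u} := by
    rw [probGood, probReal_compl_eq_one_sub (measurableSet_lt_quality u), sub_sub_cancel,
      ofReal_measureReal]
  rw [this]
  exact measure_mono fun θ hθ => (H.poolBelow_of_lt hθ).2 h

end McCall

/-! ### Equilibria that are carried by a two-state automaton -/

/-- The history without its last period. -/
def initial {t : ℕ} (h : History F (t + 1)) : History F t := fun j => h j.castSucc

/-- The last period of a history. -/
def final {t : ℕ} (h : History F (t + 1)) : Outcome F := h (Fin.last t)

@[simp] theorem initial_snoc {t : ℕ} (h : History F t) (x : Outcome F) : initial (snoc h x) = h := by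
  ext1 j
  simp [initial, snoc]

@[simp] theorem final_snoc {t : ℕ} (h : History F t) (x : Outcome F) : final (snoc h x) = x := by
  simp [final, snoc]

open scoped Classical in
/-- The transition of the automaton. In the active state the broker is expected to offer `o₀`. It
remains active if the agent buys `o₀` and observes a posterior mean other than the prior mean, or if
he rejects another offer. -/
def nextActive (o₀ : Offer F) (c : Bool) (x : Outcome F) : Bool :=
  if c = true then
    if x.1 = o₀ then (if x.2.1 = true ∧ x.2.2 ≠ priorMeanPt F then true else false)
    else (if x.2.1 = true then false else true)
  else false

/-- Whether the automaton is active after a history. -/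
def active (target : ℕ → Offer F) (init : Bool) : ∀ t, History F t → Bool
  | 0, _ => init
  | t + 1, h => nextActive (target t) (active target init t (initial h)) (final h)

theorem active_snoc (target : ℕ → Offer F) (init : Bool) {t : ℕ} (h : History F t)
    (x : Outcome F) : active target init (t + 1) (snoc h x) =
      nextActive (target t) (active target init t h) x := by
  simp [active]

theorem measurable_nextActive (o₀ : Offer F) :
    Measurable fun z : Bool × Outcome F => nextActive o₀ z.1 z.2 := by
  refine Measurable.ite (measurable_fst (measurableSet_singleton true)) (Measurable.ite ?_
    (Measurable.ite (MeasurableSet.inter ?_ (MeasurableSet.compl ?_)) measurable_const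
      measurable_const) (Measurable.ite ?_ measurable_const measurable_const)) measurable_const
  · exact (by fun_prop : Measurable fun z : Bool × Outcome F => z.2.1) (measurableSet_singleton o₀)
  · exact (by fun_prop : Measurable fun z : Bool × Outcome F => z.2.2.1)
      (measurableSet_singleton true)
  · exact (by fun_prop : Measurable fun z : Bool × Outcome F => z.2.2.2)
      (measurableSet_singleton (priorMeanPt F))
  · exact (by fun_prop : Measurable fun z : Bool × Outcome F => z.2.2.1)
      (measurableSet_singleton true)

theorem measurable_active (target : ℕ → Offer F) (init : Bool) (t : ℕ) :
    Measurable (active target init t) := by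
  induction t with
  | zero => exact measurable_const
  | succ t ih =>
    have h1 : Measurable fun h : History F (t + 1) => initial h :=
      measurable_pi_lambda _ fun j => measurable_pi_apply _
    have h2 : Measurable fun h : History F (t + 1) => final h := measurable_pi_apply _
    exact (measurable_nextActive (target t)).comp ((ih.comp h1).prodMk h2)

theorem active_eq_false (target : ℕ → Offer F) (t : ℕ) (h : History F t) :
    active target false t h = false := by
  induction t with
  | zero => rfl
  | succ t ih => simp [active, ih, nextActive]

/-- The expected maximum of the posterior mean and `L` under an offer. -/
def offerValue (L : ℝ≥0∞) (o : Offer F) : ℝ≥0∞ :=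
  ∫⁻ m, max (ENNReal.ofReal ((m : Quality) : ℝ)) L ∂((o.2.1 : ProbabilityMeasure Quality) : Measure Quality)

theorem measurable_offerValue (L : ℝ≥0∞) : Measurable (offerValue (F := F) L) := by
  have h1 : Measurable fun o : Offer F => ((o.2.1 : ProbabilityMeasure Quality) : Measure Quality) :=
    measurable_subtype_coe.comp (measurable_subtype_coe.comp measurable_snd)
  exact (Measure.measurable_lintegral (by fun_prop)).comp h1

theorem offerValue_ofReal (x : ℝ) (o : Offer F) :
    offerValue (ENNReal.ofReal x) o = ENNReal.ofReal (expMax o.2.1 x) := lintegral_max _ x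

@[simp] theorem signalLaw_true (o : Offer F) :
    signalLaw o true = ((o.2.1 : ProbabilityMeasure Quality) : Measure Quality) := rfl

@[simp] theorem signalLaw_false (o : Offer F) :
    signalLaw o false = Measure.dirac (priorMeanPt F) := rfl

@[simp] theorem payment_true (o : Offer F) : payment o true = ((o.1 : ℝ≥0) : ℝ≥0∞) := rfl

@[simp] theorem payment_false (o : Offer F) : payment o false = 0 := rfl

theorem coe_priorMeanPt : ((priorMeanPt F : Quality) : ℝ) = priorMean F := rfl

/-- The data of an automaton equilibrium: in period `t` the active automaton offers for the price
`p t` a signal that is fully revealing with probability `α t`, which gives the agent the payoff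
`w t`. -/
structure Plan (F : ProbabilityMeasure Quality) (k u : ℝ) where
  mccall : McCall F k u
  p : ℕ → ℝ≥0
  α : ℕ → ℝ
  hα : ∀ t, α t ∈ Set.Icc (0 : ℝ) 1
  w : ℕ → ℝ
  w_eq : ∀ t, w t = autarkyPayoff F k + α t * (u - autarkyPayoff F k) - p t
  le_w : ∀ t, autarkyPayoff F k ≤ w t
  w_succ : ∀ t, w (t + 1) = u
  p_succ : ∀ t, p (t + 1) = 0
  init : Bool
  hinit : init = true → expMax F (autarkyPayoff F k) ≤ u

namespace Plan

variable {k u : ℝ} (Q : Plan F k u)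

/-- The offer in the active state. -/
def target (t : ℕ) : Offer F := (Q.p t, mixSignal F (Q.hα t))

/-- The offer in the inactive state: it extracts the gains from search. -/
def extraction (_ : Plan F k u) : Offer F :=
  (Real.toNNReal (McCall.probGood F u * (u - autarkyPayoff F k)), poolSignal F u)

/-- The state after a history. -/
def state (t : ℕ) (h : History F t) : Bool := active Q.target Q.init t h

/-- The agent's payoff in a state. -/
def agentPayoff (t : ℕ) (c : Bool) : ℝ≥0∞ :=
  ENNReal.ofReal (if c = true then Q.w t else autarkyPayoff F k)

/-- The broker's payoff in a state. -/
def brokerPayoff (t : ℕ) (c : Bool) : ℝ≥0∞ :=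
  if c = true then (Q.p t : ℝ≥0∞) else ENNReal.ofReal (u - autarkyPayoff F k)

/-- The offers on the path. -/
def off (t : ℕ) (h : History F t) : Offer F := if Q.state t h = true then Q.target t else Q.extraction

open scoped Classical in
/-- The agent's purchase decisions. -/
def buy (t : ℕ) (x : History F t × Offer F) : Bool :=
  if Q.state t x.1 = true then (if x.2 = Q.target t then true else false)
  else if (x.2.1 : ℝ≥0∞) + ENNReal.ofReal (priorMean F) ≤
    offerValue (ENNReal.ofReal (autarkyPayoff F k)) x.2 then true else false

open scoped Classical in
/-- The agent's payoff after an offer, gross of the search cost. -/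
def interim (t : ℕ) (h : History F t) (o : Offer F) : ℝ≥0∞ :=
  if Q.state t h = true then
    if o = Q.target t then ENNReal.ofReal (Q.w t + k) else ENNReal.ofReal u
  else max (ENNReal.ofReal (priorMean F))
    (offerValue (ENNReal.ofReal (autarkyPayoff F k)) o - o.1)

theorem measurable_state (t : ℕ) : Measurable (Q.state t) := measurable_active _ _ t

theorem measurable_off (t : ℕ) : Measurable (Q.off t) :=
  Measurable.ite (Q.measurable_state t (measurableSet_singleton true)) measurable_const
    measurable_const

theorem measurable_buy (t : ℕ) : Measurable (Q.buy t) := by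
  refine Measurable.ite (((Q.measurable_state t).comp measurable_fst) (measurableSet_singleton true))
    (Measurable.ite (measurable_snd (measurableSet_singleton _)) measurable_const measurable_const)
    (Measurable.ite (measurableSet_le ?_ ((measurable_offerValue _).comp measurable_snd))
      measurable_const measurable_const)
  fun_prop

theorem state_snoc {t : ℕ} (h : History F t) (x : Outcome F) :
    Q.state (t + 1) (snoc h x) = nextActive (Q.target t) (Q.state t h) x := active_snoc _ _ h x

/-- The inactive state is absorbing, so an active state presupposes an active start, for which the
regime condition is part of the plan. -/
theorem expMax_le_of_state {t : ℕ} {h : History F t} (hs : Q.state t h = true) :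
    expMax F (autarkyPayoff F k) ≤ u := by
  refine Q.hinit ?_
  by_contra hc
  rw [state, eq_false_of_ne_true hc, active_eq_false] at hs
  exact absurd hs (by simp)

theorem w_le (t : ℕ) : Q.w t ≤ u := by
  have h1 := mul_le_of_le_one_left (sub_nonneg.2 Q.mccall.autarky_le) (Q.hα t).2
  have h2 := (Q.p t).coe_nonneg
  rw [Q.w_eq]
  linarith

theorem p_le (t : ℕ) : (Q.p t : ℝ) ≤ u - autarkyPayoff F k := by
  have h1 := mul_le_of_le_one_left (sub_nonneg.2 Q.mccall.autarky_le) (Q.hα t).2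
  have h2 := Q.le_w t
  rw [Q.w_eq] at h2
  linarith

theorem agentPayoff_le_one (t : ℕ) (c : Bool) : Q.agentPayoff t c ≤ 1 := by
  have h1 := Q.w_le t
  have h2 := Q.mccall.lt_one
  have h3 := Q.mccall.autarky_le
  refine ENNReal.ofReal_le_one.2 ?_
  split_ifs <;> linarith

theorem brokerPayoff_le_one (t : ℕ) (c : Bool) : Q.brokerPayoff t c ≤ 1 := by
  have h1 := Q.p_le t
  have h2 := Q.mccall.lt_one
  have h3 := Q.mccall.autarky_pos
  unfold brokerPayoff
  split_ifs
  · rw [← ENNReal.ofReal_coe_nnreal]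
    exact ENNReal.ofReal_le_one.2 (by linarith)
  · exact ENNReal.ofReal_le_one.2 (by linarith)

@[simp] theorem agentPayoff_false (t : ℕ) :
    Q.agentPayoff t false = ENNReal.ofReal (autarkyPayoff F k) := rfl

@[simp] theorem agentPayoff_succ_true (t : ℕ) :
    Q.agentPayoff (t + 1) true = ENNReal.ofReal u := by simp [agentPayoff, Q.w_succ]

@[simp] theorem brokerPayoff_succ_true (t : ℕ) : Q.brokerPayoff (t + 1) true = 0 := by
  simp [brokerPayoff, Q.p_succ]

@[simp] theorem brokerPayoff_false (t : ℕ) :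
    Q.brokerPayoff t false = ENNReal.ofReal (u - autarkyPayoff F k) := rfl

theorem nextActive_target (o₀ : Offer F) (w : Bool) (m : Quality) :
    nextActive o₀ true (o₀, w, m) = true ↔ w = true ∧ m ≠ priorMeanPt F := by
  simp [nextActive]

theorem nextActive_of_ne {o o₀ : Offer F} (ho : o ≠ o₀) (w : Bool) (m : Quality) :
    nextActive o₀ true (o, w, m) = !w := by
  cases w <;> simp [nextActive, ho]

@[simp] theorem nextActive_false (o₀ : Offer F) (x : Outcome F) : nextActive o₀ false x = false := by
  simp [nextActive]

theorem off_of_active {t : ℕ} {h : History F t} (hs : Q.state t h = true) :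
    Q.off t h = Q.target t := by simp [off, hs]

theorem off_of_inactive {t : ℕ} {h : History F t} (hs : Q.state t h = false) :
    Q.off t h = Q.extraction := by simp [off, hs]

theorem interim_target {t : ℕ} {h : History F t} (hs : Q.state t h = true) :
    Q.interim t h (Q.target t) = ENNReal.ofReal (Q.w t + k) := by simp [interim, hs]

theorem interim_of_ne {t : ℕ} {h : History F t} (hs : Q.state t h = true) {o : Offer F}
    (ho : o ≠ Q.target t) : Q.interim t h o = ENNReal.ofReal u := by simp [interim, hs, ho]

theorem interim_of_inactive {t : ℕ} {h : History F t} (hs : Q.state t h = false) (o : Offer F) :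
    Q.interim t h o = max (ENNReal.ofReal (priorMean F))
      (offerValue (ENNReal.ofReal (autarkyPayoff F k)) o - o.1) := by simp [interim, hs]

theorem buy_target {t : ℕ} {h : History F t} (hs : Q.state t h = true) :
    Q.buy t (h, Q.target t) = true := by simp [buy, hs]

theorem buy_of_ne {t : ℕ} {h : History F t} (hs : Q.state t h = true) {o : Offer F}
    (ho : o ≠ Q.target t) : Q.buy t (h, o) = false := by simp [buy, hs, ho]

theorem buy_of_le {t : ℕ} {h : History F t} (hs : Q.state t h = false) {o : Offer F}
    (ho : (o.1 : ℝ≥0∞) + ENNReal.ofReal (priorMean F) ≤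
      offerValue (ENNReal.ofReal (autarkyPayoff F k)) o) : Q.buy t (h, o) = true := by
  simp [buy, hs, ho]

theorem buy_of_not_le {t : ℕ} {h : History F t} (hs : Q.state t h = false) {o : Offer F}
    (ho : ¬ (o.1 : ℝ≥0∞) + ENNReal.ofReal (priorMean F) ≤
      offerValue (ENNReal.ofReal (autarkyPayoff F k)) o) : Q.buy t (h, o) = false := by
  simp only [buy, hs, ho]; simp

include Q in
theorem autarky_le_priorMean :
    ENNReal.ofReal (autarkyPayoff F k) ≤ ENNReal.ofReal (priorMean F) :=
  ENNReal.ofReal_le_ofReal Q.mccall.autarky_lt.le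

/-- The mean `m^∅` is read as an uninformative draw: continuation is then worth `L < m^∅` and the
agent consumes. Any other mean leaves him with `u`, so an informative draw is worth `E max(θ, u) = u
+ k`. Confusing the two has probability zero because `F` has no atoms. -/
theorem target_interim (hF : (F : Measure Quality) ≪ volume) (t : ℕ) :
    ∫⁻ m, max (ENNReal.ofReal ((m : Quality) : ℝ))
        (Q.agentPayoff (t + 1) (nextActive (Q.target t) true (Q.target t, true, m)))
      ∂((Q.target t).2.1 : Measure Quality) = ENNReal.ofReal (Q.w t + k) + Q.p t := by
  refine (lintegral_mixSignal (Q.hα t) _).trans ?_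
  have h1 : nextActive (Q.target t) true (Q.target t, true, priorMeanPt F) = false :=
    eq_false_of_ne_true fun h => ((nextActive_target _ _ _).1 h).2 rfl
  have h2 : ∫⁻ m, max (ENNReal.ofReal ((m : Quality) : ℝ))
        (Q.agentPayoff (t + 1) (nextActive (Q.target t) true (Q.target t, true, m)))
      ∂(F : Measure Quality) = ENNReal.ofReal (u + k) := by
    rw [← Q.mccall.expMax_eq, ← lintegral_max]
    refine lintegral_congr_ae ((ae_ne hF (priorMean F)).mono fun m hm => ?_)
    have h3 : nextActive (Q.target t) true (Q.target t, true, m) = true :=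
      (nextActive_target _ _ _).2 ⟨rfl, fun h => hm (congrArg Subtype.val h)⟩
    simp only [h3, agentPayoff_succ_true]
  have hm := (priorMean_mem F).1
  have hu := Q.mccall.autarky_pos.trans_le Q.mccall.autarky_le
  have hk := Q.mccall.pos
  have hw := Q.mccall.autarky_pos.trans_le (Q.le_w t)
  have hα := Q.hα t
  rw [h1, h2, agentPayoff_false, coe_priorMeanPt, max_eq_left Q.autarky_le_priorMean,
    ← ENNReal.ofReal_coe_nnreal, ← ENNReal.ofReal_mul (by linarith [hα.2]),
    ← ENNReal.ofReal_mul hα.1, ← ENNReal.ofReal_add, ← ENNReal.ofReal_add, Q.w_eq]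
  · unfold autarkyPayoff
    congr 1
    ring
  · linarith
  · exact (Q.p t).coe_nonneg
  · exact mul_nonneg (by linarith [hα.2]) hm
  · exact mul_nonneg hα.1 (by linarith)

/-- After the planned purchase the broker earns nothing more: search continues only in the active
state, where later prices are zero. -/
theorem target_broker (t : ℕ) (m : Quality) :
    (if Q.agentPayoff (t + 1) (nextActive (Q.target t) true (Q.target t, true, m)) ≤
      ENNReal.ofReal (m : ℝ) then 0 else
      Q.brokerPayoff (t + 1) (nextActive (Q.target t) true (Q.target t, true, m))) = 0 := by
  cases hc : nextActive (Q.target t) true (Q.target t, true, m)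
  · have hm : m = priorMeanPt F := by
      by_contra hm
      rw [(nextActive_target _ _ _).2 ⟨rfl, hm⟩] at hc
      exact absurd hc (by simp)
    rw [if_pos]
    rw [hm, agentPayoff_false]
    exact Q.autarky_le_priorMean
  · simp

include Q in
-- The participation constraint bounds the price by `E max(m, L) - m^∅`. Adding `u - L` on the event
-- `m < L` turns the maximum with `L` into at most the maximum with `u`; among signals its mean is
-- largest under full revelation, where it equals `u + k`.
theorem inactive_broker_le {o : Offer F} (ho : (o.1 : ℝ≥0∞) + ENNReal.ofReal (priorMean F) ≤
      offerValue (ENNReal.ofReal (autarkyPayoff F k)) o) :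
    (o.1 : ℝ≥0∞) + ∫⁻ m, (if ENNReal.ofReal (autarkyPayoff F k) ≤
      ENNReal.ofReal ((m : Quality) : ℝ) then 0 else ENNReal.ofReal (u - autarkyPayoff F k))
      ∂((o.2.1 : ProbabilityMeasure Quality) : Measure Quality) ≤
    ENNReal.ofReal (u - autarkyPayoff F k) := by
  have hle := sub_nonneg.2 Q.mccall.autarky_le
  refine ENNReal.le_of_add_le_add_right (a := ENNReal.ofReal (priorMean F))
    ENNReal.ofReal_ne_top ?_
  calc _ = ((o.1 : ℝ≥0∞) + ENNReal.ofReal (priorMean F)) + ∫⁻ m, (if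
        ENNReal.ofReal (autarkyPayoff F k) ≤ ENNReal.ofReal ((m : Quality) : ℝ) then 0 else
        ENNReal.ofReal (u - autarkyPayoff F k))
        ∂((o.2.1 : ProbabilityMeasure Quality) : Measure Quality) := by ring
    _ ≤ _ := add_le_add_left ho _
    _ = ∫⁻ m, (max (ENNReal.ofReal ((m : Quality) : ℝ)) (ENNReal.ofReal (autarkyPayoff F k)) +
        if ENNReal.ofReal (autarkyPayoff F k) ≤ ENNReal.ofReal ((m : Quality) : ℝ) then 0 else
          ENNReal.ofReal (u - autarkyPayoff F k))
        ∂((o.2.1 : ProbabilityMeasure Quality) : Measure Quality) := by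
      rw [lintegral_add_left (by fun_prop)]; rfl
    _ ≤ ∫⁻ m, max (ENNReal.ofReal ((m : Quality) : ℝ)) (ENNReal.ofReal u)
        ∂((o.2.1 : ProbabilityMeasure Quality) : Measure Quality) := by
      refine lintegral_mono fun m => ?_
      dsimp only
      split_ifs with hm
      · rw [max_eq_left hm, add_zero]; exact le_max_left _ _
      · rw [max_eq_right (not_le.1 hm).le, ← ENNReal.ofReal_add Q.mccall.autarky_pos.le hle,
          add_sub_cancel]
        exact le_max_right _ _
    _ = ENNReal.ofReal (expMax o.2.1 u) := lintegral_max _ _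
    _ ≤ ENNReal.ofReal (expMax F u) := ENNReal.ofReal_le_ofReal (expMax_signal_le _ _)
    _ = _ := by
      rw [Q.mccall.expMax_eq, ← ENNReal.ofReal_add hle (priorMean_mem F).1]
      unfold autarkyPayoff
      congr 1
      ring

theorem offerValue_extraction :
    offerValue (ENNReal.ofReal (autarkyPayoff F k)) Q.extraction =
      (Q.extraction.1 : ℝ≥0∞) + ENNReal.ofReal (priorMean F) := by
  have h1 := mul_nonneg Q.mccall.probGood_pos.le (sub_nonneg.2 Q.mccall.autarky_le)
  rw [offerValue_ofReal]
  change ENNReal.ofReal (expMax (poolSignal F u).1 _) = ENNReal.ofReal _ + _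
  rw [Q.mccall.expMax_poolSignal, add_comm, ENNReal.ofReal_add h1 (priorMean_mem F).1]

/-- The price `q (u - L)` plus the chance `1 - q` of facing the same situation again adds up to `u -
L`. -/
theorem le_extraction_broker : ENNReal.ofReal (u - autarkyPayoff F k) ≤
    (Q.extraction.1 : ℝ≥0∞) + ∫⁻ m, (if ENNReal.ofReal (autarkyPayoff F k) ≤
      ENNReal.ofReal ((m : Quality) : ℝ) then 0 else ENNReal.ofReal (u - autarkyPayoff F k))
      ∂((Q.extraction.2.1 : ProbabilityMeasure Quality) : Measure Quality) := by
  rcases Q.mccall.autarky_le.eq_or_lt with he | hlt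
  · simp [he]
  have hpos := Q.mccall.probGood_pos
  have hint : ENNReal.ofReal (1 - McCall.probGood F u) * ENNReal.ofReal (u - autarkyPayoff F k) ≤
      ∫⁻ m, (if ENNReal.ofReal (autarkyPayoff F k) ≤
      ENNReal.ofReal ((m : Quality) : ℝ) then 0 else ENNReal.ofReal (u - autarkyPayoff F k))
      ∂((Q.extraction.2.1 : ProbabilityMeasure Quality) : Measure Quality) := by
    refine (mul_le_mul_left (Q.mccall.le_poolSignal_lt hlt) _).trans ?_
    rw [mul_comm, ← lintegral_indicator_const (measurableSet_lt_quality _)]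
    refine lintegral_mono fun m => ?_
    by_cases hm : (m : ℝ) < autarkyPayoff F k
    · have : ¬ ENNReal.ofReal (autarkyPayoff F k) ≤ ENNReal.ofReal (m : ℝ) := by
        rw [not_le]; exact ENNReal.ofReal_lt_ofReal_iff_of_nonneg m.2.1 |>.2 hm
      simp [hm, this]
    · simp [hm]
  refine le_trans ?_ (add_le_add_right hint _)
  change _ ≤ ENNReal.ofReal _ + _
  rw [← ENNReal.ofReal_mul (sub_nonneg.2 McCall.probGood_le_one), ← ENNReal.ofReal_add]
  · exact ENNReal.ofReal_le_ofReal (by linarith)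
  · exact mul_nonneg hpos.le (sub_nonneg.2 hlt.le)
  · exact mul_nonneg (sub_nonneg.2 McCall.probGood_le_one) (sub_nonneg.2 hlt.le)

theorem oneShotOptimal (hF : (F : Measure Quality) ≪ volume) :
    OneShotOptimal k Q.off Q.buy (fun t h => Q.agentPayoff t (Q.state t h))
      (fun t h => Q.brokerPayoff t (Q.state t h)) Q.interim where
  hoff := Q.measurable_off
  hbuy := Q.measurable_buy
  hW t := (measurable_of_finite (Q.agentPayoff t)).comp (Q.measurable_state t)
  hV t := (measurable_of_finite (Q.brokerPayoff t)).comp (Q.measurable_state t)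
  W_le t h := Q.agentPayoff_le_one _ _
  V_le t h := Q.brokerPayoff_le_one _ _
  interim_le t h o w := by
    simp only [state_snoc]
    cases hs : Q.state t h
    · simp only [nextActive_false, agentPayoff_false, Q.interim_of_inactive hs]
      cases w
      · simp [coe_priorMeanPt, Q.autarky_le_priorMean]
      · exact (tsub_le_iff_right.1 (le_max_right _ _))
    · by_cases ho : o = Q.target t
      · subst ho
        rw [Q.interim_target hs]
        cases w
        · have h1 : ∀ m, nextActive (Q.target t) true (Q.target t, false, m) = false := fun m =>
            eq_false_of_ne_true fun h => by simpa using ((nextActive_target _ _ _).1 h).1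
          have h2 : ENNReal.ofReal (priorMean F) ≤ ENNReal.ofReal (Q.w t + k) := by
            have := Q.le_w t
            exact ENNReal.ofReal_le_ofReal (by unfold autarkyPayoff at this; linarith)
          simpa [h1, coe_priorMeanPt] using ⟨h2, Q.autarky_le_priorMean.trans h2⟩
        · exact (Q.target_interim hF t).le
      -- Here the regime condition enters: buying an unplanned offer leads to the inactive state and
      -- yields at most `E max(θ, L) ≤ u` before the price, while rejecting it preserves `u`.
      · simp only [nextActive_of_ne ho, Q.interim_of_ne hs ho]
        have hA := Q.expMax_le_of_state hs
        cases w
        · have h2 : ENNReal.ofReal (priorMean F) ≤ ENNReal.ofReal u :=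
            ENNReal.ofReal_le_ofReal ((priorMean_le_expMax _).trans hA)
          simpa [coe_priorMeanPt] using h2
        · simp only [Bool.not_true, agentPayoff_false, signalLaw_true, payment_true]
          refine (offerValue_ofReal _ o).le.trans (le_add_right (ENNReal.ofReal_le_ofReal ?_))
          exact (expMax_signal_le _ _).trans hA
  le_interim t h o := by
    simp only [state_snoc]
    cases hs : Q.state t h
    · simp only [nextActive_false, agentPayoff_false, Q.interim_of_inactive hs]
      by_cases ho : (o.1 : ℝ≥0∞) + ENNReal.ofReal (priorMean F) ≤
        offerValue (ENNReal.ofReal (autarkyPayoff F k)) o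
      · rw [Q.buy_of_le hs ho]
        simp only [payment_true, signalLaw_true]
        change _ ≤ offerValue (ENNReal.ofReal (autarkyPayoff F k)) o
        have h1 : (o.1 : ℝ≥0∞) ≤ offerValue (ENNReal.ofReal (autarkyPayoff F k)) o :=
          le_self_add.trans ho
        rw [max_add, tsub_add_cancel_of_le h1, add_comm]
        exact max_le ho le_rfl
      · rw [Q.buy_of_not_le hs ho]
        have h1 : offerValue (ENNReal.ofReal (autarkyPayoff F k)) o - o.1 ≤
            ENNReal.ofReal (priorMean F) :=
          tsub_le_iff_left.2 (not_le.1 ho).le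
        simp [coe_priorMeanPt, h1]
    · by_cases ho : o = Q.target t
      · subst ho
        rw [Q.interim_target hs, Q.buy_target hs]
        exact (Q.target_interim hF t).ge
      · rw [Q.interim_of_ne hs ho, Q.buy_of_ne hs ho]
        simp [nextActive_of_ne ho]
  promise t h := by
    have hk := Q.mccall.pos
    cases hs : Q.state t h
    · rw [Q.off_of_inactive hs, Q.interim_of_inactive hs, offerValue_extraction,
        ENNReal.add_sub_cancel_left ENNReal.coe_ne_top, max_self, agentPayoff_false,
        ← ENNReal.ofReal_add Q.mccall.autarky_pos.le hk.le]
      simp [autarkyPayoff]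
    · rw [Q.off_of_active hs, Q.interim_target hs,
        ENNReal.ofReal_add (Q.mccall.autarky_pos.trans_le (Q.le_w t)).le hk.le]
      simp [agentPayoff]
  broker_le t h o := by
    simp only [state_snoc]
    cases hs : Q.state t h
    · simp only [nextActive_false, agentPayoff_false, brokerPayoff_false]
      by_cases ho : (o.1 : ℝ≥0∞) + ENNReal.ofReal (priorMean F) ≤
        offerValue (ENNReal.ofReal (autarkyPayoff F k)) o
      · rw [Q.buy_of_le hs ho]
        exact Q.inactive_broker_le ho
      · rw [Q.buy_of_not_le hs ho]
        simp [coe_priorMeanPt, Q.autarky_le_priorMean]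
    · by_cases ho : o = Q.target t
      · subst ho
        rw [Q.buy_target hs]
        simp only [Q.target_broker]
        simp [brokerPayoff, target]
      -- An unplanned offer is not sold, and the state stays active, where the broker's next payoff
      -- is zero.
      · rw [Q.buy_of_ne hs ho]
        simp [nextActive_of_ne ho]
  le_broker t h := by
    simp only [state_snoc]
    cases hs : Q.state t h
    · rw [Q.off_of_inactive hs, Q.buy_of_le hs Q.offerValue_extraction.ge]
      simp only [nextActive_false, agentPayoff_false, brokerPayoff_false]
      exact Q.le_extraction_broker
    · rw [Q.off_of_active hs, Q.buy_target hs]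
      simp [brokerPayoff, target]

/-- The payoffs of the automaton equilibrium. -/
theorem mem_equilibriumPayoffs (hF : (F : Measure Quality) ≪ volume) :
    ((if Q.init = true then (Q.p 0 : ℝ) else u - autarkyPayoff F k),
      (if Q.init = true then Q.w 0 else autarkyPayoff F k)) ∈ equilibriumPayoffs F k := by
  have H := Q.oneShotOptimal hF
  have hk := Q.mccall.pos
  refine ⟨H.broker, H.agent, H.isEquilibrium hk, ?_, ?_⟩
  · rw [H.brokerValue_eq hk]
    change ((Q.brokerPayoff 0 Q.init : ℝ≥0∞) : EReal) = _
    unfold brokerPayoff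
    split_ifs
    · rfl
    · rw [EReal.coe_ennreal_ofReal, max_eq_left (sub_nonneg.2 Q.mccall.autarky_le)]
  · rw [H.agentValue_eq hk]
    change ((Q.agentPayoff 0 Q.init : ℝ≥0∞) : EReal) = _
    unfold agentPayoff
    rw [EReal.coe_ennreal_ofReal, max_eq_left]
    have h1 := Q.mccall.autarky_pos
    have h2 := Q.le_w 0
    split_ifs <;> linarith

end Plan

/-! ### Payoffs attained by the automata -/

namespace McCall

variable {k u : ℝ}

theorem extraction_mem (H : McCall F k u) (hF : (F : Measure Quality) ≪ volume) :
    (u - autarkyPayoff F k, autarkyPayoff F k) ∈ equilibriumPayoffs F k := by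
  have h1 := H.autarky_le
  -- With an inactive start the active data are never used; any admissible values will do.
  let Q : Plan F k u :=
    { mccall := H
      p := fun _ => 0
      α := fun _ => 1
      hα := fun _ => by simp
      w := fun _ => u
      w_eq := fun _ => by simp
      le_w := fun _ => h1
      w_succ := fun _ => rfl
      p_succ := fun _ => rfl
      init := false
      hinit := by simp }
  simpa using Q.mem_equilibriumPayoffs hF

theorem feasible_subset (H : McCall F k u) (hF : (F : Measure Quality) ≪ volume)
    (hA : expMax F (autarkyPayoff F k) ≤ u) :
    feasiblePayoffs F k u ⊆ equilibriumPayoffs F k := by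
  rintro ⟨y₁, y₂⟩ ⟨hy₁, -, hy₂, hsum⟩
  simp only at hy₁ hy₂ hsum
  have hpos : 0 < u - autarkyPayoff F k :=
    sub_pos.2 (H.autarky_lt.trans_le ((priorMean_le_expMax _).trans hA))
  -- Chosen so that `w 0 = y₂` when the first price is `y₁`: the surplus over autarky, `y₁ + y₂ -
  -- L`, is the fraction `α₀` of `u - L`.
  let α₀ := (y₁ + y₂ - autarkyPayoff F k) / (u - autarkyPayoff F k)
  have hα₀ : α₀ ∈ Set.Icc (0 : ℝ) 1 :=
    ⟨div_nonneg (by linarith) hpos.le, (div_le_one hpos).2 (by linarith)⟩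
  have hα₀' : α₀ * (u - autarkyPayoff F k) = y₁ + y₂ - autarkyPayoff F k :=
    div_mul_cancel₀ _ hpos.ne'
  let Q : Plan F k u :=
    { mccall := H
      p := fun t => if t = 0 then Real.toNNReal y₁ else 0
      α := fun t => if t = 0 then α₀ else 1
      hα := fun t => by split_ifs <;> [exact hα₀; simp]
      w := fun t => if t = 0 then y₂ else u
      w_eq := fun t => by
        split_ifs
        · rw [hα₀', Real.coe_toNNReal _ hy₁]; ring
        · simp
      le_w := fun t => by split_ifs <;> linarith
      w_succ := fun t => by simp
      p_succ := fun t => by simp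
      init := true
      hinit := fun _ => hA }
  have := Q.mem_equilibriumPayoffs hF
  simp only [if_true, Q, Real.coe_toNNReal _ hy₁] at this
  exact this

end McCall

/-! ### Bounds on equilibrium payoffs -/

theorem lintegral_bool (ν : Measure Bool) (g : Bool → ℝ≥0∞) :
    ∫⁻ d, g d ∂ν = g true * ν {true} + g false * ν {false} := by
  rw [lintegral_fintype, Fintype.sum_bool]

theorem measure_true_add_false (ν : Measure Bool) [IsProbabilityMeasure ν] :
    ν {true} + ν {false} = 1 := by
  have := lintegral_bool ν fun _ => 1
  simpa only [lintegral_const, measure_univ, one_mul] using this.symm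

theorem lintegral_signalLaw_max_le (o : Offer F) (w : Bool) (x : ℝ) :
    ∫⁻ m, max (ENNReal.ofReal ((m : Quality) : ℝ)) (ENNReal.ofReal x) ∂signalLaw o w ≤
      ENNReal.ofReal (expMax F x) := by
  cases w
  · rw [signalLaw_false, lintegral_dirac, ← ofReal_max]
    exact ENNReal.ofReal_le_ofReal (max_le (priorMean_le_expMax x) (le_expMax x))
  · exact (lintegral_max _ _).le.trans (ENNReal.ofReal_le_ofReal (expMax_signal_le _ _))

/-- In the sum of payoffs the prices cancel, leaving consumption net of search costs. The constant
`u` is superharmonic for that problem, because no signal makes `E max(m, u)` exceed `E max(θ, u) = u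
+ k`. -/
theorem McCall.value_add_value_le {k u : ℝ} (H : McCall F k u) (b : BrokerStrategy F)
    (a : AgentStrategy F) (t : ℕ) (h : History F t) :
    value b a Stage.consumption t h + value b a Stage.payment t h ≤
      ENNReal.ofReal u + value b a (Stage.cost k) t h := by
  rw [← value_add measurable_consumption]
  refine value_le_of_superharmonic (measurable_consumption.add measurable_payment)
    (measurable_cost k) (W := fun _ _ => ENNReal.ofReal u) (fun t h => ?_) t h
  have hu := H.autarky_pos.trans_le H.autarky_le
  have h1 : ∀ s : Stage F, (Stage.consumption + Stage.payment : Stage F → ℝ≥0∞) s +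
      (if s.stops = true then 0 else ENNReal.ofReal u) =
      Stage.payment s + total Stage.consumption (fun _ => ENNReal.ofReal u) h s := fun s => by
    rw [Pi.add_apply]; unfold total; ring
  have hm := measurable_total measurable_consumption (measurable_const (a := ENNReal.ofReal u)) h
  rw [lintegral_congr h1, lintegral_add_left measurable_payment, OneShotOptimal.lintegral_cost, add_comm, ← add_assoc,
    add_right_comm]
  refine add_le_add_left ?_ _
  rw [← ENNReal.ofReal_add hu.le H.pos.le, ← H.expMax_eq, lintegral_stageKernel _ _ _ hm]
  simp only [lintegral_total_response _ _ _ measurable_consumption measurable_const]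
  refine (lintegral_mono (g := fun _ => ENNReal.ofReal (expMax F u)) fun o =>
    (lintegral_mono (g := fun _ => ENNReal.ofReal (expMax F u)) fun w =>
      (lintegral_mono fun m => ?_).trans (lintegral_signalLaw_max_le o w u)).trans ?_).trans ?_
  · refine (lintegral_mono fun d => total_consumption_le (fun _ _ => ENNReal.ofReal u)
      h o w m d).trans ?_
    rw [lintegral_const, measure_univ, mul_one]
  · rw [lintegral_const, measure_univ, mul_one]
  · rw [lintegral_const, measure_univ, mul_one]

/-- The left side is a real number, so `C = ∞` would make the right side `-∞`; finiteness of `C` is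
a consequence. -/
theorem add_le_add_of_coe_sub_le {M M' C C' : ℝ≥0∞} (hM : M ≠ ∞) (hM' : M' ≠ ∞) (hC' : C' ≠ ∞)
    (h : (M' : EReal) - (C' : EReal) ≤ (M : EReal) - (C : EReal)) : M' + C ≤ M + C' := by
  lift M to ℝ≥0 using hM
  lift M' to ℝ≥0 using hM'
  lift C' to ℝ≥0 using hC'
  by_cases hC : C = ∞
  · subst hC
    exfalso
    simp only [EReal.coe_nnreal_eq_coe_real, ← EReal.coe_sub, EReal.coe_ennreal_top,
      EReal.sub_top, le_bot_iff] at h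
    exact EReal.coe_ne_bot _ h
  lift C to ℝ≥0 using hC
  simp only [EReal.coe_nnreal_eq_coe_real, ← EReal.coe_sub, EReal.coe_le_coe_iff] at h
  have : (M' : ℝ) + C ≤ M + C' := by linarith
  exact_mod_cast this

/-! ### Test deviations and their payoffs -/

/-- The agent buys in period `T` only, and stops if and only if the realized posterior mean is at
least his autarky payoff. -/
def cautiousAgent (F : ProbabilityMeasure Quality) (k : ℝ) (T : ℕ) : AgentStrategy F :=
  detAgent (fun t _ => decide (t = T)) (fun _ => measurable_const)
    (fun _ _ => ENNReal.ofReal (autarkyPayoff F k)) (fun _ => measurable_const)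

theorem haltRule_autarky (k : ℝ) {t : ℕ} (h : History F t) (o : Offer F) (w : Bool) (m : Quality) :
    haltRule (fun _ _ => ENNReal.ofReal (autarkyPayoff F k)) t (((h, o), w), m) =
      if ENNReal.ofReal (autarkyPayoff F k) ≤ ENNReal.ofReal (m : ℝ) then true else false := rfl

/-- Outside period `T` the agent declines, observes `m^∅ > L` and consumes at once, so only one
period's reward counts. -/
theorem McCall.value_cautiousAgent {k u : ℝ} (H : McCall F k u) (b : BrokerStrategy F) {T t : ℕ}
    (ht : t ≠ T) (h : History F t) {f : Stage F → ℝ≥0∞} (hf : Measurable f) {c : ℝ≥0∞}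
    (hc : ∀ o, f (o, false, priorMeanPt F, true) = c) :
    value b (cautiousAgent F k T) f t h = c := by
  have hm := measurable_total hf (measurable_value (b := b) (a := cautiousAgent F k T) hf (t + 1)) h
  rw [value_eq_total _ _ _ hf, lintegral_stageKernel _ _ _ hm]
  have h1 : ∀ o, ∫⁻ r, total f (value b (cautiousAgent F k T) f (t + 1)) h (o, r)
      ∂responseKernel (cautiousAgent F k T) t (h, o) = c := fun o => by
    have h2 : ENNReal.ofReal (autarkyPayoff F k) ≤
        ENNReal.ofReal ((priorMeanPt F : Quality) : ℝ) :=
      ENNReal.ofReal_le_ofReal H.autarky_lt.le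
    refine (lintegral_responseKernel_detAgent h o hm).trans ?_
    simp only [ht, decide_false, signalLaw_false, lintegral_dirac, haltRule_autarky, h2, if_true,
      total, stops_mk, hc, add_zero]
  simp only [h1, lintegral_const, measure_univ, mul_one]

/-- The agent follows `a`, but buys for sure in period `T`. -/
def AgentStrategy.buyAt (a : AgentStrategy F) (T : ℕ) : AgentStrategy F where
  buy t := if t = T then Kernel.const _ (Measure.dirac true) else a.buy t
  halt := a.halt
  buy_markov t := by split_ifs <;> infer_instance
  halt_markov := a.halt_markov

/-- The agent follows `a`, but continues for sure in period `T`. -/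
def AgentStrategy.continueAt (a : AgentStrategy F) (T : ℕ) : AgentStrategy F where
  buy := a.buy
  halt t := if t = T then Kernel.const _ (Measure.dirac false) else a.halt t
  buy_markov := a.buy_markov
  halt_markov t := by split_ifs <;> infer_instance

/-- The broker follows `b`, but offers `o` in period `T`. -/
def BrokerStrategy.offerAt (b : BrokerStrategy F) (T : ℕ) (o : Offer F) : BrokerStrategy F where
  offer t := if t = T then Kernel.const _ (Measure.dirac o) else b.offer t
  markov t := by split_ifs <;> infer_instance

section

variable (b : BrokerStrategy F) (a : AgentStrategy F) (f : Stage F → ℝ≥0∞)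

theorem value_buyAt {T t : ℕ} (ht : T < t) : value b (a.buyAt T) f t = value b a f t := by
  refine value_congr (t₀ := t) (fun s hs => ?_) t le_rfl
  have hne : s ≠ T := by omega
  unfold stageKernel responseKernel AgentStrategy.buyAt
  simp only [hne, if_false]

theorem value_continueAt {T t : ℕ} (ht : T < t) :
    value b (a.continueAt T) f t = value b a f t := by
  refine value_congr (t₀ := t) (fun s hs => ?_) t le_rfl
  have hne : s ≠ T := by omega
  unfold stageKernel responseKernel AgentStrategy.continueAt
  simp only [hne, if_false]

theorem value_offerAt {T t : ℕ} (ht : T < t) (o : Offer F) :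
    value (b.offerAt T o) a f t = value b a f t := by
  refine value_congr (t₀ := t) (fun s hs => ?_) t le_rfl
  have hne : s ≠ T := by omega
  unfold stageKernel BrokerStrategy.offerAt
  simp only [hne, if_false]

end

/-- The expected total reward after the history `h`, the offer `o` and the purchase decision `w`. -/
def purchaseValue (b : BrokerStrategy F) (a : AgentStrategy F) (f : Stage F → ℝ≥0∞) {t : ℕ}
    (h : History F t) (o : Offer F) (w : Bool) : ℝ≥0∞ :=
  ∫⁻ m, ∫⁻ d, total f (value b a f (t + 1)) h (o, w, m, d) ∂a.halt t (((h, o), w), m) ∂signalLaw o w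

theorem lintegral_offer_total (a' : AgentStrategy F) {t : ℕ} (h : History F t) (o : Offer F)
    {f : Stage F → ℝ≥0∞} (hf : Measurable f) {φ : History F (t + 1) → ℝ≥0∞} (hφ : Measurable φ) :
    ∫⁻ s, total f φ h s ∂((responseKernel a' t (h, o)).map fun r => (o, r)) =
      ∫⁻ r, total f φ h (o, r) ∂responseKernel a' t (h, o) :=
  lintegral_map (measurable_total hf hφ h) measurable_prodMk_left

namespace IsEquilibrium

variable {k u : ℝ} {b : BrokerStrategy F} {a : AgentStrategy F}

theorem autarky_add_cost_le (E : IsEquilibrium k b a) (H : McCall F k u) (t : ℕ)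
    (h : History F t) :
    ENNReal.ofReal (autarkyPayoff F k) + value b a (Stage.cost k) t h ≤
      value b a Stage.consumption t h := by
  -- The designated purchase period is not `t`, so this deviation is plain autarky, with payoff `m^∅
  -- - k`.
  have h1 := E.agent t h (cautiousAgent F k (t + 1))
  rw [agentValue_lawAt, agentValue_lawAt, H.value_cautiousAgent b (by omega) h
    measurable_consumption (c := ENNReal.ofReal (priorMean F)) (fun o => rfl),
    H.value_cautiousAgent b (by omega) h (measurable_cost k) (c := ENNReal.ofReal k)
    (fun o => by simp)] at h1
  have h2 := add_le_add_of_coe_sub_le (OneShotOptimal.value_consumption_ne_top _ _ _ _)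
    ENNReal.ofReal_ne_top ENNReal.ofReal_ne_top h1
  have h3 : ENNReal.ofReal (priorMean F) =
      ENNReal.ofReal (autarkyPayoff F k) + ENNReal.ofReal k := by
    rw [← ENNReal.ofReal_add H.autarky_pos.le H.pos.le]; simp [autarkyPayoff]
  rw [h3, add_right_comm] at h2
  exact ENNReal.le_of_add_le_add_right ENNReal.ofReal_ne_top h2

theorem cost_le_one (E : IsEquilibrium k b a) (H : McCall F k u) (t : ℕ) (h : History F t) :
    value b a (Stage.cost k) t h ≤ 1 :=
  (le_add_self.trans (E.autarky_add_cost_le H t h)).trans (value_consumption_le_one _ _ _ _)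

theorem cost_ne_top (E : IsEquilibrium k b a) (H : McCall F k u) (t : ℕ) (h : History F t) :
    value b a (Stage.cost k) t h ≠ ∞ := ne_top_of_le_ne_top ENNReal.one_ne_top (E.cost_le_one H t h)

theorem autarky_add_payment_le (E : IsEquilibrium k b a) (H : McCall F k u) (t : ℕ)
    (h : History F t) :
    ENNReal.ofReal (autarkyPayoff F k) + value b a Stage.payment t h ≤ ENNReal.ofReal u := by
  refine ENNReal.le_of_add_le_add_right (E.cost_ne_top H t h) ?_
  rw [add_right_comm]
  exact (add_le_add_left (E.autarky_add_cost_le H t h) _).trans (H.value_add_value_le b a t h)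

/-- A bad posterior mean is followed by further search. -/
theorem halt_eq_zero (E : IsEquilibrium k b a) (H : McCall F k u) {t : ℕ} (h : History F t)
    (o : Offer F) (w : Bool) {m : Quality} (hm : (m : ℝ) < autarkyPayoff F k) :
    a.halt t (((h, o), w), m) {true} = 0 := by
  have hd : Measurable fun d : Bool => ((o, w, m, d) : Stage F) := measurable_of_finite _
  have h1 := E.agent_stopping t h o w m (a.continueAt t)
  rw [lawAtSignal, lawAtSignal, agentValue_pathLaw, agentValue_pathLaw] at h1
  have hprob : ∀ a : AgentStrategy F,
      IsProbabilityMeasure ((a.halt t (((h, o), w), m)).map fun d => (o, w, m, d)) := fun a =>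
    Measure.isProbabilityMeasure_map hd.aemeasurable
  have hpay : payment o w ≠ ∞ := by unfold payment; split_ifs <;> simp
  have hcont : ∀ {f : Stage F → ℝ≥0∞}, Measurable f →
      ∫⁻ s, total f (value b (a.continueAt t) f (t + 1)) h s
        ∂(((a.continueAt t).halt t (((h, o), w), m)).map fun d => (o, w, m, d)) =
      f (o, w, m, false) + value b a f (t + 1) (snoc h (o, w, m)) := fun hf => by
    rw [lintegral_map (measurable_total hf (measurable_value hf _) h) hd,
      value_continueAt b a _ (Nat.lt_succ_self t)]
    simp [AgentStrategy.continueAt, total]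
  have hself : ∀ {f : Stage F → ℝ≥0∞}, Measurable f →
      ∫⁻ s, total f (value b a f (t + 1)) h s
        ∂((a.halt t (((h, o), w), m)).map fun d => (o, w, m, d)) =
      f (o, w, m, true) * a.halt t (((h, o), w), m) {true} +
        (f (o, w, m, false) + value b a f (t + 1) (snoc h (o, w, m))) *
          a.halt t (((h, o), w), m) {false} := fun hf => by
    rw [lintegral_map (measurable_total hf (measurable_value hf _) h) hd, lintegral_bool]
    simp [total]
  rw [hcont measurable_consumption, hcont (measurable_cost k), hself measurable_consumption,
    hself (measurable_cost k)] at h1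
  simp only [consumption_mk, cost_mk, if_true, Bool.false_eq_true, if_false, zero_add] at h1
  have h2 := E.autarky_add_cost_le H (t + 1) (snoc h (o, w, m))
  have hM := OneShotOptimal.value_consumption_ne_top b a (t + 1) (snoc h (o, w, m))
  have hC := E.cost_ne_top H (t + 1) (snoc h (o, w, m))
  have hν := measure_true_add_false (a.halt t (((h, o), w), m))
  have hν1 : a.halt t (((h, o), w), m) {true} ≠ ∞ := measure_ne_top _ _
  have hν0 : a.halt t (((h, o), w), m) {false} ≠ ∞ := measure_ne_top _ _
  generalize a.halt t (((h, o), w), m) {true} = ν₁ at *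
  generalize a.halt t (((h, o), w), m) {false} = ν₀ at *
  generalize value b a Stage.consumption (t + 1) (snoc h (o, w, m)) = M at *
  generalize value b a (Stage.cost k) (t + 1) (snoc h (o, w, m)) = C at *
  generalize payment o w = p at *
  have h3 := add_le_add_of_coe_sub_le (by finiteness) hM (by finiteness) h1
  have hL := H.autarky_pos
  have hk := H.pos
  lift ν₁ to ℝ≥0 using hν1
  lift ν₀ to ℝ≥0 using hν0
  lift M to ℝ≥0 using hM
  lift C to ℝ≥0 using hC
  lift p to ℝ≥0 using hpay
  have hm0 := m.2.1
  simp only [ENNReal.ofReal] at h2 h3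
  norm_cast at h2 h3 hν
  have h2' := NNReal.coe_le_coe.2 h2
  have h3' := NNReal.coe_le_coe.2 h3
  have hν' : (ν₁ : ℝ) + ν₀ = 1 := by exact_mod_cast hν
  push_cast [Real.coe_toNNReal _ hL.le, Real.coe_toNNReal _ hm0, Real.coe_toNNReal _ hk.le] at h2' h3'
  have hν0' : (ν₀ : ℝ) = 1 - ν₁ := by linarith
  rw [hν0'] at h3'
  -- Stopping with probability `ν₁` loses `ν₁ (M - C - m)` against continuing for sure, and `M - C ≥
  -- L > m`.
  have h4 : (ν₁ : ℝ) * (autarkyPayoff F k - m) ≤ 0 := by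
    have h5 : (ν₁ : ℝ) * (autarkyPayoff F k + C - M) ≤ 0 :=
      mul_nonpos_of_nonneg_of_nonpos ν₁.coe_nonneg (by linarith)
    nlinarith
  have h6 : (ν₁ : ℝ) = 0 := by
    by_contra hne
    have : 0 < (ν₁ : ℝ) := lt_of_le_of_ne ν₁.coe_nonneg (Ne.symm hne)
    have := mul_pos this (sub_pos.2 hm)
    linarith
  exact_mod_cast h6

end IsEquilibrium

section

variable (b : BrokerStrategy F) (a : AgentStrategy F) {t : ℕ} (h : History F t) (o : Offer F)
  {f : Stage F → ℝ≥0∞}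

theorem lintegral_response_self (hf : Measurable f) :
    ∫⁻ r, total f (value b a f (t + 1)) h (o, r) ∂responseKernel a t (h, o) =
      purchaseValue b a f h o true * a.buy t (h, o) {true} +
        purchaseValue b a f h o false * a.buy t (h, o) {false} := by
  rw [lintegral_total_response _ _ _ hf (measurable_value hf _), lintegral_bool]
  rfl

theorem lintegral_response_buyAt (hf : Measurable f) :
    ∫⁻ r, total f (value b (a.buyAt t) f (t + 1)) h (o, r) ∂responseKernel (a.buyAt t) t (h, o) =
      purchaseValue b a f h o true := by
  rw [lintegral_total_response _ _ _ hf (measurable_value hf _),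
    value_buyAt b a _ (Nat.lt_succ_self t)]
  simp only [AgentStrategy.buyAt, if_true, Kernel.const_apply, lintegral_dirac]
  rfl

end

/-- After a mean below `L`, one autarkic period yields `m^∅ = L + k` at cost `k`. The constant `c`
is the expected cost of that extra period; carried on both sides, it cancels and leaves `E max(m,
L)` against price and search cost. -/
theorem McCall.lintegral_response_cautious {k u : ℝ} (H : McCall F k u) (b : BrokerStrategy F)
    {t : ℕ} (h : History F t) (o : Offer F) :
    ∃ c : ℝ≥0∞, c ≠ ∞ ∧
      ∫⁻ r, total Stage.consumption (value b (cautiousAgent F k t) Stage.consumption (t + 1)) h (o, r)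
        ∂responseKernel (cautiousAgent F k t) t (h, o) =
          offerValue (ENNReal.ofReal (autarkyPayoff F k)) o + c ∧
      ∫⁻ r, total (Stage.cost k) (value b (cautiousAgent F k t) (Stage.cost k) (t + 1)) h (o, r)
        ∂responseKernel (cautiousAgent F k t) t (h, o) = o.1 + ENNReal.ofReal k + c := by
  have hh : ∀ m : Quality, haltRule (fun _ _ => ENNReal.ofReal (autarkyPayoff F k)) t
      (((h, o), true), m) =
      if ENNReal.ofReal (autarkyPayoff F k) ≤ ENNReal.ofReal (m : ℝ) then true else false :=
    fun m => rfl
  have hms : MeasurableSet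
      {m : Quality | ENNReal.ofReal (autarkyPayoff F k) ≤ ENNReal.ofReal (m : ℝ)} :=
    measurableSet_le measurable_const (by fun_prop)
  have hmc : Measurable fun m : Quality => if ENNReal.ofReal (autarkyPayoff F k) ≤
      ENNReal.ofReal (m : ℝ) then 0 else ENNReal.ofReal k :=
    Measurable.ite hms measurable_const measurable_const
  refine ⟨∫⁻ m, (if ENNReal.ofReal (autarkyPayoff F k) ≤ ENNReal.ofReal ((m : Quality) : ℝ) then 0
    else ENNReal.ofReal k) ∂((o.2.1 : ProbabilityMeasure Quality) : Measure Quality), ?_, ?_, ?_⟩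
  · refine ne_top_of_le_ne_top (ENNReal.ofReal_ne_top (r := k))
      ((lintegral_mono (g := fun _ => ENNReal.ofReal k) fun m => ?_).trans (by simp))
    dsimp only
    split_ifs <;> simp
  · refine (lintegral_responseKernel_detAgent h o (measurable_total measurable_consumption
      (measurable_value measurable_consumption _) h)).trans ?_
    rw [offerValue, ← lintegral_add_right _ hmc]
    simp only [decide_true, signalLaw_true]
    refine lintegral_congr fun m => ?_
    rw [hh]
    split_ifs with hm
    · simp [total, hm]
    · have h3 : ENNReal.ofReal (priorMean F) =
          ENNReal.ofReal (autarkyPayoff F k) + ENNReal.ofReal k := by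
        rw [← ENNReal.ofReal_add H.autarky_pos.le H.pos.le]; simp [autarkyPayoff]
      rw [max_eq_right (not_le.1 hm).le, ← h3]
      simp only [total, consumption_mk, stops_mk, Bool.false_eq_true, if_false, zero_add]
      exact H.value_cautiousAgent b (by omega) _ measurable_consumption fun o => rfl
  · refine (lintegral_responseKernel_detAgent h o (measurable_total (measurable_cost k)
      (measurable_value (measurable_cost k) _) h)).trans ?_
    have h4 : (o.1 : ℝ≥0∞) + ENNReal.ofReal k = ∫⁻ _ : Quality, ((o.1 : ℝ≥0∞) + ENNReal.ofReal k)
        ∂((o.2.1 : ProbabilityMeasure Quality) : Measure Quality) := by simp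
    rw [h4, ← lintegral_add_right _ hmc]
    simp only [decide_true, signalLaw_true]
    refine lintegral_congr fun m => ?_
    rw [hh]
    split_ifs with hm
    · simp [total]
    · simp only [total, cost_mk, payment_true, stops_mk, Bool.false_eq_true, if_false]
      congr 1
      exact H.value_cautiousAgent b (by omega) _ (measurable_cost k) fun o => by simp

namespace IsEquilibrium

variable {k u : ℝ} {b : BrokerStrategy F} {a : AgentStrategy F}

theorem purchaseValue_consumption_ne_top {t : ℕ} (h : History F t) (o : Offer F) (w : Bool) :
    purchaseValue b a Stage.consumption h o w ≠ ∞ := by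
  refine ne_top_of_le_ne_top ENNReal.one_ne_top ((lintegral_mono (g := fun _ => 1) fun m =>
    (lintegral_mono (g := fun _ => 1) fun d => ?_).trans (by
      rw [lintegral_const, measure_univ, mul_one])).trans (by
      rw [lintegral_const, measure_univ, mul_one]))
  cases d
  · simpa [total] using value_consumption_le_one b a _ _
  · simpa [total] using m.2.2

theorem purchaseValue_cost_ne_top (E : IsEquilibrium k b a) (H : McCall F k u) {t : ℕ}
    (h : History F t) (o : Offer F) (w : Bool) :
    purchaseValue b a (Stage.cost k) h o w ≠ ∞ := by
  have hpay : payment o w ≠ ∞ := by unfold payment; split_ifs <;> simp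
  refine ne_top_of_le_ne_top (b := payment o w + ENNReal.ofReal k + 1) (by finiteness)
    ((lintegral_mono (g := fun _ => payment o w + ENNReal.ofReal k + 1) fun m =>
    (lintegral_mono (g := fun _ => payment o w + ENNReal.ofReal k + 1) fun d => ?_).trans (by
      rw [lintegral_const, measure_univ, mul_one])).trans (by
      rw [lintegral_const, measure_univ, mul_one]))
  cases d
  · simp only [total, cost_mk, stops_mk, Bool.false_eq_true, if_false]
    exact add_le_add_right (E.cost_le_one H _ _) _
  · simp [total]

/-- After a rejection the agent either consumes `m^∅` or searches on, for a net payoff of at most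
`x`. -/
theorem purchaseValue_false_le {x : ℝ}
    (hx : ∀ t h, value b a Stage.consumption t h ≤
      ENNReal.ofReal x + value b a (Stage.cost k) t h) {t : ℕ} (h : History F t) (o : Offer F) :
    purchaseValue b a Stage.consumption h o false + ENNReal.ofReal k ≤
      ENNReal.ofReal (max (priorMean F) x) + purchaseValue b a (Stage.cost k) h o false := by
  unfold purchaseValue
  rw [signalLaw_false, lintegral_dirac, lintegral_dirac, lintegral_bool, lintegral_bool]
  simp only [total, consumption_mk, cost_mk, stops_mk, if_true, Bool.false_eq_true, if_false,
    payment_false, zero_add, add_zero, coe_priorMeanPt, outcome_mk]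
  have h1 := hx (t + 1) (snoc h (o, false, priorMeanPt F))
  have hν := measure_true_add_false (a.halt t (((h, o), false), priorMeanPt F))
  generalize a.halt t (((h, o), false), priorMeanPt F) {true} = ν₁ at *
  generalize a.halt t (((h, o), false), priorMeanPt F) {false} = ν₀ at *
  generalize value b a Stage.consumption (t + 1) _ = M at *
  generalize value b a (Stage.cost k) (t + 1) _ = C at *
  have e : ENNReal.ofReal k = ENNReal.ofReal k * (ν₁ + ν₀) := by rw [hν, mul_one]
  have e' : ENNReal.ofReal (max (priorMean F) x) =
      ENNReal.ofReal (max (priorMean F) x) * (ν₁ + ν₀) := by rw [hν, mul_one]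
  calc _ = (ENNReal.ofReal (priorMean F) + ENNReal.ofReal k) * ν₁ +
        (M + ENNReal.ofReal k) * ν₀ := by
        conv_lhs => rw [e]
        ring
    _ ≤ (ENNReal.ofReal (max (priorMean F) x) + ENNReal.ofReal k) * ν₁ +
        (ENNReal.ofReal (max (priorMean F) x) + C + ENNReal.ofReal k) * ν₀ := by
        gcongr
        · exact le_max_left _ _
        · refine h1.trans ?_
          gcongr
          exact le_max_right _ _
    _ = _ := by
        conv_rhs => rw [e']
        ring

/-- If rejection had positive probability, optimality against sure purchase would make it at least
as good as buying, so the mixture would be worth at most the rejection payoff. That is strictly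
below what the cautious deviation guarantees. -/
theorem rejection_eq_zero {β₁ β₀ M₁ M₀ C₁ C₀ I X K p : ℝ} (h0 : 0 ≤ β₀) (h1 : 0 ≤ β₁) (hβ : β₁ + β₀ = 1)
    (hbuy : M₁ + (C₁ * β₁ + C₀ * β₀) ≤ (M₁ * β₁ + M₀ * β₀) + C₁)
    (hcaut : I + (C₁ * β₁ + C₀ * β₀) ≤ (M₁ * β₁ + M₀ * β₀) + (p + K))
    (hrej : M₀ + K ≤ X + C₀) (hp : p + X < I) : β₀ = 0 := by
  by_contra hne
  have hpos : 0 < β₀ := lt_of_le_of_ne h0 (Ne.symm hne)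
  have e : β₁ = 1 - β₀ := by linarith
  subst e
  have h2 : 0 ≤ β₀ * ((M₀ - C₀) - (M₁ - C₁)) := by linarith
  have h3 : 0 ≤ (1 - β₀) * ((M₀ - C₀) - (M₁ - C₁)) :=
    mul_nonneg h1 (nonneg_of_mul_nonneg_right h2 hpos)
  linarith

/-- An offer that is attractive for every continuation payoff is bought. -/
theorem buy_eq_zero (E : IsEquilibrium k b a) (H : McCall F k u) {x : ℝ}
    (hx : ∀ t h, value b a Stage.consumption t h ≤
      ENNReal.ofReal x + value b a (Stage.cost k) t h) {t : ℕ} (h : History F t) {o : Offer F}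
    (ho : (o.1 : ℝ) + max (priorMean F) x < expMax o.2.1 (autarkyPayoff F k)) :
    a.buy t (h, o) {false} = 0 := by
  have hlaw : ∀ (a' : AgentStrategy F), agentValue k t (lawAtOffer b a' h o) =
      ((∫⁻ r, total Stage.consumption (value b a' Stage.consumption (t + 1)) h (o, r)
        ∂responseKernel a' t (h, o) : ℝ≥0∞) : EReal) -
      ((∫⁻ r, total (Stage.cost k) (value b a' (Stage.cost k) (t + 1)) h (o, r)
        ∂responseKernel a' t (h, o) : ℝ≥0∞) : EReal) := fun a' => by
    rw [lawAtOffer, agentValue_pathLaw, lintegral_offer_total _ _ _ measurable_consumption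
      (measurable_value measurable_consumption _), lintegral_offer_total _ _ _ (measurable_cost k)
      (measurable_value (measurable_cost k) _)]
  -- Two deviations are needed: sure purchase under the agent's own continuation, to compare the two
  -- branches, and cautious purchase, which guarantees `E max(m, L) - p - k`.
  have h1 := E.agent_purchase t h o (a.buyAt t)
  have h2 := E.agent_purchase t h o (cautiousAgent F k t)
  obtain ⟨c, hc, hc1, hc2⟩ := H.lintegral_response_cautious b h o
  have hself := lintegral_response_self b a h o measurable_consumption
  have hself' := lintegral_response_self b a h o (measurable_cost k)
  rw [hlaw, hlaw, hself, hself', lintegral_response_buyAt _ _ _ _ measurable_consumption,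
    lintegral_response_buyAt _ _ _ _ (measurable_cost k)] at h1
  rw [hlaw, hlaw, hself, hself', hc1, hc2, offerValue_ofReal] at h2
  have h3 := purchaseValue_false_le hx h o
  have hM₁ := purchaseValue_consumption_ne_top (b := b) (a := a) h o true
  have hM₀ := purchaseValue_consumption_ne_top (b := b) (a := a) h o false
  have hC₁ := E.purchaseValue_cost_ne_top H h o true
  have hC₀ := E.purchaseValue_cost_ne_top H h o false
  have hβ := measure_true_add_false (a.buy t (h, o))
  have hβ1 : a.buy t (h, o) {true} ≠ ∞ := measure_ne_top _ _
  have hβ0 : a.buy t (h, o) {false} ≠ ∞ := measure_ne_top _ _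
  generalize a.buy t (h, o) {true} = β₁ at *
  generalize a.buy t (h, o) {false} = β₀ at *
  generalize purchaseValue b a Stage.consumption h o true = M₁ at *
  generalize purchaseValue b a Stage.consumption h o false = M₀ at *
  generalize purchaseValue b a (Stage.cost k) h o true = C₁ at *
  generalize purchaseValue b a (Stage.cost k) h o false = C₀ at *
  have h4 := add_le_add_of_coe_sub_le (by finiteness) hM₁ hC₁ h1
  have h5 := add_le_add_of_coe_sub_le (by finiteness) (by finiteness) (by finiteness) h2
  rw [add_right_comm, ← add_assoc _ _ c] at h5
  have h6 := ENNReal.le_of_add_le_add_right hc h5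
  have hI : 0 ≤ expMax o.2.1 (autarkyPayoff F k) :=
    integral_nonneg fun m => m.2.1.trans (le_max_left _ _)
  have hX : 0 ≤ max (priorMean F) x := (priorMean_mem F).1.trans (le_max_left _ _)
  lift β₁ to ℝ≥0 using hβ1
  lift β₀ to ℝ≥0 using hβ0
  lift M₁ to ℝ≥0 using hM₁
  lift M₀ to ℝ≥0 using hM₀
  lift C₁ to ℝ≥0 using hC₁
  lift C₀ to ℝ≥0 using hC₀
  have hk := H.pos.le
  simp only [ENNReal.ofReal] at h3 h6
  norm_cast at h3 h4 h6 hβ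
  have h3' := NNReal.coe_le_coe.2 h3
  have h4' := NNReal.coe_le_coe.2 h4
  have h6' := NNReal.coe_le_coe.2 h6
  have hβ' : (β₁ : ℝ) + β₀ = 1 := by exact_mod_cast hβ
  simp only [NNReal.coe_add, NNReal.coe_mul, Real.coe_toNNReal _ hI, Real.coe_toNNReal _ hk,
    Real.coe_toNNReal _ hX] at h3' h4' h6'
  have := rejection_eq_zero β₀.coe_nonneg β₁.coe_nonneg hβ' h4' h6' h3' ho
  exact_mod_cast this

/-- The broker's payoff is at least the payoff from a deviation to an attractive offer. -/
theorem le_payment (E : IsEquilibrium k b a) (H : McCall F k u) {x : ℝ}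
    (hx : ∀ t h, value b a Stage.consumption t h ≤
      ENNReal.ofReal x + value b a (Stage.cost k) t h) {o : Offer F}
    (ho : (o.1 : ℝ) + max (priorMean F) x < expMax o.2.1 (autarkyPayoff F k)) {v : ℝ≥0∞}
    (hv : ∀ t h, v ≤ value b a Stage.payment t h) (t : ℕ) (h : History F t) :
    (o.1 : ℝ≥0∞) + v * ((o.2.1 : ProbabilityMeasure Quality) : Measure Quality)
      {m : Quality | (m : ℝ) < autarkyPayoff F k} ≤ value b a Stage.payment t h := by
  have h1 := E.broker t h (b.offerAt t o)
  rw [brokerValue_lawAt, brokerValue_lawAt, EReal.coe_ennreal_le_coe_ennreal_iff] at h1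
  refine le_trans ?_ h1
  have hm := measurable_total measurable_payment
    (measurable_value (b := b) (a := a) measurable_payment (t + 1)) h
  rw [value_eq_total _ _ _ measurable_payment, value_offerAt b a _ (Nat.lt_succ_self t),
    lintegral_stageKernel _ _ _ hm]
  simp only [BrokerStrategy.offerAt, if_true, Kernel.const_apply, lintegral_dirac]
  have hβ := measure_true_add_false (a.buy t (h, o))
  rw [lintegral_response_self _ _ _ _ measurable_payment, E.buy_eq_zero H hx h ho, mul_zero,
    add_zero]
  rw [E.buy_eq_zero H hx h ho, add_zero] at hβ
  rw [hβ, mul_one, ← lintegral_indicator_const (measurableSet_lt_quality _)]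
  have e : (o.1 : ℝ≥0∞) = ∫⁻ _ : Quality, (o.1 : ℝ≥0∞)
      ∂((o.2.1 : ProbabilityMeasure Quality) : Measure Quality) := by simp
  rw [e, ← lintegral_add_left measurable_const]
  unfold purchaseValue
  refine lintegral_mono fun m => ?_
  dsimp only
  have hν := measure_true_add_false (a.halt t (((h, o), true), m))
  rw [lintegral_bool]
  simp only [total, payment_mk, payment_true, stops_mk, if_true, Bool.false_eq_true, if_false,
    add_zero, outcome_mk]
  -- Below `L` search surely goes on and is worth at least `v` to the broker; elsewhere only the
  -- price is counted.
  by_cases hlt : (m : ℝ) < autarkyPayoff F k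
  · rw [E.halt_eq_zero H h o true hlt, zero_add] at hν
    rw [hν, E.halt_eq_zero H h o true hlt, Set.indicator_of_mem (by simpa using hlt)]
    simpa using hv _ _
  · rw [Set.indicator_of_notMem (by simpa using hlt), add_zero]
    calc (o.1 : ℝ≥0∞) = o.1 * (a.halt t (((h, o), true), m) {true} +
          a.halt t (((h, o), true), m) {false}) := by rw [hν, mul_one]
      _ ≤ _ := by
        rw [mul_add]
        gcongr
        exact le_self_add

/-- Above the threshold, the broker extracts all gains from search. -/
theorem gains_le_payment (E : IsEquilibrium k b a) (H : McCall F k u)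
    (hA : u < expMax F (autarkyPayoff F k)) (t : ℕ) (h : History F t) :
    ENNReal.ofReal (u - autarkyPayoff F k) ≤ value b a Stage.payment t h := by
  -- The infimum runs over all histories, on or off the path, because a deviation may lead to any of
  -- them.
  set v : ℝ≥0∞ := ⨅ t, ⨅ h, value b a Stage.payment t h with hvdef
  have hv : ∀ t h, v ≤ value b a Stage.payment t h := fun t h => iInf₂_le t h
  have hle : ∀ {c : ℝ≥0∞}, (∀ t h, c ≤ value b a Stage.payment t h) → c ≤ v :=
    fun hc => le_iInf₂ hc
  clear_value v
  refine le_trans ?_ (hv t h)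
  have hvu : ENNReal.ofReal (autarkyPayoff F k) + v ≤ ENNReal.ofReal u :=
    (add_le_add_right (hv t h) _).trans (E.autarky_add_payment_le H t h)
  have hvtop : v ≠ ∞ := ne_top_of_le_ne_top ENNReal.ofReal_ne_top (le_add_self.trans hvu)
  lift v to ℝ≥0 using hvtop
  have hL := H.autarky_pos
  have hLu := H.autarky_le
  have hvu' : autarkyPayoff F k + v ≤ u := by
    rw [← ENNReal.ofReal_coe_nnreal, ← ENNReal.ofReal_add hL.le v.coe_nonneg] at hvu
    exact (ENNReal.ofReal_le_ofReal_iff (hL.le.trans hLu)).1 hvu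
  -- The broker's guarantee caps the agent: the sum is at most `u`, so he gets at most `u - v`.
  have hx : ∀ t h, value b a Stage.consumption t h ≤
      ENNReal.ofReal (u - v) + value b a (Stage.cost k) t h := fun t h => by
    refine ENNReal.le_of_add_le_add_right (a := (v : ℝ≥0∞)) ENNReal.coe_ne_top ?_
    refine ((add_le_add_right (hv t h) _).trans (H.value_add_value_le b a t h)).trans ?_
    rw [add_right_comm, ← ENNReal.ofReal_coe_nnreal (p := v),
      ← ENNReal.ofReal_add (by linarith) v.coe_nonneg, sub_add_cancel]
  have key : ∀ o : Offer F, (o.1 : ℝ) + max (priorMean F) (u - v) <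
      expMax o.2.1 (autarkyPayoff F k) → (o.1 : ℝ≥0∞) + v *
        ((o.2.1 : ProbabilityMeasure Quality) : Measure Quality)
          {m : Quality | (m : ℝ) < autarkyPayoff F k} ≤ v := fun o ho =>
    hle fun t h => E.le_payment H hx ho hv t h
  -- Otherwise full revelation at a price between `v` and `expMax F L - (u - v)` is bought and pays
  -- more than `v`. The interval is nonempty precisely because `u < expMax F L`.
  have hxm : u - v ≤ priorMean F := by
    by_contra hc
    push Not at hc
    obtain ⟨p, hp1, hp2⟩ := exists_between (show (v : ℝ) < expMax F (autarkyPayoff F k) - (u - v) by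
      linarith)
    have hp0 : 0 ≤ p := v.coe_nonneg.trans hp1.le
    have := le_self_add.trans (key (Real.toNNReal p, fullSignal F) (by
      rw [max_eq_right hc.le, Real.coe_toNNReal _ hp0]
      change _ < expMax F _
      linarith))
    rw [ENNReal.coe_le_coe] at this
    have := NNReal.coe_le_coe.2 this
    rw [Real.coe_toNNReal _ hp0] at this
    linarith
  rw [← ENNReal.ofReal_coe_nnreal]
  refine ENNReal.ofReal_le_ofReal ?_
  rcases hLu.eq_or_lt with heq | hlt
  · rw [heq, sub_self]; exact v.coe_nonneg
  have hq := H.probGood_pos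
  have hq1 : 0 ≤ 1 - McCall.probGood F u := sub_nonneg.2 McCall.probGood_le_one
  by_contra hc
  push Not at hc
  -- Rejection is now worth at most `m^∅`, so the pooling signal sells at any price `p < q (u - L)`.
  -- With `p > q v` the deviation pays at least `p + (1 - q) v > v` at every history, contradicting
  -- the choice of `v`.
  have hlt' : McCall.probGood F u * v < McCall.probGood F u * (u - autarkyPayoff F k) :=
    mul_lt_mul_of_pos_left hc hq
  obtain ⟨p, hp1, hp2⟩ := exists_between hlt'
  have hp0 : 0 ≤ p := (mul_nonneg hq.le v.coe_nonneg).trans hp1.le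
  have h1 := key (Real.toNNReal p, poolSignal F u) (by
    rw [max_eq_left hxm, Real.coe_toNNReal _ hp0]
    change _ < expMax (poolSignal F u).1 _
    rw [H.expMax_poolSignal]
    linarith)
  have h2 := (add_le_add_right (mul_le_mul_right (H.le_poolSignal_lt hlt) (v : ℝ≥0∞)) _).trans h1
  change ENNReal.ofReal p + _ ≤ _ at h2
  rw [← ENNReal.ofReal_coe_nnreal, ← ENNReal.ofReal_mul v.coe_nonneg,
    ← ENNReal.ofReal_add hp0 (mul_nonneg v.coe_nonneg hq1),
    ENNReal.ofReal_le_ofReal_iff v.coe_nonneg] at h2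
  linarith

/-- All values at the start are finite in equilibrium, so the autarky and surplus bounds become real
inequalities. -/
theorem payoffs_eq_toReal (E : IsEquilibrium k b a) (H : McCall F k u) {y : ℝ × ℝ}
    (h₁ : brokerValue 0 (lawAt b a (emptyHistory F)) = ((y.1 : ℝ) : EReal))
    (h₂ : agentValue k 0 (lawAt b a (emptyHistory F)) = ((y.2 : ℝ) : EReal)) :
    ∃ M C V : ℝ≥0, value b a Stage.payment 0 (emptyHistory F) = V ∧ y.1 = V ∧ y.2 = M - C ∧
      autarkyPayoff F k + C ≤ M ∧ (M : ℝ) + V ≤ u + C := by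
  have hL := E.autarky_add_cost_le H 0 (emptyHistory F)
  have hU := H.value_add_value_le b a 0 (emptyHistory F)
  have hV := E.autarky_add_payment_le H 0 (emptyHistory F)
  have hMtop := OneShotOptimal.value_consumption_ne_top b a 0 (emptyHistory F)
  have hCtop := E.cost_ne_top H 0 (emptyHistory F)
  have hVtop : value b a Stage.payment 0 (emptyHistory F) ≠ ∞ :=
    ne_top_of_le_ne_top ENNReal.ofReal_ne_top (le_add_self.trans hV)
  rw [brokerValue_lawAt] at h₁
  rw [agentValue_lawAt] at h₂
  generalize value b a Stage.payment 0 (emptyHistory F) = V at *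
  generalize value b a Stage.consumption 0 (emptyHistory F) = M at *
  generalize value b a (Stage.cost k) 0 (emptyHistory F) = C at *
  lift M to ℝ≥0 using hMtop
  lift C to ℝ≥0 using hCtop
  lift V to ℝ≥0 using hVtop
  have hL0 := H.autarky_pos.le
  have hu0 := hL0.trans H.autarky_le
  simp only [EReal.coe_nnreal_eq_coe_real, ← EReal.coe_sub, EReal.coe_eq_coe_iff] at h₁ h₂
  simp only [ENNReal.ofReal] at hL hU
  norm_cast at hL hU
  have hL' := NNReal.coe_le_coe.2 hL
  have hU' := NNReal.coe_le_coe.2 hU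
  simp only [NNReal.coe_add, Real.coe_toNNReal _ hL0, Real.coe_toNNReal _ hu0] at hL' hU'
  exact ⟨M, C, V, rfl, h₁.symm, h₂.symm, hL', hU'⟩

end IsEquilibrium

namespace McCall

variable {k u : ℝ}

theorem equilibriumPayoffs_subset (H : McCall F k u) :
    equilibriumPayoffs F k ⊆ feasiblePayoffs F k u := by
  rintro y ⟨b, a, E, h₁, h₂⟩
  obtain ⟨M, C, V, -, hy1, hy2, h3, h4⟩ := E.payoffs_eq_toReal H h₁ h₂
  have := H.autarky_pos
  refine ⟨hy1 ▸ V.coe_nonneg, ?_, ?_, ?_⟩ <;> linarith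

theorem equilibriumPayoffs_subset_singleton (H : McCall F k u)
    (hA : u < expMax F (autarkyPayoff F k)) :
    equilibriumPayoffs F k ⊆ {(u - autarkyPayoff F k, autarkyPayoff F k)} := by
  rintro y ⟨b, a, E, h₁, h₂⟩
  obtain ⟨M, C, V, hV, hy1, hy2, h3, h4⟩ := E.payoffs_eq_toReal H h₁ h₂
  have h5 := E.gains_le_payment H hA 0 (emptyHistory F)
  rw [hV, ← ENNReal.ofReal_coe_nnreal, ENNReal.ofReal_le_ofReal_iff V.coe_nonneg] at h5
  refine Prod.ext ?_ ?_ <;> simp only <;> linarith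

end McCall

end PersuadedSearch
end

/-! ### Assembly and uniqueness of the threshold -/

theorem proposition1 (F : ProbabilityMeasure PersuadedSearch.Quality)
    (hF : (F : Measure PersuadedSearch.Quality) ≪ volume) :
    (∀ k ∈ Set.Ioo 0 (PersuadedSearch.priorMean F),
      ∃! ubar : ℝ, PersuadedSearch.IsMcCallPayoff F k ubar) ∧
    ∃! kstar : ℝ, kstar ∈ Set.Ioo 0 (PersuadedSearch.priorMean F) ∧
      ∀ k ∈ Set.Ioo 0 (PersuadedSearch.priorMean F),
        ∀ ubar : ℝ, PersuadedSearch.IsMcCallPayoff F k ubar →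
          (k ≤ kstar →
            PersuadedSearch.equilibriumPayoffs F k =
              PersuadedSearch.feasiblePayoffs F k ubar) ∧
          (kstar < k →
            PersuadedSearch.equilibriumPayoffs F k =
              {(ubar - PersuadedSearch.autarkyPayoff F k,
                PersuadedSearch.autarkyPayoff F k)}) := by
  open PersuadedSearch in
  have hmc : ∀ k ∈ Set.Ioo 0 (priorMean F), ∀ u, IsMcCallPayoff F k u → McCall F k u :=
    fun k hk u hu => ⟨hk.1, hk.2, isMcCallPayoff_iff.1 hu⟩
  refine ⟨fun k hk => existsUnique_isMcCallPayoff hk, ?_⟩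
  obtain ⟨c, hc, hthr⟩ := exists_threshold hF
  have hmain : ∀ k ∈ Set.Ioo 0 (priorMean F), ∀ u : ℝ, IsMcCallPayoff F k u →
      (k ≤ c → equilibriumPayoffs F k = feasiblePayoffs F k u) ∧
      (c < k → equilibriumPayoffs F k = {(u - autarkyPayoff F k, autarkyPayoff F k)}) := by
    intro k hk u hu
    have H := hmc k hk u hu
    refine ⟨fun hle => H.equilibriumPayoffs_subset.antisymm
      (H.feasible_subset hF (H.expMax_autarky_le_iff.2 ((hthr k hk).1 hle))), fun hlt =>
      (H.equilibriumPayoffs_subset_singleton ?_).antisymm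
        (Set.singleton_subset_iff.2 (H.extraction_mem hF))⟩
    by_contra hcon
    exact not_le.2 hlt ((hthr k hk).2 (H.expMax_autarky_le_iff.1 (not_lt.1 hcon)))
  -- When `L < u` the feasible set contains `(0, u)`, so the two regimes cannot coincide.
  have hdistinct : ∀ k ∈ Set.Ioo 0 (priorMean F), ∀ u : ℝ, IsMcCallPayoff F k u →
      autarkyPayoff F k < u →
      feasiblePayoffs F k u ≠ {(u - autarkyPayoff F k, autarkyPayoff F k)} := by
    intro k hk u hu hlt heq
    have H := hmc k hk u hu
    have hpos := H.autarky_pos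
    have hmem : ((0 : ℝ), u) ∈ feasiblePayoffs F k u :=
      ⟨le_rfl, hpos.le.trans hlt.le, hlt.le, by simp⟩
    rw [heq] at hmem
    exact hlt.ne' (congrArg Prod.snd hmem)
  refine ⟨c, ⟨hc, hmain⟩, fun c' hc' => ?_⟩
  obtain ⟨hc'mem, hc'main⟩ := hc'
  -- A different threshold would assign the opposite regime at some `k` with `L < u`: at `c` itself
  -- if `c' < c`, and just above `c` if `c < c'`.
  rcases lt_trichotomy c' c with hlt | heq | hlt
  · obtain ⟨u, hu, -⟩ := existsUnique_isMcCallPayoff hc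
    have H := hmc c hc u hu
    have hgain : autarkyPayoff F c < u := H.autarky_lt.trans_le ((priorMean_le_expMax _).trans
      (H.expMax_autarky_le_iff.2 ((hthr c hc).1 le_rfl)))
    exact absurd (((hmain c hc u hu).1 le_rfl).symm.trans ((hc'main c hc u hu).2 hlt))
      (hdistinct c hc u hu hgain)
  · exact heq
  -- Gains from search may vanish for larger `k`, and then both descriptions agree; so `k` must be
  -- taken close to `c`, where gains persist by continuity.
  · obtain ⟨k, hk, hkgain⟩ := exists_gains_above hc ((hthr c hc).1 le_rfl) hlt
    have hkmem : k ∈ Set.Ioo 0 (priorMean F) := ⟨hc.1.trans hk.1, hk.2.trans hc'mem.2⟩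
    obtain ⟨u, hu, -⟩ := existsUnique_isMcCallPayoff hkmem
    have H := hmc k hkmem u hu
    have hgain : autarkyPayoff F k < u := by
      refine lt_of_le_of_ne H.autarky_le fun h => ?_
      rw [h, H.eq] at hkgain
      exact lt_irrefl _ hkgain
    exact absurd (((hc'main k hkmem u hu).1 hk.2.le).symm.trans ((hmain k hkmem u hu).2 hk.1))
      (hdistinct k hkmem u hu hgain)
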